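/- Let $\mathbf H(f)(x)=\frac1\pi\,\mathrm{p.v.}\!\int_{\mathbb R}\frac{f(y)}{x-y}\,dy$ be the Hilbert transform on $\mathbb R$. Assume that the real function $\omega_0\in H^1(\mathbb R)$ (identified with its continuous representative) satisfies 1. $\omega_0$ is odd; 2. $x=0$ is the unique zero of $\omega_0$, and $\operatorname{sgn}(\omega_0(x))=-\operatorname{sgn}(x)$; 3. $\omega_0\in C^5(-\delta,\delta)$ for some $\delta>0$, $\omega_0'(0)=0$ and $\omega_0'''(0)<0$. Then $\mathbf H(\omega_0)$ exists at every point and is $C^2$ near $0$, with $\mathbf H(\omega_0)(0)>0$ and $\mathbf H(\omega_0)''(0)>0$. Let $a,b,c>0$ be such that $$\mathbf H(\omega_0)(0)=2a,\qquad \mathbf H(\omega_0)''(0)=4b,\qquad \omega_0'''(0)=-24c,$$ and put $$T=\frac1a,\quad r=\frac{a}{b^{1/2}},\quad \Omega_2(z)=-\frac{a^3b^{3/2}c}{a^4c^2+b^4z^2}.$$ Then $\mathbf H(\Omega_2)(z)=-\dfrac{ab^{7/2}z}{a^4c^2+b^4z^2}$ for all $z\in\mathbb R$. The Constantin–Lax–Majda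 equation $\omega_t=\omega\,\mathbf H(\omega)$ with initial value $\omega_0$ has a solution $\omega\in C([0,T);H^1(\mathbb R))$ (the equation holding pointwise in $x$ and $t$, with the Hilbert transform of $\omega(\cdot,t)$ existing at every point). Every solution in $C([0,T');H^1(\mathbb R))$ with initial value $\omega_0$, for any real $T'$, has $T'\le T$ and coincides with $\omega$ on $[0,T')$. The solution blows up at $T$: $\sup_x|\omega(x,t)|\to\infty$ as $t\to T-0$. Moreover, as $t\to T-0$, for every function $x=x(t)$ with $x=r(T-t)^{1/2}+o((T-t)^{1/2})$, $$\omega(x,t)=\frac1{(T-t)^{3/2}}\Big(\Omega_2\Big(\frac{x-r(T-t)^{1/2}}{T-t}\Big)+o(1)\Big),\qquad \mathbf H(\omega)(x,t)=\frac1{(T-t)^{3/2}}\Big(\mathbf H(\Omega_2)\Big(\frac{x-r(T-t)^{1/2}}{T-t}\Big)+o(1)\Big),$$ and for every function $x=x(t)$ with $x=r(T-t)^{1/2}+O(T-t)$ both formulas hold with $o(1)$ replaced by $O\big((T-t)^{1/2}\big)$. -/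

import Mathlib

open Set Filter Topology MeasureTheory Asymptotics

noncomputable section

/-- `g` is the weak derivative of `f` on the real line: integration by parts against every
smooth compactly supported test function. (Used for square integrable `f` and `g` only.) -/
def IsWeakDeriv (f g : ℝ → ℝ) : Prop :=
  ∀ φ : ℝ → ℝ, ContDiff ℝ (⊤ : ℕ∞) φ → HasCompactSupport φ →
    ∫ x, f x * deriv φ x = - ∫ x, g x * φ x

/-- `f` belongs to the Sobolev space `H¹(ℝ)` of real functions: `f` is square integrable with a
square integrable weak derivative. As usual for statements about point values, `f` denotes the
continuous representative of its class. -/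
structure MemH1 (f : ℝ → ℝ) : Prop where
  continuous : Continuous f
  memLp : MemLp f 2 volume
  weakDeriv : ∃ g : ℝ → ℝ, MemLp g 2 volume ∧ IsWeakDeriv f g

/-- `ω ∈ C([0,T); H¹(ℝ))`: every `ω t` is in `H¹`, and `t ↦ ω t` is continuous for the `H¹` norm
(the sum of the `L²` norms of the function and of its weak derivative). -/
structure ContinuousInH1 (T : ℝ) (ω : ℝ → ℝ → ℝ) : Prop where
  memH1 : ∀ t ∈ Ico 0 T, MemH1 (ω t)
  continuous_norm : ∃ ωx : ℝ → ℝ → ℝ,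
    (∀ t ∈ Ico 0 T, MemLp (ωx t) 2 volume ∧ IsWeakDeriv (ω t) (ωx t)) ∧
    ∀ t ∈ Ico 0 T, Tendsto
      (fun s => eLpNorm (ω s - ω t) 2 volume + eLpNorm (ωx s - ωx t) 2 volume)
      (𝓝[Ico 0 T] t) (𝓝 0)

/-- The truncated singular integral `(1/π) ∫_{|x-y|>ε} f(y)/(x-y) dy`. -/
def truncHilbert (f : ℝ → ℝ) (x ε : ℝ) : ℝ :=
  Real.pi⁻¹ * ∫ y in {y : ℝ | ε < |x - y|}, f y / (x - y)

/-- The Hilbert transform of `f` exists at `x`, as a Cauchy principal value, and equals `h`. -/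
def HasHilbertAt (f : ℝ → ℝ) (x h : ℝ) : Prop :=
  Tendsto (truncHilbert f x) (𝓝[>] 0) (𝓝 h)

/-- The Hilbert transform `H(f)(x) = (1/π) p.v. ∫ f(y)/(x-y) dy`. For `f ∈ H¹(ℝ)` the principal
value exists at every `x` (`f` is square integrable and Hölder continuous of exponent `1/2`). -/
def hilbert (f : ℝ → ℝ) (x : ℝ) : ℝ :=
  limUnder (𝓝[>] (0 : ℝ)) (truncHilbert f x)

/-- `ω` (written `ω t x`) is a solution on `[0,T)` of the Constantin--Lax--Majda equation
`ω_t = ω H(ω)` with initial value `ω₀`, in the class `C([0,T); H¹(ℝ))`. The time derivative is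
one-sided at `t = 0` and two-sided at every `t ∈ (0,T)`. -/
structure IsCLMSolution (ω₀ : ℝ → ℝ) (T : ℝ) (ω : ℝ → ℝ → ℝ) : Prop where
  initial : ω 0 = ω₀
  regular : ContinuousInH1 T ω
  equation : ∀ t ∈ Ico 0 T, ∀ x : ℝ,
    HasDerivWithinAt (fun s => ω s x) (ω t x * hilbert (ω t) x) (Ico 0 T) t

/-- The two-scale profile `Ω₂(z) = - a³ b^{3/2} c / (a⁴ c² + b⁴ z²)`. -/
def profile (a b c z : ℝ) : ℝ :=
  -(a ^ 3 * b ^ (3 / 2 : ℝ) * c) / (a ^ 4 * c ^ 2 + b ^ 4 * z ^ 2)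

end

open scoped FourierTransform SchwartzMap

/-! The equation is solvable in closed form. The function `z = H(ω) + iω` is the boundary value of
an analytic function, and so is `z²`; hence `ω_t = ω H(ω)` is the imaginary part of `z_t = z² / 2`,
whose solution is `z = 2 z₀ / (2 - t z₀)`. The denominator vanishes only where `ω₀ = 0` and `t H(ω₀)
= 2`, that is, at `x = 0` and `t = 1 / a = T`.

The profile comes from expanding the denominator there. Near the origin `H(ω₀) = 2a + 2b x² + O(x⁴)`
and `ω₀ = -4c x³ + O(x⁴)`. With `s = (T - t)^{1/2}` and `x = s (r + η)`, the terms of order `s²` in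
`2 - t z₀` cancel exactly when `r = a / b^{1/2}`. What remains is `s³ (-4 b^{1/2} η / s + 4 i c a² /
b^{3/2})` up to a small relative error, and `η / s` is the argument of the profile. Real and
imaginary parts of the limit are `H(Ω₂)` and `Ω₂` (`exists_rescaled_signal_bound`,
`rescaled_limit_eq`).

The analysis rests on writing an `H¹` function as `𝓕 q` with `q` and `ξ q` square integrable
(`MemH1.exists_hasSpectrum`). The principal value then exists everywhere and is the multiplier `i
sgn ξ` (`HasSpectrum.tendsto_truncHilbert`), so analytic signals are the functions with spectrum in
`[0, ∞)`. That the explicit `z` keeps this property is shown in short time steps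
(`IsHardy.of_resolvent`, `MemH1.isHardy_clmSignal`); therefore `Re z = H(Im z)` and `Im z` solves
the equation (`MemH1.isCLMSolution`).

Uniqueness is an `L²` estimate with Gronwall's inequality (`IsCLMSolution.unique`). Unboundedness at
`T` then excludes any longer solution, since a solution in `C([0,T'); H¹)` is bounded on compact
time intervals. The signs of `H(ω₀)(0)` and `H(ω₀)''(0)` follow from integrals of `-ω₀ / y` and `-ω₀
/ y³` over the half line, the latter after integration by parts. -/

/-! ### Fourier integrals and the Fourier transform on `L²`. -/

theorem integral_schwartz_mul_fourier {q : ℝ → ℂ} (hq : Integrable q) (φ : 𝓢(ℝ, ℂ)) :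
    ∫ x, φ x • 𝓕 q x = ∫ x, 𝓕 φ x • q x := by
  have h := VectorFourier.integral_fourierIntegral_smul_eq_flip (μ := volume) (ν := volume)
    (L := innerₗ ℝ) (e := Real.fourierChar) Real.continuous_fourierChar continuous_inner
    φ.integrable hq
  simp only [flip_innerₗ] at h
  exact h.symm

theorem integral_schwartz_mul_fourierInv {q : ℝ → ℂ} (hq : Integrable q) (φ : 𝓢(ℝ, ℂ)) :
    ∫ x, φ x • 𝓕⁻ q x = ∫ x, 𝓕⁻ φ x • q x := by
  -- `𝓕⁻ (𝓕⁻ φ)` is the reflection of `φ`, so the forward identity applies after `x ↦ -x`.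
  have h := integral_schwartz_mul_fourier hq (𝓕⁻ (𝓕⁻ φ))
  rw [FourierTransform.fourier_fourierInv_eq] at h
  rw [← h, ← integral_neg_eq_self]
  refine integral_congr_ae (.of_forall fun x => ?_)
  simp only [SchwartzMap.fourierInv_coe]
  rw [Real.fourierInv_eq_fourier_neg, Real.fourierInv_eq_fourier_neg]
  rw [neg_neg, ← SchwartzMap.fourierInv_coe, ← SchwartzMap.fourier_coe,
    FourierTransform.fourier_fourierInv_eq]

/-- The bridge between the abstract transform on `Lp`, handled by duality with Schwartz functions,
and concrete formulas. -/
theorem Lp_ae_eq_of_schwartz (u : Lp ℂ 2 (volume : Measure ℝ)) {B : ℝ → ℂ}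
    (hB : LocallyIntegrable B) (h : ∀ φ : 𝓢(ℝ, ℂ), ∫ x, φ x • u x = ∫ x, φ x • B x) :
    u =ᵐ[volume] B := by
  refine ae_eq_of_integral_contDiff_smul_eq ((Lp.memLp u).locallyIntegrable (by norm_num)) hB ?_
  intro g hg hgc
  have hg₁ : HasCompactSupport (Complex.ofRealCLM ∘ g) := hgc.comp_left rfl
  have hg₂ : ContDiff ℝ (⊤ : ℕ∞) (Complex.ofRealCLM ∘ g) := by fun_prop
  simpa using h (hg₁.toSchwartzMap hg₂)

theorem continuous_fourier_of_integrable {q : ℝ → ℂ} (hq : Integrable q) : Continuous (𝓕 q) :=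
  VectorFourier.fourierIntegral_continuous (L := innerₗ ℝ) Real.continuous_fourierChar
    continuous_inner hq

theorem continuous_fourierInv_of_integrable {q : ℝ → ℂ} (hq : Integrable q) :
    Continuous (𝓕⁻ q) := by
  have : 𝓕⁻ q = fun x => 𝓕 q (-x) := funext fun x => Real.fourierInv_eq_fourier_neg q x
  rw [this]
  exact (continuous_fourier_of_integrable hq).comp continuous_neg

theorem fourier_toLp_ae_eq {q : ℝ → ℂ} (hq : Integrable q) (hq2 : MemLp q 2) :
    (𝓕 (hq2.toLp q) : Lp ℂ 2 (volume : Measure ℝ)) =ᵐ[volume] 𝓕 q := by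
  refine Lp_ae_eq_of_schwartz _ (continuous_fourier_of_integrable hq).locallyIntegrable fun φ => ?_
  have h := congrArg (fun D : 𝓢'(ℝ, ℂ) => D φ) (Lp.fourier_toTemperedDistribution_eq (hq2.toLp q))
  simp only [TemperedDistribution.fourier_apply, Lp.toTemperedDistribution_apply] at h
  rw [← h, integral_schwartz_mul_fourier hq]
  refine integral_congr_ae ?_
  filter_upwards [hq2.coeFn_toLp] with x hx
  rw [hx]

theorem fourierInv_toLp_ae_eq {q : ℝ → ℂ} (hq : Integrable q) (hq2 : MemLp q 2) :
    (𝓕⁻ (hq2.toLp q) : Lp ℂ 2 (volume : Measure ℝ)) =ᵐ[volume] 𝓕⁻ q := by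
  refine Lp_ae_eq_of_schwartz _
    (continuous_fourierInv_of_integrable hq).locallyIntegrable fun φ => ?_
  have h := congrArg (fun D : 𝓢'(ℝ, ℂ) => D φ)
    (Lp.fourierInv_toTemperedDistribution_eq (hq2.toLp q))
  simp only [TemperedDistribution.fourierInv_apply, Lp.toTemperedDistribution_apply] at h
  rw [← h, integral_schwartz_mul_fourierInv hq]
  refine integral_congr_ae ?_
  filter_upwards [hq2.coeFn_toLp] with x hx
  rw [hx]

/-- Inversion with the `L²` hypothesis on the transform alone. It gives square integrability of
convolutions and injectivity of `𝓕`. -/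
theorem fourierInv_toLp_fourier_ae_eq {q : ℝ → ℂ} (hq : Integrable q) (hF : MemLp (𝓕 q) 2) :
    (𝓕⁻ (hF.toLp (𝓕 q)) : Lp ℂ 2 (volume : Measure ℝ)) =ᵐ[volume] q := by
  refine Lp_ae_eq_of_schwartz _ hq.locallyIntegrable fun φ => ?_
  have h := congrArg (fun D : 𝓢'(ℝ, ℂ) => D φ)
    (Lp.fourierInv_toTemperedDistribution_eq (hF.toLp (𝓕 q)))
  simp only [TemperedDistribution.fourierInv_apply, Lp.toTemperedDistribution_apply] at h
  rw [← h]
  have h2 := integral_schwartz_mul_fourier hq (𝓕⁻ φ)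
  rw [FourierTransform.fourier_fourierInv_eq] at h2
  rw [← h2]
  refine integral_congr_ae ?_
  filter_upwards [hF.coeFn_toLp] with x hx
  rw [hx]

/-- Square integrability can be read off from the Fourier transform. -/
theorem memLp_two_of_memLp_fourier {q : ℝ → ℂ} (hq : Integrable q) (hF : MemLp (𝓕 q) 2) :
    MemLp q 2 :=
  (memLp_congr_ae (fourierInv_toLp_fourier_ae_eq hq hF)).1 (Lp.memLp _)

theorem memLp_fourier {q : ℝ → ℂ} (hq : Integrable q) (hq2 : MemLp q 2) : MemLp (𝓕 q) 2 :=
  (memLp_congr_ae (fourier_toLp_ae_eq hq hq2)).1 (Lp.memLp _)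

/-- Plancherel's theorem for integrable and square integrable functions. -/
theorem eLpNorm_fourier {q : ℝ → ℂ} (hq : Integrable q) (hq2 : MemLp q 2) :
    eLpNorm (𝓕 q) 2 volume = eLpNorm q 2 volume := by
  rw [← eLpNorm_congr_ae (fourier_toLp_ae_eq hq hq2), ← eLpNorm_congr_ae hq2.coeFn_toLp,
    ← Lp.enorm_def, ← Lp.enorm_def, ← ofReal_norm, ← ofReal_norm, Lp.norm_fourier_eq]

theorem integral_conj_fourier_mul_fourier {k q : ℝ → ℂ} (hk : Integrable k) (hk2 : MemLp k 2)
    (hq : Integrable q) (hq2 : MemLp q 2) :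
    ∫ x, (starRingEnd ℂ) (𝓕 k x) * 𝓕 q x = ∫ ξ, (starRingEnd ℂ) (k ξ) * q ξ := by
  have h := Lp.inner_fourier_eq (hk2.toLp k) (hq2.toLp q)
  rw [L2.inner_def, L2.inner_def] at h
  have e1 : ∫ x, (starRingEnd ℂ) (𝓕 k x) * 𝓕 q x
      = ∫ a, inner ℂ ((𝓕 (hk2.toLp k) : Lp ℂ 2 (volume : Measure ℝ)) a)
        ((𝓕 (hq2.toLp q) : Lp ℂ 2 (volume : Measure ℝ)) a) := by
    refine integral_congr_ae ?_
    filter_upwards [fourier_toLp_ae_eq hk hk2, fourier_toLp_ae_eq hq hq2] with x h1 h2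
    rw [h1, h2, RCLike.inner_apply, mul_comm]
  rw [e1, h]
  refine integral_congr_ae ?_
  filter_upwards [hk2.coeFn_toLp, hq2.coeFn_toLp] with x h1 h2
  rw [h1, h2, RCLike.inner_apply, mul_comm]

theorem fourierInv_indicator_Ioc {a b : ℝ} (hab : a ≤ b) (ξ : ℝ) :
    (starRingEnd ℂ) (𝓕⁻ ((Ioc a b).indicator (fun _ => (1 : ℂ))) ξ) * (-(2 * Real.pi * Complex.I * ξ))
      = (Real.fourierChar (-(ξ * b)) : ℂ) - Real.fourierChar (-(ξ * a)) := by
  rw [Real.fourierInv_eq, ← integral_conj]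
  have : ∀ v : ℝ, (starRingEnd ℂ) (Real.fourierChar (inner ℝ v ξ) •
      (Ioc a b).indicator (fun _ => (1 : ℂ)) v)
      = (Ioc a b).indicator (fun v : ℝ => Complex.exp (-(2 * Real.pi * Complex.I * ξ) * v)) v := by
    intro v
    by_cases hv : v ∈ Ioc a b
    · simp only [indicator_of_mem hv, Circle.smul_def, smul_eq_mul, mul_one]
      rw [Real.fourierChar_apply, ← Complex.exp_conj]
      congr 1
      simp only [RCLike.inner_apply, conj_trivial, map_mul, Complex.conj_I, Complex.conj_ofReal]
      push_cast
      ring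
    · simp [indicator_of_notMem hv]
  simp_rw [this]
  rw [integral_indicator measurableSet_Ioc, ← intervalIntegral.integral_of_le hab,
    ← intervalIntegral.integral_mul_const]
  rw [intervalIntegral.integral_eq_sub_of_hasDerivAt
    (f := fun v : ℝ => Complex.exp (-(2 * Real.pi * Complex.I * ξ) * v))]
  · simp only [Real.fourierChar_apply]
    congr 2 <;> (push_cast; ring)
  · intro x _
    have h := ((hasDerivAt_id (x : ℂ)).const_mul (-(2 * Real.pi * Complex.I * ξ))).cexp.comp_ofReal
    simpa using h
  · apply Continuous.intervalIntegrable
    fun_prop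

/-- If `q` and `ξ q` are square integrable, then `𝓕 q` is absolutely continuous with the expected
square integrable derivative. -/
theorem fourier_sub_eq_integral {q : ℝ → ℂ} (hq : Integrable q)
    (hs : MemLp (fun ξ : ℝ => -(2 * Real.pi * Complex.I * ξ) * q ξ) 2) (a b : ℝ) :
    𝓕 q b - 𝓕 q a = ∫ x in a..b, (𝓕 (hs.toLp _) : Lp ℂ 2 (volume : Measure ℝ)) x := by
  wlog hab : a ≤ b generalizing a b
  · rw [intervalIntegral.integral_symm, ← this b a (le_of_not_ge hab)]; ring
  have hc : Integrable ((Ioc a b).indicator (fun _ => (1 : ℂ))) :=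
    (integrable_indicator_iff measurableSet_Ioc).2 (integrableOn_const (by simp))
  have hc2 : MemLp ((Ioc a b).indicator (fun _ => (1 : ℂ))) 2 :=
    memLp_indicator_const _ measurableSet_Ioc _ (Or.inr (by simp))
  -- Parseval against the indicator of `(a, b]`: one side is the integral of the candidate
  -- derivative, the other is evaluated by `fourierInv_indicator_Ioc`.
  have h := Lp.inner_fourier_eq (𝓕⁻ (hc2.toLp _)) (hs.toLp _)
  rw [FourierTransform.fourier_fourierInv_eq, L2.inner_def, L2.inner_def] at h
  have e1 : ∫ x in a..b, (𝓕 (hs.toLp _) : Lp ℂ 2 (volume : Measure ℝ)) x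
      = ∫ x, inner ℂ ((hc2.toLp _) x) ((𝓕 (hs.toLp _) : Lp ℂ 2 (volume : Measure ℝ)) x) := by
    rw [intervalIntegral.integral_of_le hab, ← integral_indicator measurableSet_Ioc]
    refine integral_congr_ae ?_
    filter_upwards [hc2.coeFn_toLp] with x hx
    rw [hx]
    by_cases hv : x ∈ Ioc a b <;> simp [hv]
  rw [e1, h, Real.fourier_real_eq, Real.fourier_real_eq, ← integral_sub]
  · refine integral_congr_ae ?_
    filter_upwards [hs.coeFn_toLp, fourierInv_toLp_ae_eq hc hc2] with ξ h1 h2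
    rw [h1, h2, RCLike.inner_apply, mul_right_comm, mul_comm (-_) (starRingEnd ℂ _),
      fourierInv_indicator_Ioc hab]
    simp only [Circle.smul_def, smul_eq_mul]
    ring
  · simpa [mul_comm] using (Real.fourierIntegral_convergent_iff (μ := volume) (f := q) b).2 hq
  · simpa [mul_comm] using (Real.fourierIntegral_convergent_iff (μ := volume) (f := q) a).2 hq

theorem norm_fourier_le {q : ℝ → ℂ} (x : ℝ) : ‖𝓕 q x‖ ≤ ∫ ξ, ‖q ξ‖ :=
  VectorFourier.norm_fourierIntegral_le_integral_norm _ _ _ _ _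

/-! ### Absolute continuity and weak derivatives. -/

/-- Absolute continuity on every compact interval. -/
def LocAC (f : ℝ → ℝ) : Prop := ∀ a b, AbsolutelyContinuousOnInterval f a b

theorem LocAC.continuous {f : ℝ → ℝ} (h : LocAC f) : Continuous f := by
  refine continuous_iff_continuousAt.2 fun x => ?_
  refine (h (x - 1) (x + 1)).continuousOn.continuousAt ?_
  rw [uIcc_of_le (by linarith)]
  exact Icc_mem_nhds (by linarith) (by linarith)

theorem LocAC.ae_differentiableAt {f : ℝ → ℝ} (h : LocAC f) :
    ∀ᵐ x, DifferentiableAt ℝ f x := by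
  have : ∀ᵐ x : ℝ, ∀ n : ℕ, x ∈ uIcc (-(n : ℝ)) n → DifferentiableAt ℝ f x :=
    ae_all_iff.2 fun n => (h (-n) n).ae_differentiableAt
  filter_upwards [this] with x hx
  obtain ⟨n, hn⟩ := exists_nat_ge |x|
  refine hx n ?_
  rw [uIcc_of_le (by linarith [abs_nonneg x])]
  exact abs_le.1 hn

theorem LocAC.isWeakDeriv {f : ℝ → ℝ} (h : LocAC f) : IsWeakDeriv f (deriv f) := by
  intro φ hφ hc
  obtain ⟨R, hR⟩ := hc.isCompact.isBounded.subset_ball 0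
  rw [Real.ball_eq_Ioo] at hR
  simp only [zero_sub, zero_add] at hR
  have hsub : Function.support φ ⊆ Ioc (-R) R :=
    (subset_tsupport φ).trans (hR.trans Ioo_subset_Ioc_self)
  have hsub' : Function.support (deriv φ) ⊆ Ioc (-R) R :=
    (support_deriv_subset).trans (hR.trans Ioo_subset_Ioc_self)
  have hz : ∀ x, x ∉ Ioo (-R) R → φ x = 0 := fun x hx => by
    by_contra h0
    exact hx (hR (subset_tsupport φ h0))
  have hac : AbsolutelyContinuousOnInterval φ (-R) R :=
    ((hφ.of_le (by exact_mod_cast le_top)).contDiffOn).absolutelyContinuousOnInterval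
  have h1 := AbsolutelyContinuousOnInterval.integral_mul_deriv_eq_deriv_mul (h (-R) R) hac
  rw [hz R (by simp), hz (-R) (by simp)] at h1
  rw [← intervalIntegral.integral_eq_integral_of_support_subset (a := -R) (b := R),
    ← intervalIntegral.integral_eq_integral_of_support_subset (a := -R) (b := R), h1]
  · simp
  · exact (Function.support_mul_subset_right _ _).trans hsub
  · exact (Function.support_mul_subset_right _ _).trans hsub'

theorem IsWeakDeriv.ae_eq {f g g' : ℝ → ℝ} (h : IsWeakDeriv f g) (h' : IsWeakDeriv f g')
    (hg : LocallyIntegrable g) (hg' : LocallyIntegrable g') : g =ᵐ[volume] g' := by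
  refine ae_eq_of_integral_contDiff_smul_eq hg hg' fun φ hφ hc => ?_
  have := (h φ hφ hc).symm.trans (h' φ hφ hc)
  simpa [mul_comm] using this

/-- Integration by parts against a weak derivative extends to square integrable test functions. -/
theorem IsWeakDeriv.integral_mul_deriv {f g : ℝ → ℝ} (h : IsWeakDeriv f g) (hf : MemLp f 2)
    (hg : MemLp g 2) {φ : ℝ → ℝ} (hφ : ContDiff ℝ (⊤ : ℕ∞) φ) (h1 : MemLp φ 2)
    (h2 : MemLp (deriv φ) 2) : ∫ x, f x * deriv φ x = - ∫ x, g x * φ x := by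
  -- The test function is cut off by `χ (c n * x)` with `c n → 0`; differentiating the cutoff
  -- produces a factor `c n`, which disappears in the limit.
  let χ : ContDiffBump (0 : ℝ) := ⟨1, 2, by norm_num, by norm_num⟩
  have hχ : ContDiff ℝ (⊤ : ℕ∞) χ := χ.contDiff
  have hχd : Differentiable ℝ χ := hχ.differentiable (by simp)
  have hφd : Differentiable ℝ φ := hφ.differentiable (by simp)
  obtain ⟨C, hC⟩ := (χ.hasCompactSupport.deriv).exists_bound_of_continuous
    (hχ.continuous_deriv (by simp))
  let c : ℕ → ℝ := fun n => 1 / ((n : ℝ) + 1)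
  have hc0 : Tendsto c atTop (𝓝 0) := tendsto_one_div_add_atTop_nhds_zero_nat
  have hcpos : ∀ n, 0 < c n := fun n => by positivity
  have hcle : ∀ n, c n ≤ 1 := fun n => by
    simp only [c]; rw [div_le_one (by positivity)]; linarith [n.cast_nonneg (α := ℝ)]
  have hder : ∀ n x, deriv (fun x => χ (c n * x) * φ x) x
      = c n * deriv χ (c n * x) * φ x + χ (c n * x) * deriv φ x := by
    intro n x
    have := ((hχd (c n * x)).hasDerivAt.comp x ((hasDerivAt_id x).const_mul (c n))).mul
      (hφd x).hasDerivAt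
    refine this.deriv.trans ?_
    simp only [Function.comp_apply, mul_one]; ring
  have hlim : ∀ x, Tendsto (fun n => χ (c n * x)) atTop (𝓝 1) := by
    intro x
    have h0 : χ (0 : ℝ) = 1 := χ.one_of_mem_closedBall (by simp [χ])
    rw [← h0]
    refine (hχ.continuous.tendsto 0).comp ?_
    simpa using hc0.mul_const x
  have key : ∀ n, ∫ x, f x * (c n * deriv χ (c n * x) * φ x + χ (c n * x) * deriv φ x)
      = - ∫ x, g x * (χ (c n * x) * φ x) := by
    intro n
    rw [← h (fun x => χ (c n * x) * φ x) _ _]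
    · simp_rw [hder]
    · exact (hχ.comp (contDiff_const.mul contDiff_id)).mul hφ
    · refine HasCompactSupport.mul_right ?_
      exact χ.hasCompactSupport.comp_homeomorph (Homeomorph.mulLeft₀ (c n) (hcpos n).ne')
  have hfφ : Integrable (fun x => f x * φ x) := hf.integrable_mul h1
  have hfφ' : Integrable (fun x => f x * deriv φ x) := hf.integrable_mul h2
  have hgφ : Integrable (fun x => g x * φ x) := hg.integrable_mul h1
  have hCn : 0 ≤ C := (norm_nonneg _).trans (hC 0)
  have t1 : Tendsto (fun n => ∫ x, f x * (c n * deriv χ (c n * x) * φ x + χ (c n * x) * deriv φ x))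
      atTop (𝓝 (∫ x, f x * deriv φ x)) := by
    refine tendsto_integral_of_dominated_convergence
      (fun x => C * ‖f x * φ x‖ + ‖f x * deriv φ x‖) ?_ ((hfφ.norm.const_mul C).add hfφ'.norm) ?_ ?_
    · intro n
      refine hf.1.mul (Continuous.aestronglyMeasurable ?_)
      have h3 := hχ.continuous_deriv (by simp)
      have h4 := hφ.continuous_deriv (by simp)
      have h5 := hχ.continuous
      have h6 := hφ.continuous
      fun_prop
    · intro n
      refine .of_forall fun x => ?_
      have e : f x * (c n * deriv χ (c n * x) * φ x + χ (c n * x) * deriv φ x)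
        = c n * deriv χ (c n * x) * (f x * φ x) + χ (c n * x) * (f x * deriv φ x) := by ring
      rw [e]
      refine (norm_add_le _ _).trans (add_le_add ?_ ?_)
      · rw [norm_mul, norm_mul]
        refine mul_le_mul_of_nonneg_right ?_ (norm_nonneg _)
        have := mul_le_mul (hcle n) (hC (c n * x)) (norm_nonneg _) zero_le_one
        rw [Real.norm_of_nonneg (hcpos n).le]
        simpa using this
      · rw [norm_mul]
        refine mul_le_of_le_one_left (norm_nonneg _) ?_
        rw [Real.norm_of_nonneg χ.nonneg]
        exact χ.le_one
    · refine .of_forall fun x => ?_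
      have l1 : Tendsto (fun n => c n * deriv χ (c n * x)) atTop (𝓝 0) := by
        refine squeeze_zero_norm (a := fun n => c n * C) (fun n => ?_) (by simpa using hc0.mul_const C)
        rw [norm_mul, Real.norm_of_nonneg (hcpos n).le]
        exact mul_le_mul_of_nonneg_left (hC _) (hcpos n).le
      have := ((l1.mul_const (φ x)).add ((hlim x).mul_const (deriv φ x))).const_mul (f x)
      simpa using this
  have t2 : Tendsto (fun n => - ∫ x, g x * (χ (c n * x) * φ x)) atTop (𝓝 (- ∫ x, g x * φ x)) := by
    refine Tendsto.neg ?_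
    refine tendsto_integral_of_dominated_convergence (fun x => ‖g x * φ x‖) ?_ hgφ.norm ?_ ?_
    · intro n
      refine hg.1.mul (Continuous.aestronglyMeasurable ?_)
      have h5 := hχ.continuous
      have h6 := hφ.continuous
      fun_prop
    · intro n
      refine .of_forall fun x => ?_
      rw [show g x * (χ (c n * x) * φ x) = χ (c n * x) * (g x * φ x) by ring, norm_mul]
      refine mul_le_of_le_one_left (norm_nonneg _) ?_
      rw [Real.norm_of_nonneg χ.nonneg]
      exact χ.le_one
    · refine .of_forall fun x => ?_
      simpa using ((hlim x).mul_const (φ x)).const_mul (g x)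
  exact tendsto_nhds_unique (t1.congr key) t2

theorem IsWeakDeriv.integral_schwartz {f g : ℝ → ℝ} (h : IsWeakDeriv f g) (hf : MemLp f 2)
    (hg : MemLp g 2) (ψ : 𝓢(ℝ, ℂ)) :
    ∫ x, deriv ψ x * (f x : ℂ) = - ∫ x, ψ x * (g x : ℂ) := by
  have hψ : ContDiff ℝ (⊤ : ℕ∞) ψ := ψ.smooth _
  have hψ2 : MemLp ψ 2 := ψ.memLp 2
  have hψ' : MemLp (deriv ψ) 2 := (SchwartzMap.derivCLM ℂ ℂ ψ).memLp 2 volume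
  have hd : ∀ x, HasDerivAt ψ (deriv ψ x) x := ψ.hasDerivAt
  have dre : deriv (fun x => (ψ x).re) = fun x => (deriv ψ x).re :=
    funext fun x => (Complex.reCLM.hasFDerivAt.comp_hasDerivAt x (hd x)).deriv
  have dim : deriv (fun x => (ψ x).im) = fun x => (deriv ψ x).im :=
    funext fun x => (Complex.imCLM.hasFDerivAt.comp_hasDerivAt x (hd x)).deriv
  have e1 := h.integral_mul_deriv hf hg (φ := fun x => (ψ x).re) (Complex.reCLM.contDiff.comp hψ)
    hψ2.re (by rw [dre]; exact hψ'.re)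
  have e2 := h.integral_mul_deriv hf hg (φ := fun x => (ψ x).im) (Complex.imCLM.contDiff.comp hψ)
    hψ2.im (by rw [dim]; exact hψ'.im)
  rw [dre] at e1
  rw [dim] at e2
  have i1 : Integrable (fun x => deriv ψ x * (f x : ℂ)) := hψ'.integrable_mul hf.ofReal
  have i2 : Integrable (fun x => ψ x * (g x : ℂ)) := hψ2.integrable_mul hg.ofReal
  refine Complex.ext ?_ ?_
  · rw [Complex.neg_re]
    have a1 := integral_re i1
    have a2 := integral_re i2
    simp only [RCLike.re_to_complex, Complex.re_mul_ofReal] at a1 a2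
    rw [← a1, ← a2]
    simpa [mul_comm] using e1
  · rw [Complex.neg_im]
    have a1 := integral_im i1
    have a2 := integral_im i2
    simp only [RCLike.im_to_complex, Complex.im_mul_ofReal] at a1 a2
    rw [← a1, ← a2]
    simpa [mul_comm] using e2

/-! ### The Fourier description of `H¹`. -/

/-- The weight whose `L²` norm controls the `L¹` norm of the Fourier transform on `H¹`. -/
theorem memLp_weight : MemLp (fun ξ : ℝ => ((1 + |ξ|)⁻¹ : ℝ)) 2 := by
  have hc : Continuous (fun ξ : ℝ => ((1 + |ξ|)⁻¹ : ℝ)) :=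
    (continuous_const.add continuous_abs).inv₀ fun x => by
      exact (show (0 : ℝ) < 1 + |x| by positivity).ne'
  rw [memLp_two_iff_integrable_sq hc.aestronglyMeasurable]
  refine integrable_inv_one_add_sq.mono' (hc.pow 2).aestronglyMeasurable (.of_forall fun x => ?_)
  rw [Real.norm_of_nonneg (by positivity), inv_pow]
  refine inv_anti₀ (by positivity) ?_
  nlinarith [abs_nonneg x, sq_abs x]

/-- Cauchy–Schwarz for `q = (1 + |ξ|)⁻¹ · (1 + |ξ|) q`. This is the source of the embedding of `H¹`
into bounded functions. -/
theorem eLpNorm_one_le {q : ℝ → ℂ} (hq : MemLp q 2)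
    (hs : MemLp (fun ξ : ℝ => -(2 * Real.pi * Complex.I * ξ) * q ξ) 2) :
    eLpNorm q 1 volume ≤ eLpNorm (fun ξ : ℝ => ((1 + |ξ|)⁻¹ : ℝ)) 2 volume *
      (eLpNorm q 2 volume + eLpNorm (fun ξ : ℝ => -(2 * Real.pi * Complex.I * ξ) * q ξ) 2 volume) := by
  have e : q = fun ξ : ℝ => ((1 + |ξ|)⁻¹ : ℝ) • ((1 + |ξ|) • q ξ) := by
    funext ξ
    rw [smul_smul, inv_mul_cancel₀ (by positivity), one_smul]
  have hm : AEStronglyMeasurable (fun ξ : ℝ => (1 + |ξ|) • q ξ) volume :=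
    (show Continuous (fun ξ : ℝ => 1 + |ξ|) by fun_prop).aestronglyMeasurable.smul hq.1
  calc eLpNorm q 1 volume
      = eLpNorm ((fun ξ : ℝ => ((1 + |ξ|)⁻¹ : ℝ)) • (fun ξ : ℝ => (1 + |ξ|) • q ξ)) 1 volume := by
        conv_lhs => rw [e]
        rfl
    _ ≤ _ := eLpNorm_smul_le_mul_eLpNorm (p := 2) (q := 2) hm memLp_weight.1
    _ ≤ _ := by
        gcongr
        have hb : ∀ ξ : ℝ, ‖(1 + |ξ|) • q ξ‖ ≤ ‖(fun ξ : ℝ => ‖q ξ‖) ξ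
            + (fun ξ : ℝ => ‖-(2 * Real.pi * Complex.I * ξ) * q ξ‖) ξ‖ := by
          intro ξ
          have hpi : 1 ≤ 2 * Real.pi := by linarith [Real.pi_gt_three]
          have : ‖-(2 * Real.pi * Complex.I * ξ) * q ξ‖ = 2 * Real.pi * |ξ| * ‖q ξ‖ := by
            simp [abs_of_pos Real.pi_pos]
          simp only [this]
          rw [norm_smul, Real.norm_of_nonneg (by positivity), Real.norm_of_nonneg (by positivity)]
          have : |ξ| * ‖q ξ‖ ≤ 2 * Real.pi * |ξ| * ‖q ξ‖ := by
            rw [mul_assoc (2 * Real.pi)]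
            exact le_mul_of_one_le_left (by positivity) hpi
          linarith
        refine (eLpNorm_mono hb).trans ((eLpNorm_add_le hq.1.norm hs.1.norm (by norm_num)).trans ?_)
        rw [eLpNorm_norm, eLpNorm_norm]

theorem integrable_of_memLp_weighted {q : ℝ → ℂ} (hq : MemLp q 2)
    (hs : MemLp (fun ξ : ℝ => -(2 * Real.pi * Complex.I * ξ) * q ξ) 2) : Integrable q := by
  rw [← memLp_one_iff_integrable]
  refine ⟨hq.1, (eLpNorm_one_le hq hs).trans_lt ?_⟩
  exact ENNReal.mul_lt_top memLp_weight.2 (ENNReal.add_lt_top.2 ⟨hq.2, hs.2⟩)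

/-- `q` is the spectrum of the real `H¹` function `f`: `f = 𝓕 q` with `q` and `ξ q` square
integrable. -/
structure HasSpectrum (f : ℝ → ℝ) (q : ℝ → ℂ) : Prop where
  integrable : Integrable q
  memLp : MemLp q 2
  memLp_deriv : MemLp (fun ξ : ℝ => -(2 * Real.pi * Complex.I * ξ) * q ξ) 2
  eq : ∀ x, (f x : ℂ) = 𝓕 q x

/-- The weak derivative is a distributional derivative (`hD`), which the inverse transform turns
into multiplication by `-2πiξ` (`hs`). Hence `q` is integrable, `𝓕 q` is continuous, and the almost
everywhere equality with `f` holds at every point. -/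
theorem MemH1.exists_hasSpectrum {f : ℝ → ℝ} (hf : MemH1 f) : ∃ q, HasSpectrum f q := by
  obtain ⟨g, hg, hw⟩ := hf.weakDeriv
  have hfc : MemLp (fun x => (f x : ℂ)) 2 := hf.memLp.ofReal
  have hgc : MemLp (fun x => (g x : ℂ)) 2 := hg.ofReal
  let F : Lp ℂ 2 (volume : Measure ℝ) := hfc.toLp _
  let G : Lp ℂ 2 (volume : Measure ℝ) := hgc.toLp _
  open LineDeriv in
  have hD : (∂_{(1 : ℝ)} (F : 𝓢'(ℝ, ℂ))) = (G : 𝓢'(ℝ, ℂ)) := by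
    ext ψ
    rw [TemperedDistribution.lineDerivOp_apply_apply, Lp.toTemperedDistribution_apply,
      Lp.toTemperedDistribution_apply]
    have e1 : ∫ x, (-∂_{(1 : ℝ)} ψ) x • F x = - ∫ x, deriv ψ x * (f x : ℂ) := by
      rw [← integral_neg]
      refine integral_congr_ae ?_
      filter_upwards [hfc.coeFn_toLp] with x hx
      rw [hx]
      simp [SchwartzMap.lineDerivOp_apply_eq_fderiv]
    have e2 : ∫ x, ψ x • G x = ∫ x, ψ x * (g x : ℂ) := by
      refine integral_congr_ae ?_
      filter_upwards [hgc.coeFn_toLp] with x hx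
      rw [hx, smul_eq_mul]
    rw [e1, e2, hw.integral_schwartz hf.memLp hg, neg_neg]
  let q : ℝ → ℂ := (𝓕⁻ F : Lp ℂ 2 (volume : Measure ℝ))
  have hq2 : MemLp q 2 := Lp.memLp _
  have hs : ((𝓕⁻ G : Lp ℂ 2 (volume : Measure ℝ)) : ℝ → ℂ)
      =ᵐ[volume] fun ξ : ℝ => -(2 * Real.pi * Complex.I * ξ) * q ξ := by
    refine Lp_ae_eq_of_schwartz _ ?_ fun φ => ?_
    · rw [← locallyIntegrableOn_univ]
      exact ((hq2.locallyIntegrable (by norm_num)).locallyIntegrableOn univ).continuousOn_mul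
        (by fun_prop) isOpen_univ.isLocallyClosed
    · have h := congrArg (fun D : 𝓢'(ℝ, ℂ) => D φ) (Lp.fourierInv_toTemperedDistribution_eq G)
      simp only [Lp.toTemperedDistribution_apply] at h
      rw [← h, ← hD, TemperedDistribution.fourierInv_lineDerivOp_eq]
      have h2 := Lp.fourierInv_toTemperedDistribution_eq F
      rw [h2]
      have ht : (fun x : ℝ => (x : ℂ)).HasTemperateGrowth := by
        fun_prop
      simp
      rw [integral_neg, ← integral_const_mul]
      congr 2 with x
      rw [SchwartzMap.smulLeftCLM_apply_apply ht, smul_eq_mul]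
      ring
  have hs2 : MemLp (fun ξ : ℝ => -(2 * Real.pi * Complex.I * ξ) * q ξ) 2 :=
    (memLp_congr_ae hs).1 (Lp.memLp _)
  have hq1 : Integrable q := integrable_of_memLp_weighted hq2 hs2
  refine ⟨q, hq1, hq2, hs2, fun x => ?_⟩
  have h1 := fourier_toLp_ae_eq hq1 hq2
  have h2 : hq2.toLp q = 𝓕⁻ F := Lp.toLp_coeFn _ _
  rw [h2, FourierTransform.fourier_fourierInv_eq] at h1
  have h3 : (fun x => (f x : ℂ)) =ᵐ[volume] 𝓕 q := hfc.coeFn_toLp.symm.trans h1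
  have h4 := Continuous.ae_eq_iff_eq volume (Complex.continuous_ofReal.comp hf.continuous)
    (continuous_fourier_of_integrable hq1) |>.1 h3
  exact congrFun h4 x

section spectrum

variable {f : ℝ → ℝ} {q : ℝ → ℂ}

theorem HasSpectrum.continuous (h : HasSpectrum f q) : Continuous f := by
  have : f = fun x => (𝓕 q x).re := funext fun x => by rw [← h.eq, Complex.ofReal_re]
  rw [this]
  exact Complex.continuous_re.comp (continuous_fourier_of_integrable h.integrable)

theorem HasSpectrum.ofReal_eq (h : HasSpectrum f q) : (fun x => (f x : ℂ)) = 𝓕 q := funext h.eq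

theorem HasSpectrum.eLpNorm_eq (h : HasSpectrum f q) : eLpNorm f 2 volume = eLpNorm q 2 volume := by
  rw [← eLpNorm_fourier h.integrable h.memLp, ← h.ofReal_eq]
  exact eLpNorm_congr_norm_ae (.of_forall fun x => by simp)

theorem HasSpectrum.memLp_fun (h : HasSpectrum f q) : MemLp f 2 := by
  refine ⟨h.continuous.aestronglyMeasurable, ?_⟩
  rw [h.eLpNorm_eq]
  exact h.memLp.2

theorem HasSpectrum.sub_eq_integral (h : HasSpectrum f q) (a b : ℝ) :
    (((f b - f a : ℝ)) : ℂ) =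
      ∫ x in a..b, (𝓕 (h.memLp_deriv.toLp _) : Lp ℂ 2 (volume : Measure ℝ)) x := by
  rw [← fourier_sub_eq_integral h.integrable h.memLp_deriv, ← h.eq, ← h.eq]
  push_cast; rfl

/-- `HasSpectrum.sub_eq_integral` presents `f` as a primitive of a locally integrable function, so
both claims are Lebesgue's theorem on indefinite integrals, applied to real and imaginary parts. -/
theorem HasSpectrum.locAC_and_deriv (h : HasSpectrum f q) :
    LocAC f ∧ (fun x => ((deriv f x : ℝ) : ℂ)) =ᵐ[volume]
      (𝓕 (h.memLp_deriv.toLp _) : Lp ℂ 2 (volume : Measure ℝ)) := by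
  set G : Lp ℂ 2 (volume : Measure ℝ) := 𝓕 (h.memLp_deriv.toLp _)
  have hG : LocallyIntegrable G := (Lp.memLp G).locallyIntegrable (by norm_num)
  have hGi : ∀ a b, IntervalIntegrable G volume a b := fun a b =>
    (hG.integrableOn_isCompact isCompact_uIcc).intervalIntegrable
  have hre : ∀ a b, IntervalIntegrable (fun x => (G x).re) volume a b := fun a b =>
    ⟨(hGi a b).1.re, (hGi a b).2.re⟩
  have him : ∀ a b, IntervalIntegrable (fun x => (G x).im) volume a b := fun a b =>
    ⟨(hGi a b).1.im, (hGi a b).2.im⟩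
  have e := h.sub_eq_integral
  have ere : ∀ a b, f b - f a = ∫ x in a..b, (G x).re := by
    intro a b
    have := Complex.reCLM.intervalIntegral_comp_comm (hGi a b)
    rw [← e a b] at this
    simpa using this.symm
  have eim : ∀ a b, 0 = ∫ x in a..b, (G x).im := by
    intro a b
    have := Complex.imCLM.intervalIntegral_comp_comm (hGi a b)
    rw [← e a b] at this
    simpa using this.symm
  have hae : ∀ φ : ℝ → ℝ, (∀ a b, IntervalIntegrable φ volume a b) →
      ∀ᵐ x, HasDerivAt (fun y => ∫ t in (0 : ℝ)..y, φ t) (φ x) x := by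
    intro φ hφ
    have : ∀ᵐ x : ℝ, ∀ n : ℕ, x ∈ uIcc (-(n : ℝ)) n →
        HasDerivAt (fun y => ∫ t in (0 : ℝ)..y, φ t) (φ x) x := by
      refine ae_all_iff.2 fun n => ?_
      filter_upwards [(hφ (-n) n).ae_hasDerivAt_integral] with x hx hxm
      refine hx hxm 0 ?_
      rw [uIcc_of_le (by linarith [n.cast_nonneg (α := ℝ)])]
      constructor <;> linarith [n.cast_nonneg (α := ℝ)]
    filter_upwards [this] with x hx
    obtain ⟨n, hn⟩ := exists_nat_ge |x|
    refine hx n ?_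
    rw [uIcc_of_le (by linarith [abs_nonneg x])]
    exact abs_le.1 hn
  constructor
  · intro a b
    have hc : AbsolutelyContinuousOnInterval (fun _ : ℝ => f a) a b :=
      (contDiff_const (𝕜 := ℝ) (n := 1)).contDiffOn.absolutelyContinuousOnInterval
    have h2 := hc.add ((hre a b).absolutelyContinuousOnInterval_intervalIntegral
      (c := a) left_mem_uIcc)
    have h3 : ((fun _ : ℝ => f a) + fun x => ∫ v in a..x, (G v).re) = f := by
      funext x
      simp only [Pi.add_apply, ← ere]
      ring
    rwa [h3] at h2
  · filter_upwards [hae _ hre, hae _ him] with x h1 h2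
    refine Complex.ext ?_ ?_
    · rw [Complex.ofReal_re]
      have : f = fun y => (∫ t in (0 : ℝ)..y, (G t).re) + f 0 := by
        funext y; rw [← ere]; ring
      rw [this]
      exact (h1.add_const (f 0)).deriv
    · rw [Complex.ofReal_im]
      simp only [← eim] at h2
      exact (hasDerivAt_const x (0 : ℝ)).unique h2

theorem HasSpectrum.locAC (h : HasSpectrum f q) : LocAC f := h.locAC_and_deriv.1

theorem HasSpectrum.eLpNorm_deriv_eq (h : HasSpectrum f q) : eLpNorm (deriv f) 2 volume
    = eLpNorm (fun ξ : ℝ => -(2 * Real.pi * Complex.I * ξ) * q ξ) 2 volume := by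
  have h1 : eLpNorm (deriv f) 2 volume = eLpNorm (fun x => ((deriv f x : ℝ) : ℂ)) 2 volume :=
    eLpNorm_congr_norm_ae (.of_forall fun x => by simp)
  rw [h1, eLpNorm_congr_ae h.locAC_and_deriv.2, ← eLpNorm_congr_ae h.memLp_deriv.coeFn_toLp,
    ← Lp.enorm_def, ← Lp.enorm_def, ← ofReal_norm, ← ofReal_norm, Lp.norm_fourier_eq]

theorem HasSpectrum.memLp_deriv_fun (h : HasSpectrum f q) : MemLp (deriv f) 2 := by
  refine ⟨(measurable_deriv f).aestronglyMeasurable, ?_⟩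
  rw [h.eLpNorm_deriv_eq]
  exact h.memLp_deriv.2

end spectrum

/-- The `H¹` norm, as an extended nonnegative real number. -/
noncomputable def h1Norm (f : ℝ → ℝ) : ENNReal := eLpNorm f 2 volume + eLpNorm (deriv f) 2 volume

theorem HasSpectrum.eLpNorm_one_le {f : ℝ → ℝ} {q : ℝ → ℂ} (h : HasSpectrum f q) :
    eLpNorm q 1 volume ≤ eLpNorm (fun ξ : ℝ => ((1 + |ξ|)⁻¹ : ℝ)) 2 volume * h1Norm f := by
  rw [h1Norm, h.eLpNorm_eq, h.eLpNorm_deriv_eq]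
  exact _root_.eLpNorm_one_le h.memLp h.memLp_deriv

/-- Replaces an unspecified weak derivative by the pointwise `deriv f`, with which all later
estimates are made. -/
theorem memH1_iff {f : ℝ → ℝ} : MemH1 f ↔ LocAC f ∧ MemLp f 2 ∧ MemLp (deriv f) 2 := by
  constructor
  · intro h
    obtain ⟨q, hq⟩ := h.exists_hasSpectrum
    exact ⟨hq.locAC, hq.memLp_fun, hq.memLp_deriv_fun⟩
  · rintro ⟨h1, h2, h3⟩
    exact ⟨h1.continuous, h2, _, h3, h1.isWeakDeriv⟩

theorem HasSpectrum.memH1 {f : ℝ → ℝ} {q : ℝ → ℂ} (h : HasSpectrum f q) : MemH1 f :=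
  memH1_iff.2 ⟨h.locAC, h.memLp_fun, h.memLp_deriv_fun⟩

theorem MemH1.locAC {f : ℝ → ℝ} (h : MemH1 f) : LocAC f := (memH1_iff.1 h).1

theorem MemH1.memLp_deriv {f : ℝ → ℝ} (h : MemH1 f) : MemLp (deriv f) 2 := (memH1_iff.1 h).2.2

theorem MemH1.h1Norm_lt_top {f : ℝ → ℝ} (h : MemH1 f) : h1Norm f < ⊤ :=
  ENNReal.add_lt_top.2 ⟨h.memLp.2, h.memLp_deriv.2⟩

theorem LocAC.sub {f g : ℝ → ℝ} (hf : LocAC f) (hg : LocAC g) : LocAC (f - g) := fun a b =>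
  (hf a b).sub (hg a b)

theorem MemH1.sub {f g : ℝ → ℝ} (hf : MemH1 f) (hg : MemH1 g) : MemH1 (f - g) := by
  refine memH1_iff.2 ⟨hf.locAC.sub hg.locAC, hf.memLp.sub hg.memLp, ?_⟩
  refine (memLp_congr_ae ?_).1 (hf.memLp_deriv.sub hg.memLp_deriv)
  filter_upwards [hf.locAC.ae_differentiableAt, hg.locAC.ae_differentiableAt] with x h1 h2
  exact (deriv_sub h1 h2).symm

theorem IsWeakDeriv.ae_eq_deriv {f g : ℝ → ℝ} (h : IsWeakDeriv f g) (hf : MemH1 f)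
    (hg : MemLp g 2) : g =ᵐ[volume] deriv f :=
  h.ae_eq hf.locAC.isWeakDeriv (hg.locallyIntegrable (by norm_num))
    (hf.memLp_deriv.locallyIntegrable (by norm_num))

/-! ### Poisson kernels and the multiplier of the Hilbert transform. -/

/-- The Fourier multiplier of the Hilbert transform, for functions written as `𝓕 q`. -/
noncomputable def hilbertMul (ξ : ℝ) : ℂ :=
  if 0 < ξ then Complex.I else if ξ < 0 then -Complex.I else 0

theorem measurable_hilbertMul : Measurable hilbertMul :=
  Measurable.ite measurableSet_Ioi measurable_const
    (Measurable.ite measurableSet_Iio measurable_const measurable_const)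

theorem norm_hilbertMul_le (ξ : ℝ) : ‖hilbertMul ξ‖ ≤ 1 := by
  unfold hilbertMul
  split_ifs <;> simp

theorem hilbertMul_of_pos {ξ : ℝ} (h : 0 < ξ) : hilbertMul ξ = Complex.I := if_pos h

theorem hilbertMul_of_neg {ξ : ℝ} (h : ξ < 0) : hilbertMul ξ = -Complex.I := by
  rw [hilbertMul, if_neg (not_lt.2 h.le), if_pos h]

theorem conj_hilbertMul (ξ : ℝ) : (starRingEnd ℂ) (hilbertMul ξ) = -hilbertMul ξ := by
  unfold hilbertMul
  split_ifs <;> simp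

/-- The character `e^{2πit}`. -/
noncomputable def fourierExp (t : ℝ) : ℂ := Complex.exp (2 * Real.pi * t * Complex.I)

theorem norm_fourierExp (t : ℝ) : ‖fourierExp t‖ = 1 := by
  have := Complex.norm_exp_ofReal_mul_I (2 * Real.pi * t)
  push_cast at this
  exact this

theorem fourierExp_add (s t : ℝ) : fourierExp (s + t) = fourierExp s * fourierExp t := by
  rw [fourierExp, fourierExp, fourierExp, ← Complex.exp_add]
  congr 1; push_cast; ring

theorem conj_fourierExp (t : ℝ) : (starRingEnd ℂ) (fourierExp t) = fourierExp (-t) := by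
  rw [fourierExp, fourierExp, ← Complex.exp_conj]
  congr 1
  simp only [map_mul, Complex.conj_I, Complex.conj_ofReal, map_ofNat]
  push_cast; ring

theorem continuous_fourierExp : Continuous fourierExp := by
  unfold fourierExp
  fun_prop

theorem fourierChar_smul_eq (t : ℝ) (z : ℂ) : Real.fourierChar t • z = fourierExp t * z := by
  rw [Circle.smul_def, Real.fourierChar_apply, smul_eq_mul, fourierExp]
  push_cast; rfl

section exponentials

variable {l : ℝ}

theorem integrable_exp_neg_abs (hl : 0 < l) : Integrable (fun ξ : ℝ => Real.exp (-l * |ξ|)) := by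
  have h1 : IntegrableOn (fun ξ : ℝ => Real.exp (-l * |ξ|)) (Ioi 0) :=
    (integrableOn_exp_mul_Ioi (neg_neg_of_pos hl) 0).congr_fun
      (fun x hx => by simp only [abs_of_pos (mem_Ioi.1 hx)]) measurableSet_Ioi
  have h2 : IntegrableOn (fun ξ : ℝ => Real.exp (-l * |ξ|)) (Iic 0) :=
    (integrableOn_exp_mul_Iic hl 0).congr_fun
      (fun x hx => by simp only [abs_of_nonpos (mem_Iic.1 hx)]; ring_nf) measurableSet_Iic
  have := h2.union h1
  rwa [Iic_union_Ioi, integrableOn_univ] at this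

theorem memLp_exp_neg_abs (hl : 0 < l) : MemLp (fun ξ : ℝ => Real.exp (-l * |ξ|)) 2 := by
  have hc : Continuous (fun ξ : ℝ => Real.exp (-l * |ξ|)) := by fun_prop
  rw [memLp_two_iff_integrable_sq hc.aestronglyMeasurable]
  refine (integrable_exp_neg_abs (l := 2 * l) (by positivity)).congr (.of_forall fun ξ => ?_)
  simp only [← Real.exp_nat_mul]
  congr 1; push_cast; ring

theorem integral_Ioi_exp_fourier (hl : 0 < l) (x : ℝ) :
    ∫ ξ in Ioi (0 : ℝ), fourierExp (-(ξ * x)) * Real.exp (-l * |ξ|)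
      = 1 / (l + 2 * Real.pi * x * Complex.I) := by
  have ha : (-(l + 2 * Real.pi * x * Complex.I)).re < 0 := by simp [hl]
  have := integral_exp_mul_complex_Ioi ha 0
  rw [show (1 : ℂ) / (l + 2 * Real.pi * x * Complex.I)
    = -Complex.exp (-(l + 2 * Real.pi * x * Complex.I) * (0 : ℝ)) / -(l + 2 * Real.pi * x * Complex.I)
    by simp only [Complex.ofReal_zero, mul_zero, Complex.exp_zero, neg_div_neg_eq], ← this]
  refine setIntegral_congr_fun measurableSet_Ioi fun ξ hξ => ?_
  simp only [abs_of_pos (mem_Ioi.1 hξ), fourierExp, Complex.ofReal_exp]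
  rw [← Complex.exp_add]
  congr 1; push_cast; ring

theorem integral_Iic_exp_fourier (hl : 0 < l) (x : ℝ) :
    ∫ ξ in Iic (0 : ℝ), fourierExp (-(ξ * x)) * Real.exp (-l * |ξ|)
      = 1 / (l - 2 * Real.pi * x * Complex.I) := by
  have ha : 0 < ((l - 2 * Real.pi * x * Complex.I)).re := by simp [hl]
  have := integral_exp_mul_complex_Iic ha 0
  rw [show (1 : ℂ) / (l - 2 * Real.pi * x * Complex.I)
    = Complex.exp ((l - 2 * Real.pi * x * Complex.I) * (0 : ℝ)) / (l - 2 * Real.pi * x * Complex.I)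
    by simp, ← this]
  refine setIntegral_congr_fun measurableSet_Iic fun ξ hξ => ?_
  simp only [abs_of_nonpos (mem_Iic.1 hξ), fourierExp, Complex.ofReal_exp]
  rw [← Complex.exp_add]
  congr 1; push_cast; ring

theorem integrable_fourierExp_mul {q : ℝ → ℂ} (hq : Integrable q) (x : ℝ) :
    Integrable (fun ξ : ℝ => fourierExp (-(ξ * x)) * q ξ) := by
  have := (Real.fourierIntegral_convergent_iff (μ := volume) (f := q) x).2 hq
  simpa [mul_comm x, fourierChar_smul_eq] using this

theorem fourier_eq_mul (q : ℝ → ℂ) (x : ℝ) :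
    𝓕 q x = ∫ ξ : ℝ, fourierExp (-(ξ * x)) * q ξ := by
  rw [Real.fourier_real_eq]; simp_rw [fourierChar_smul_eq]

theorem sq_add_ne (hl : 0 < l) (x : ℝ) : (l : ℂ) + 2 * Real.pi * x * Complex.I ≠ 0 ∧
    (l : ℂ) - 2 * Real.pi * x * Complex.I ≠ 0 := by
  constructor <;> intro h <;> have := congrArg Complex.re h <;> simp at this <;> linarith

theorem sq_add_sq_eq_mul (l x : ℝ) :
    ((l : ℂ) ^ 2 + 4 * Real.pi ^ 2 * x ^ 2) =
      (l + 2 * Real.pi * x * Complex.I) * (l - 2 * Real.pi * x * Complex.I) := by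
  ring_nf
  rw [Complex.I_sq]
  ring

theorem fourier_exp_neg_abs (hl : 0 < l) (x : ℝ) :
    𝓕 (fun ξ : ℝ => (Real.exp (-l * |ξ|) : ℂ)) x
      = ((2 * l / (l ^ 2 + 4 * Real.pi ^ 2 * x ^ 2) : ℝ) : ℂ) := by
  rw [fourier_eq_mul]
  have hi : Integrable (fun ξ : ℝ => fourierExp (-(ξ * x)) * (Real.exp (-l * |ξ|) : ℂ)) :=
    integrable_fourierExp_mul (integrable_exp_neg_abs hl).ofReal x
  rw [← integral_add_compl measurableSet_Ioi (s := Ioi (0 : ℝ)) hi, compl_Ioi]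
  rw [integral_Ioi_exp_fourier hl, integral_Iic_exp_fourier hl]
  push_cast
  rw [sq_add_sq_eq_mul]
  obtain ⟨h1, h2⟩ := sq_add_ne hl x
  field_simp
  ring

/-- The conjugate Poisson kernel. It serves twice: as the regularised Hilbert kernel and as the
Hilbert transform of the blow-up profile. -/
theorem fourier_hilbertMul_exp_neg_abs (hl : 0 < l) (x : ℝ) :
    𝓕 (fun ξ : ℝ => hilbertMul ξ * (Real.exp (-l * |ξ|) : ℂ)) x
      = ((4 * Real.pi * x / (l ^ 2 + 4 * Real.pi ^ 2 * x ^ 2) : ℝ) : ℂ) := by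
  rw [fourier_eq_mul]
  have hi : Integrable (fun ξ : ℝ => hilbertMul ξ * (Real.exp (-l * |ξ|) : ℂ)) :=
    (integrable_exp_neg_abs hl).ofReal.bdd_mul measurable_hilbertMul.aestronglyMeasurable
      (.of_forall norm_hilbertMul_le)
  rw [← integral_add_compl measurableSet_Ioi (s := Ioi (0 : ℝ)) (integrable_fourierExp_mul hi x),
    compl_Ioi]
  have e1 : ∫ ξ in Ioi (0 : ℝ), fourierExp (-(ξ * x)) *
      (hilbertMul ξ * (Real.exp (-l * |ξ|) : ℂ)) = Complex.I * (1 / (l + 2 * Real.pi * x * Complex.I)) := by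
    rw [← integral_Ioi_exp_fourier hl, ← integral_const_mul]
    refine setIntegral_congr_fun measurableSet_Ioi fun ξ hξ => ?_
    simp only [hilbertMul_of_pos (mem_Ioi.1 hξ)]
    ring
  have e2 : ∫ ξ in Iic (0 : ℝ), fourierExp (-(ξ * x)) *
      (hilbertMul ξ * (Real.exp (-l * |ξ|) : ℂ)) = -Complex.I * (1 / (l - 2 * Real.pi * x * Complex.I)) := by
    rw [← integral_Iic_exp_fourier hl, ← integral_const_mul, integral_Iic_eq_integral_Iio,
      integral_Iic_eq_integral_Iio]
    refine setIntegral_congr_fun measurableSet_Iio fun ξ hξ => ?_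
    simp only [hilbertMul_of_neg (mem_Iio.1 hξ)]
    ring
  rw [e1, e2]
  push_cast
  rw [sq_add_sq_eq_mul]
  obtain ⟨h1, h2⟩ := sq_add_ne hl x
  rw [mul_one_div, mul_one_div, div_add_div _ _ h1 h2]
  congr 1
  ring_nf
  rw [Complex.I_sq]
  ring

end exponentials

section multiplier

variable {q : ℝ → ℂ}

theorem integrable_hilbertMul (hq : Integrable q) : Integrable (fun ξ => hilbertMul ξ * q ξ) :=
  hq.bdd_mul measurable_hilbertMul.aestronglyMeasurable (.of_forall norm_hilbertMul_le)

theorem memLp_hilbertMul (hq : MemLp q 2) : MemLp (fun ξ => hilbertMul ξ * q ξ) 2 := by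
  refine hq.of_le (measurable_hilbertMul.aestronglyMeasurable.mul hq.1) (.of_forall fun ξ => ?_)
  rw [norm_mul]
  exact mul_le_of_le_one_left (norm_nonneg _) (norm_hilbertMul_le ξ)

/-- The conjugate Poisson integral, computed on the Fourier side. -/
theorem integral_conjPoisson (hq : Integrable q) (hq2 : MemLp q 2) (x : ℝ) {ε : ℝ} (hε : 0 < ε) :
    ∫ y : ℝ, (((x - y) / (ε ^ 2 + (x - y) ^ 2) : ℝ) : ℂ) * 𝓕 q y
      = Real.pi * 𝓕 (fun ξ : ℝ => (Real.exp (-(2 * Real.pi * ε) * |ξ|) : ℂ) * (hilbertMul ξ * q ξ)) x := by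
  have hl : 0 < 2 * Real.pi * ε := by positivity
  set k0 : ℝ → ℂ := fun ξ => hilbertMul ξ * (Real.exp (-(2 * Real.pi * ε) * |ξ|) : ℂ)
  have hk0 : Integrable k0 := integrable_hilbertMul (integrable_exp_neg_abs hl).ofReal
  have hk02 : MemLp k0 2 := memLp_hilbertMul (memLp_exp_neg_abs hl).ofReal
  -- The modulation centres the kernel at `x`, and the minus sign turns `y - x` into `x - y`.
  set k : ℝ → ℂ := fun ξ => fourierExp (ξ * x) * -k0 ξ
  have hcont : Continuous (fun ξ : ℝ => fourierExp (ξ * x)) := by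
    exact continuous_fourierExp.comp (by fun_prop)
  have hk : Integrable k :=
    hk0.neg.bdd_mul (c := 1) hcont.aestronglyMeasurable (.of_forall fun ξ => (norm_fourierExp _).le)
  have hk2 : MemLp k 2 := by
    refine hk02.of_le (hcont.aestronglyMeasurable.mul hk02.1.neg) (.of_forall fun ξ => ?_)
    simp [k, norm_fourierExp]
  have hFk : ∀ y, 𝓕 k y = ((((x - y) / (ε ^ 2 + (x - y) ^ 2)) / Real.pi : ℝ) : ℂ) := by
    intro y
    have h1 : 𝓕 k y = -𝓕 k0 (y - x) := by
      rw [fourier_eq_mul, fourier_eq_mul, ← integral_neg]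
      congr 1 with ξ
      simp only [k]
      rw [← mul_assoc, ← fourierExp_add]
      rw [show -(ξ * y) + ξ * x = -(ξ * (y - x)) by ring]
      ring
    rw [h1, fourier_hilbertMul_exp_neg_abs hl, ← Complex.ofReal_neg]
    congr 1
    have : 0 < ε ^ 2 + (x - y) ^ 2 := by positivity
    have : 0 < (2 * Real.pi * ε) ^ 2 + 4 * Real.pi ^ 2 * (y - x) ^ 2 := by positivity
    field_simp
    ring
  have h := integral_conj_fourier_mul_fourier hk hk2 hq hq2
  have e1 : ∫ y : ℝ, (((x - y) / (ε ^ 2 + (x - y) ^ 2) : ℝ) : ℂ) * 𝓕 q y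
      = Real.pi * ∫ y, (starRingEnd ℂ) (𝓕 k y) * 𝓕 q y := by
    rw [← integral_const_mul]
    congr 1 with y
    rw [hFk, Complex.conj_ofReal, ← mul_assoc, ← Complex.ofReal_mul]
    congr 2
    field_simp
  rw [e1, h, fourier_eq_mul]
  congr 2 with ξ
  simp only [k, k0, map_mul, map_neg, conj_hilbertMul, Complex.conj_ofReal, conj_fourierExp]
  ring

/-- On the Fourier side the regularisation is the factor `exp (-2πε|ξ|)`, bounded by one and tending
to one. -/
theorem tendsto_conjPoisson (hq : Integrable q) (hq2 : MemLp q 2) (x : ℝ) :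
    Tendsto (fun ε : ℝ => ∫ y : ℝ, (((x - y) / (ε ^ 2 + (x - y) ^ 2) : ℝ) : ℂ) * 𝓕 q y)
      (𝓝[>] 0) (𝓝 (Real.pi * 𝓕 (fun ξ => hilbertMul ξ * q ξ) x)) := by
  have h : Tendsto (fun ε : ℝ => (Real.pi : ℂ) *
      𝓕 (fun ξ : ℝ => (Real.exp (-(2 * Real.pi * ε) * |ξ|) : ℂ) * (hilbertMul ξ * q ξ)) x)
      (𝓝[>] 0) (𝓝 (Real.pi * 𝓕 (fun ξ => hilbertMul ξ * q ξ) x)) := by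
    refine Tendsto.const_mul _ ?_
    simp_rw [fourier_eq_mul]
    have hm := integrable_fourierExp_mul (integrable_hilbertMul hq) x
    have hb := integrable_hilbertMul hq
    refine tendsto_integral_filter_of_dominated_convergence (fun ξ => ‖hilbertMul ξ * q ξ‖) ?_ ?_
      hb.norm ?_
    · refine .of_forall fun ε => ?_
      have e : (fun ξ : ℝ => fourierExp (-(ξ * x)) *
          ((Real.exp (-(2 * Real.pi * ε) * |ξ|) : ℂ) * (hilbertMul ξ * q ξ)))
          = fun ξ : ℝ => (Real.exp (-(2 * Real.pi * ε) * |ξ|) : ℂ) *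
          (fourierExp (-(ξ * x)) * (hilbertMul ξ * q ξ)) := by
        funext ξ; ring
      rw [e]
      refine (Continuous.aestronglyMeasurable ?_).mul hm.1
      fun_prop
    · filter_upwards [self_mem_nhdsWithin] with ε hε
      refine .of_forall fun ξ => ?_
      rw [norm_mul, norm_mul, norm_fourierExp, one_mul, Complex.norm_real, Real.norm_eq_abs,
        abs_of_pos (Real.exp_pos _)]
      refine mul_le_of_le_one_left (norm_nonneg _) (Real.exp_le_one_iff.2 ?_)
      have : 0 < ε := hε
      have : 0 ≤ 2 * Real.pi * ε * |ξ| := by positivity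
      linarith
    · refine .of_forall fun ξ => ?_
      have h1 : Tendsto (fun ε : ℝ => (Real.exp (-(2 * Real.pi * ε) * |ξ|) : ℂ)) (𝓝[>] 0) (𝓝 1) := by
        have : Continuous (fun ε : ℝ => (Real.exp (-(2 * Real.pi * ε) * |ξ|) : ℂ)) := by fun_prop
        simpa using (this.tendsto 0).mono_left nhdsWithin_le_nhds
      simpa using (h1.mul_const (hilbertMul ξ * q ξ)).const_mul (fourierExp (-(ξ * x)))
  refine h.congr' ?_
  filter_upwards [self_mem_nhdsWithin] with ε hε
  exact (integral_conjPoisson hq hq2 x hε).symm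

end multiplier

/-! ### Comparison of the truncated kernel with the conjugate Poisson kernel. -/

section truncation

/-- The difference between the truncated Hilbert kernel and the conjugate Poisson kernel. -/
noncomputable def truncDiff (v : ℝ) : ℝ :=
  (if 1 < |v| then 1 / v else 0) - v / (1 + v ^ 2)

theorem measurable_truncDiff : Measurable truncDiff := by
  unfold truncDiff
  refine Measurable.sub (Measurable.ite ?_ (by fun_prop) measurable_const) (by fun_prop)
  exact measurableSet_lt measurable_const (by fun_prop)

theorem abs_truncDiff_le (v : ℝ) : |truncDiff v| ≤ (1 + v ^ 2)⁻¹ := by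
  have h1 : 0 < 1 + v ^ 2 := by positivity
  unfold truncDiff
  split_ifs with h
  · have hv : v ≠ 0 := by rintro rfl; simp at h; linarith
    have : 1 / v - v / (1 + v ^ 2) = v⁻¹ * (1 + v ^ 2)⁻¹ := by field_simp; ring
    rw [this, abs_mul, abs_of_pos (inv_pos.2 h1), abs_inv]
    exact mul_le_of_le_one_left (by positivity) (inv_le_one_of_one_le₀ h.le)
  · rw [zero_sub, abs_neg, abs_div, abs_of_pos h1, div_eq_mul_inv]
    exact mul_le_of_le_one_left (by positivity) (not_lt.1 h)

theorem integrable_truncDiff : Integrable truncDiff :=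
  integrable_inv_one_add_sq.mono' measurable_truncDiff.aestronglyMeasurable
    (.of_forall fun v => abs_truncDiff_le v)

theorem truncDiff_neg (v : ℝ) : truncDiff (-v) = -truncDiff v := by
  unfold truncDiff
  rw [abs_neg]
  split_ifs
  · rw [neg_sq]; ring
  · rw [neg_sq]; ring

theorem integral_truncDiff : ∫ v, truncDiff v = 0 := by
  have h := integral_neg_eq_self truncDiff volume
  simp_rw [truncDiff_neg, integral_neg] at h
  linarith

theorem memLp_indicator_inv {ε : ℝ} (hε : 0 < ε) (x : ℝ) :
    MemLp ({y : ℝ | ε < |x - y|}.indicator fun y => 1 / (x - y)) 2 := by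
  have hs : MeasurableSet {y : ℝ | ε < |x - y|} :=
    measurableSet_lt measurable_const (by fun_prop)
  have hm : Measurable ({y : ℝ | ε < |x - y|}.indicator fun y => 1 / (x - y)) :=
    Measurable.indicator (by fun_prop) hs
  rw [memLp_two_iff_integrable_sq hm.aestronglyMeasurable]
  have h2 : Integrable (fun y : ℝ => (1 + ε⁻¹ ^ 2) * (1 + (x - y) ^ 2)⁻¹) :=
    (integrable_inv_one_add_sq.comp_sub_left x).const_mul _
  refine h2.mono' (hm.pow_const 2).aestronglyMeasurable (.of_forall fun y => ?_)
  by_cases hy : y ∈ {y : ℝ | ε < |x - y|}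
  · rw [indicator_of_mem hy]
    have hy' : ε < |x - y| := hy
    have hp : 0 < (x - y) ^ 2 := by
      rw [← sq_abs]; have := hε.trans hy'; positivity
    have h3 : ε ^ 2 ≤ (x - y) ^ 2 := by
      rw [← sq_abs (x - y)]; exact pow_le_pow_left₀ hε.le hy'.le 2
    rw [Real.norm_of_nonneg (by positivity), div_pow, one_pow, ← div_eq_mul_inv,
      div_le_div_iff₀ hp (by positivity)]
    have h4 : 1 ≤ ε⁻¹ ^ 2 * (x - y) ^ 2 := by
      rw [inv_pow, inv_mul_eq_div, le_div_iff₀ (by positivity)]; linarith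
    nlinarith
  · rw [indicator_of_notMem hy]
    simp only [ne_eq, OfNat.ofNat_ne_zero, not_false_eq_true, zero_pow, norm_zero]
    positivity

theorem memLp_conjPoisson {ε : ℝ} (hε : 0 < ε) (x : ℝ) :
    MemLp (fun y : ℝ => (x - y) / (ε ^ 2 + (x - y) ^ 2)) 2 := by
  have hc : Continuous (fun y : ℝ => (x - y) / (ε ^ 2 + (x - y) ^ 2)) :=
    Continuous.div (by fun_prop) (by fun_prop) fun y => by positivity
  rw [memLp_two_iff_integrable_sq hc.aestronglyMeasurable]
  have h2 : Integrable (fun y : ℝ => (1 + ε⁻¹ ^ 2) * (1 + (x - y) ^ 2)⁻¹) :=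
    (integrable_inv_one_add_sq.comp_sub_left x).const_mul _
  refine h2.mono' (hc.pow 2).aestronglyMeasurable (.of_forall fun y => ?_)
  rw [Real.norm_of_nonneg (by positivity), div_pow, ← div_eq_mul_inv,
    div_le_div_iff₀ (by positivity) (by positivity)]
  have h4 : ε⁻¹ ^ 2 * ε ^ 2 = 1 := by field_simp
  set t := (x - y) ^ 2
  have ht : 0 ≤ t := sq_nonneg _
  have e : (1 + ε⁻¹ ^ 2) * (ε ^ 2 + t) ^ 2
    = ε ^ 4 + 2 * ε ^ 2 * t + t ^ 2 + (ε⁻¹ ^ 2 * ε ^ 2) * (ε ^ 2 + 2 * t) + ε⁻¹ ^ 2 * t ^ 2 := by ring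
  rw [e, h4]
  have : 0 ≤ ε⁻¹ ^ 2 * t ^ 2 := by positivity
  nlinarith [mul_nonneg (sq_nonneg ε) ht, sq_nonneg (ε ^ 2)]

/-- Under `y = x - ε v` both kernels scale in the same way, so their difference is a dilate of one
fixed function. -/
theorem truncHilbert_sub_conjPoisson {f : ℝ → ℝ} (hf2 : MemLp f 2) (x : ℝ) {ε : ℝ} (hε : 0 < ε) :
    truncHilbert f x ε - Real.pi⁻¹ * ∫ y, (x - y) / (ε ^ 2 + (x - y) ^ 2) * f y
      = Real.pi⁻¹ * ∫ v, f (x - ε * v) * truncDiff v := by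
  have hs : MeasurableSet {y : ℝ | ε < |x - y|} :=
    measurableSet_lt measurable_const (by fun_prop)
  rw [truncHilbert, ← mul_sub]
  congr 1
  have i1 := (memLp_indicator_inv hε x).integrable_mul hf2
  have i2 : Integrable (fun y => (x - y) / (ε ^ 2 + (x - y) ^ 2) * f y) :=
    (memLp_conjPoisson hε x).integrable_mul hf2
  have e1 : ∫ y in {y : ℝ | ε < |x - y|}, f y / (x - y)
      = ∫ y, ({y : ℝ | ε < |x - y|}.indicator (fun y => 1 / (x - y)) * f) y := by
    rw [← integral_indicator hs]
    congr 1 with y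
    by_cases hy : y ∈ {y : ℝ | ε < |x - y|}
    · simp only [Pi.mul_apply, indicator_of_mem hy]; ring
    · simp only [Pi.mul_apply, indicator_of_notMem hy, zero_mul]
  rw [e1, ← integral_sub i1 i2]
  have e2 : ∫ v, f (x - ε * v) * truncDiff v
      = ∫ u, ε⁻¹ * (f (x - u) * truncDiff (u / ε)) := by
    rw [integral_const_mul]
    have := Measure.integral_comp_mul_left (fun u => f (x - u) * truncDiff (u / ε)) ε
    rw [abs_of_pos (inv_pos.2 hε), smul_eq_mul] at this
    rw [← this]
    congr 1 with v
    rw [mul_div_cancel_left₀ _ hε.ne']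
  rw [e2, ← integral_sub_left_eq_self (fun u => ε⁻¹ * (f (x - u) * truncDiff (u / ε))) volume x]
  congr 1 with y
  have hb : (1 < |(x - y) / ε|) ↔ ε < |x - y| := by
    rw [abs_div, abs_of_pos hε, one_lt_div hε]
  have h3 : 0 < ε ^ 2 + (x - y) ^ 2 := by positivity
  have h4 : 0 < 1 + ((x - y) / ε) ^ 2 := by positivity
  have e4 : (x - y) / ε / (1 + ((x - y) / ε) ^ 2) = ε * ((x - y) / (ε ^ 2 + (x - y) ^ 2)) := by
    rw [div_eq_iff h4.ne']
    field_simp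
  simp only [Pi.mul_apply, truncDiff, hb, sub_sub_cancel, e4]
  by_cases hy : ε < |x - y|
  · rw [if_pos hy, indicator_of_mem (by exact hy)]
    have : x - y ≠ 0 := by
      intro h0; rw [h0, abs_zero] at hy; linarith
    field_simp
  · rw [if_neg hy, indicator_of_notMem (by exact hy)]
    field_simp
    ring

/-- `truncDiff` is integrable with integral zero by oddness, so the limit is `f x` times zero. Thus
the principal value exists as soon as the conjugate Poisson limit does. -/
theorem tendsto_truncHilbert_sub {f : ℝ → ℝ} (hf : Continuous f) (hf2 : MemLp f 2) {C : ℝ}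
    (hC : ∀ x, |f x| ≤ C) (x : ℝ) :
    Tendsto (fun ε => truncHilbert f x ε - Real.pi⁻¹ * ∫ y, (x - y) / (ε ^ 2 + (x - y) ^ 2) * f y)
      (𝓝[>] 0) (𝓝 0) := by
  have h : Tendsto (fun ε => Real.pi⁻¹ * ∫ v, f (x - ε * v) * truncDiff v) (𝓝[>] 0) (𝓝 0) := by
    have h0 : Real.pi⁻¹ * ∫ v, f x * truncDiff v = 0 := by
      rw [integral_const_mul, integral_truncDiff]; simp
    have hgoal : Tendsto (fun ε => Real.pi⁻¹ * ∫ v, f (x - ε * v) * truncDiff v) (𝓝[>] 0)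
        (𝓝 (Real.pi⁻¹ * ∫ v, f x * truncDiff v)) := ?_
    · rwa [h0] at hgoal
    refine Tendsto.const_mul _ ?_
    refine tendsto_integral_filter_of_dominated_convergence (fun v => C * ‖truncDiff v‖) ?_ ?_
      (integrable_truncDiff.norm.const_mul C) ?_
    · exact .of_forall fun ε => ((hf.comp (by fun_prop)).aestronglyMeasurable).mul
        measurable_truncDiff.aestronglyMeasurable
    · refine .of_forall fun ε => .of_forall fun v => ?_
      rw [norm_mul]
      exact mul_le_mul_of_nonneg_right (hC _) (norm_nonneg _)
    · refine .of_forall fun v => Tendsto.mul_const _ ?_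
      have : Continuous fun ε => f (x - ε * v) := hf.comp (by fun_prop)
      simpa using (this.tendsto 0).mono_left nhdsWithin_le_nhds
  refine h.congr' ?_
  filter_upwards [self_mem_nhdsWithin] with ε hε
  exact (truncHilbert_sub_conjPoisson hf2 x hε).symm

end truncation

/-! ### The Hilbert transform on `H¹`. -/

section hilbert

variable {f g : ℝ → ℝ} {q r : ℝ → ℂ}

theorem HasHilbertAt.eq {x h : ℝ} (hh : HasHilbertAt f x h) : hilbert f x = h := hh.limUnder_eq

theorem HasSpectrum.abs_le (h : HasSpectrum f q) (x : ℝ) : |f x| ≤ ∫ ξ, ‖q ξ‖ := by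
  have := norm_fourier_le (q := q) x
  rw [← h.eq, Complex.norm_real] at this
  exact this

theorem HasSpectrum.tendsto_truncHilbert (h : HasSpectrum f q) (x : ℝ) :
    Tendsto (fun ε => (truncHilbert f x ε : ℂ)) (𝓝[>] 0)
      (𝓝 (𝓕 (fun ξ => hilbertMul ξ * q ξ) x)) := by
  have h1 := (Complex.continuous_ofReal.tendsto 0).comp
    (tendsto_truncHilbert_sub h.continuous h.memLp_fun h.abs_le x)
  have h2 := (tendsto_conjPoisson h.integrable h.memLp x).const_mul ((Real.pi : ℂ)⁻¹)
  have hpi : (Real.pi : ℂ) ≠ 0 := by exact_mod_cast Real.pi_ne_zero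
  rw [inv_mul_cancel_left₀ hpi] at h2
  have h3 := h1.add h2
  simp only [Complex.ofReal_zero, zero_add] at h3
  refine h3.congr fun ε => ?_
  have e : ∫ y : ℝ, (((x - y) / (ε ^ 2 + (x - y) ^ 2) : ℝ) : ℂ) * 𝓕 q y
      = ((∫ y, (x - y) / (ε ^ 2 + (x - y) ^ 2) * f y : ℝ) : ℂ) := by
    rw [← integral_complex_ofReal]
    congr 1 with y
    rw [← h.eq, ← Complex.ofReal_mul]
  rw [e]
  simp only [Function.comp_apply]
  push_cast
  ring

theorem HasSpectrum.hasHilbertAt_re (h : HasSpectrum f q) (x : ℝ) :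
    HasHilbertAt f x (𝓕 (fun ξ => hilbertMul ξ * q ξ) x).re := by
  have := (Complex.continuous_re.tendsto _).comp (h.tendsto_truncHilbert x)
  simpa [Function.comp_def, HasHilbertAt] using this

theorem HasSpectrum.hilbert_eq (h : HasSpectrum f q) (x : ℝ) :
    (hilbert f x : ℂ) = 𝓕 (fun ξ => hilbertMul ξ * q ξ) x := by
  refine Complex.ext ?_ ?_
  · rw [Complex.ofReal_re]
    exact (h.hasHilbertAt_re x).eq
  · have := (Complex.continuous_im.tendsto _).comp (h.tendsto_truncHilbert x)
    simp only [Function.comp_def, Complex.ofReal_im] at this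
    rw [Complex.ofReal_im]
    exact tendsto_nhds_unique tendsto_const_nhds this

theorem HasSpectrum.hasHilbertAt (h : HasSpectrum f q) (x : ℝ) :
    HasHilbertAt f x (hilbert f x) := by
  rw [(h.hasHilbertAt_re x).eq]
  exact h.hasHilbertAt_re x

theorem HasSpectrum.hilbert (h : HasSpectrum f q) :
    HasSpectrum (hilbert f) (fun ξ => hilbertMul ξ * q ξ) where
  integrable := integrable_hilbertMul h.integrable
  memLp := memLp_hilbertMul h.memLp
  memLp_deriv := by
    have := memLp_hilbertMul h.memLp_deriv
    refine (memLp_congr_ae (.of_forall fun ξ => ?_)).1 this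
    ring
  eq := h.hilbert_eq

theorem HasSpectrum.eLpNorm_hilbert_le (h : HasSpectrum f q) :
    eLpNorm (_root_.hilbert f) 2 volume ≤ eLpNorm f 2 volume := by
  rw [h.hilbert.eLpNorm_eq, h.eLpNorm_eq]
  refine eLpNorm_mono fun ξ => ?_
  rw [norm_mul]
  exact mul_le_of_le_one_left (norm_nonneg _) (norm_hilbertMul_le ξ)

theorem HasSpectrum.abs_hilbert_le (h : HasSpectrum f q) (x : ℝ) :
    |_root_.hilbert f x| ≤ ∫ ξ, ‖q ξ‖ := by
  refine (h.hilbert.abs_le x).trans ?_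
  refine integral_mono h.hilbert.integrable.norm h.integrable.norm fun ξ => ?_
  simp only [norm_mul]
  exact mul_le_of_le_one_left (norm_nonneg _) (norm_hilbertMul_le ξ)

theorem MemH1.hasHilbertAt (h : MemH1 f) (x : ℝ) : HasHilbertAt f x (_root_.hilbert f x) := by
  obtain ⟨q, hq⟩ := h.exists_hasSpectrum
  exact hq.hasHilbertAt x

theorem MemH1.hilbert (h : MemH1 f) : MemH1 (hilbert f) := by
  obtain ⟨q, hq⟩ := h.exists_hasSpectrum
  exact hq.hilbert.memH1

theorem MemH1.eLpNorm_hilbert_le (h : MemH1 f) :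
    eLpNorm (_root_.hilbert f) 2 volume ≤ eLpNorm f 2 volume := by
  obtain ⟨q, hq⟩ := h.exists_hasSpectrum
  exact hq.eLpNorm_hilbert_le

/-- The norm of the embeddings of `H¹` into bounded functions. -/
noncomputable def supConst : ENNReal := eLpNorm (fun ξ : ℝ => ((1 + |ξ|)⁻¹ : ℝ)) 2 volume

theorem supConst_lt_top : supConst < ⊤ := memLp_weight.2

theorem HasSpectrum.ofReal_integral_le (h : HasSpectrum f q) :
    ENNReal.ofReal (∫ ξ, ‖q ξ‖) ≤ supConst * h1Norm f := by
  rw [ofReal_integral_norm_eq_lintegral_enorm h.integrable, ← eLpNorm_one_eq_lintegral_enorm]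
  exact h.eLpNorm_one_le

theorem MemH1.enorm_le (h : MemH1 f) (x : ℝ) : ‖f x‖ₑ ≤ supConst * h1Norm f := by
  obtain ⟨q, hq⟩ := h.exists_hasSpectrum
  refine le_trans ?_ hq.ofReal_integral_le
  rw [← ofReal_norm]
  exact ENNReal.ofReal_le_ofReal (hq.abs_le x)

theorem MemH1.enorm_hilbert_le (h : MemH1 f) (x : ℝ) :
    ‖_root_.hilbert f x‖ₑ ≤ supConst * h1Norm f := by
  obtain ⟨q, hq⟩ := h.exists_hasSpectrum
  refine le_trans ?_ hq.ofReal_integral_le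
  rw [← ofReal_norm]
  exact ENNReal.ofReal_le_ofReal (hq.abs_hilbert_le x)

theorem integrableOn_truncHilbert (hf : MemLp f 2) (x : ℝ) {ε : ℝ} (hε : 0 < ε) :
    IntegrableOn (fun y => f y / (x - y)) {y : ℝ | ε < |x - y|} := by
  have hs : MeasurableSet {y : ℝ | ε < |x - y|} :=
    measurableSet_lt measurable_const (by fun_prop)
  rw [← integrable_indicator_iff hs]
  refine ((memLp_indicator_inv hε x).integrable_mul hf).congr (.of_forall fun y => ?_)
  by_cases hy : y ∈ {y : ℝ | ε < |x - y|}
  · simp only [Pi.mul_apply, indicator_of_mem hy]; ring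
  · simp only [Pi.mul_apply, indicator_of_notMem hy, zero_mul]

theorem HasHilbertAt.sub (hf : MemLp f 2) (hg : MemLp g 2) {x a b : ℝ} (ha : HasHilbertAt f x a)
    (hb : HasHilbertAt g x b) : HasHilbertAt (f - g) x (a - b) := by
  refine (Tendsto.sub ha hb).congr' ?_
  filter_upwards [self_mem_nhdsWithin] with ε hε
  rw [truncHilbert, truncHilbert, truncHilbert, ← mul_sub, ← integral_sub
    (integrableOn_truncHilbert hf x hε) (integrableOn_truncHilbert hg x hε)]
  congr 2 with y
  simp only [Pi.sub_apply]
  ring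

theorem hilbert_sub (hf : MemH1 f) (hg : MemH1 g) :
    hilbert (f - g) = hilbert f - hilbert g :=
  funext fun x => (HasHilbertAt.sub hf.memLp hg.memLp (hf.hasHilbertAt x) (hg.hasHilbertAt x)).eq

end hilbert

/-! ### Functions with spectrum in the half line. -/

section algebra

variable {q r : ℝ → ℂ}

theorem fourier_add_apply (hq : Integrable q) (hr : Integrable r) (x : ℝ) :
    𝓕 (fun ξ => q ξ + r ξ) x = 𝓕 q x + 𝓕 r x := by
  simp_rw [fourier_eq_mul, mul_add]
  exact integral_add (integrable_fourierExp_mul hq x) (integrable_fourierExp_mul hr x)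

theorem fourier_const_mul_apply (c : ℂ) (x : ℝ) : 𝓕 (fun ξ => c * q ξ) x = c * 𝓕 q x := by
  simp_rw [fourier_eq_mul, ← integral_const_mul]
  congr 1 with ξ
  ring

theorem ae_eq_of_fourier_eq (hq : Integrable q) (hq2 : MemLp q 2) (hr : Integrable r)
    (h : 𝓕 q = 𝓕 r) : q =ᵐ[volume] r := by
  have hF : MemLp (𝓕 q) 2 := memLp_fourier hq hq2
  have hF' : MemLp (𝓕 r) 2 := by rwa [← h]
  have h1 := fourierInv_toLp_fourier_ae_eq hq hF
  have h2 := fourierInv_toLp_fourier_ae_eq hr hF'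
  have e : hF.toLp (𝓕 q) = hF'.toLp (𝓕 r) := by simp only [h]
  rw [e] at h1
  exact h1.symm.trans h2

theorem conj_fourier_apply (x : ℝ) :
    (starRingEnd ℂ) (𝓕 q x) = 𝓕 (fun ξ => (starRingEnd ℂ) (q (-ξ))) x := by
  rw [fourier_eq_mul, fourier_eq_mul, ← integral_conj, ← integral_neg_eq_self]
  congr 1 with ξ
  rw [map_mul, conj_fourierExp]
  congr 2
  ring

/-- Square integrability is read off from the transform, a bounded function times an `L²` one. For
`ξ < 0` one of `t` and `ξ - t` is negative, so the convolution integrand vanishes when both spectra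
lie in `[0, ∞)`. -/
theorem exists_convolution (hq : Integrable q) (hq2 : MemLp q 2) (hr : Integrable r) :
    ∃ c : ℝ → ℂ, Integrable c ∧ MemLp c 2 ∧ (∀ x, 𝓕 c x = 𝓕 q x * 𝓕 r x) ∧
      ((∀ᵐ ξ, ξ < 0 → q ξ = 0) → (∀ᵐ ξ, ξ < 0 → r ξ = 0) → ∀ ξ, ξ < 0 → c ξ = 0) := by
  let c := convolution q r (ContinuousLinearMap.mul ℂ ℂ) volume
  have hc : Integrable c := hq.integrable_convolution (ContinuousLinearMap.mul ℂ ℂ) hr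
  have hF : ∀ x, 𝓕 c x = 𝓕 q x * 𝓕 r x := fun x => Real.fourier_mul_convolution_eq hq hr x
  have hF2 : MemLp (𝓕 c) 2 := by
    have h1 : MemLp (fun x => 𝓕 r x * 𝓕 q x) 2 := by
      refine (memLp_fourier hq hq2).of_le_mul (c := ∫ ξ, ‖r ξ‖)
        ((continuous_fourier_of_integrable hr).aestronglyMeasurable.mul
          (continuous_fourier_of_integrable hq).aestronglyMeasurable) (.of_forall fun x => ?_)
      rw [norm_mul]
      exact mul_le_mul_of_nonneg_right (norm_fourier_le x) (norm_nonneg _)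
    refine (memLp_congr_ae (.of_forall fun x => ?_)).1 h1
    simp only [hF, mul_comm]
  refine ⟨c, hc, memLp_two_of_memLp_fourier hc hF2, hF, fun h1 h2 ξ hξ => ?_⟩
  have h3 : ∀ᵐ t : ℝ, ξ - t < 0 → r (ξ - t) = 0 :=
    (Measure.measurePreserving_sub_left volume ξ).quasiMeasurePreserving.ae h2
  have : ∀ᵐ t : ℝ, (ContinuousLinearMap.mul ℂ ℂ) (q t) (r (ξ - t)) = 0 := by
    filter_upwards [h1, h3] with t ht1 ht3
    rcases lt_or_ge t 0 with h | h
    · simp [ht1 h]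
    · simp [ht3 (by linarith)]
  simp only [c, convolution]
  rw [integral_congr_ae this, integral_zero]

end algebra

/-- Functions `𝓕 q` with `q` integrable, square integrable and vanishing on `(-∞, 0)`. -/
def IsHardy (F : ℝ → ℂ) : Prop :=
  ∃ q : ℝ → ℂ, Integrable q ∧ MemLp q 2 ∧ (∀ᵐ ξ, ξ < 0 → q ξ = 0) ∧ ∀ x, F x = 𝓕 q x

section hardy

variable {F G : ℝ → ℂ}

theorem IsHardy.add (hF : IsHardy F) (hG : IsHardy G) : IsHardy (fun x => F x + G x) := by
  obtain ⟨q, h1, h2, h3, h4⟩ := hF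
  obtain ⟨r, k1, k2, k3, k4⟩ := hG
  refine ⟨fun ξ => q ξ + r ξ, h1.add k1, h2.add k2, ?_, fun x => ?_⟩
  · filter_upwards [h3, k3] with ξ a b hξ
    rw [a hξ, b hξ, add_zero]
  · simp only [fourier_add_apply h1 k1, h4, k4]

theorem IsHardy.const_mul (c : ℂ) (hF : IsHardy F) : IsHardy (fun x => c * F x) := by
  obtain ⟨q, h1, h2, h3, h4⟩ := hF
  refine ⟨fun ξ => c * q ξ, h1.const_mul c, h2.const_mul c, ?_, fun x => ?_⟩
  · filter_upwards [h3] with ξ a hξ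
    rw [a hξ, mul_zero]
  · simp only [fourier_const_mul_apply, h4]

theorem IsHardy.mul (hF : IsHardy F) (hG : IsHardy G) : IsHardy (fun x => F x * G x) := by
  obtain ⟨q, h1, h2, h3, h4⟩ := hF
  obtain ⟨r, k1, k2, k3, k4⟩ := hG
  obtain ⟨c, c1, c2, c3, c4⟩ := exists_convolution h1 h2 k1
  exact ⟨c, c1, c2, .of_forall (c4 h3 k3), fun x => by simp only [c3, h4, k4]⟩

/-- If `F` is in the Hardy class and `h ‖F‖ < 2`, then so is the solution `G` of
`G (2 - h F) = 2 F`. -/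
theorem IsHardy.of_resolvent (hF : IsHardy F) {K h : ℝ} (hh : 0 ≤ h) (hK : ∀ x, ‖F x‖ ≤ K)
    (hhK : h * K < 2) {g : ℝ → ℂ} (hg : Integrable g) (hg2 : MemLp g 2)
    (hG : ∀ x, 𝓕 g x * (2 - h * F x) = 2 * F x) : IsHardy (𝓕 g) := by
  have hF0 := hF
  obtain ⟨f, f1, f2, f3, f4⟩ := hF
  -- The spectrum of `G` is split into its negative part `b` and the rest `a`; the aim is `b = 0`.
  set b : ℝ → ℂ := (Iio (0 : ℝ)).indicator g
  set a : ℝ → ℂ := (Iio (0 : ℝ))ᶜ.indicator g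
  have hab : ∀ ξ, a ξ + b ξ = g ξ := fun ξ => by
    rw [add_comm]; exact congrFun (indicator_self_add_compl (Iio (0 : ℝ)) g) ξ
  have hb : Integrable b := hg.indicator measurableSet_Iio
  have hb2 : MemLp b 2 := hg2.indicator measurableSet_Iio
  have ha : Integrable a := hg.indicator measurableSet_Iio.compl
  have ha2 : MemLp a 2 := hg2.indicator measurableSet_Iio.compl
  have ha0 : ∀ ξ, ξ < 0 → a ξ = 0 := fun ξ hξ => indicator_of_notMem (by simp [hξ]) _
  have hA : IsHardy (𝓕 a) := ⟨a, ha, ha2, .of_forall ha0, fun x => rfl⟩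
  have hsum : ∀ x, 𝓕 g x = 𝓕 a x + 𝓕 b x := fun x => by
    rw [← fourier_add_apply ha hb]; simp_rw [hab]
  obtain ⟨c, c1, c2, c3, -⟩ := exists_convolution hb hb2 f1
  obtain ⟨e, e1, e2, e3, e4⟩ := ((hF0.const_mul 2).add ((hA.const_mul (-2)).add
    ((hF0.mul hA).const_mul (h : ℂ))))
  -- All terms known to have nonnegative spectrum are moved to the right. On negative frequencies
  -- this leaves `b = (h / 2) c`, where `𝓕 c = F · 𝓕 b`.
  have hE : 𝓕 (fun ξ => 2 * b ξ + (-h : ℂ) * c ξ) = 𝓕 e := by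
    funext x
    rw [fourier_add_apply (hb.const_mul 2) (c1.const_mul _), fourier_const_mul_apply,
      fourier_const_mul_apply, c3, ← e4, ← f4]
    have := hG x
    rw [hsum] at this
    linear_combination this
  have hae := ae_eq_of_fourier_eq ((hb.const_mul 2).add (c1.const_mul (-h : ℂ)))
    ((hb2.const_mul 2).add (c2.const_mul (-h : ℂ))) e1 hE
  have hbound : ∀ᵐ ξ, ‖b ξ‖ ≤ (h / 2) * ‖c ξ‖ := by
    filter_upwards [hae, e3] with ξ h1 h2
    by_cases hξ : ξ < 0
    · simp only [Pi.add_apply, h2 hξ] at h1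
      have : b ξ = ((h / 2 : ℝ) : ℂ) * c ξ := by
        push_cast
        linear_combination h1 / 2
      rw [this, norm_mul, Complex.norm_real, Real.norm_of_nonneg (by positivity)]
    · rw [show b ξ = 0 from indicator_of_notMem (by simpa using hξ) _, norm_zero]
      positivity
  have hK0 : 0 ≤ K := (norm_nonneg _).trans (hK 0)
  have n1 : eLpNorm b 2 volume ≤ ENNReal.ofReal (h / 2) * eLpNorm c 2 volume :=
    eLpNorm_le_mul_eLpNorm_of_ae_le_mul hbound 2
  have n2 : eLpNorm (𝓕 c) 2 volume ≤ ENNReal.ofReal K * eLpNorm (𝓕 b) 2 volume := by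
    refine eLpNorm_le_mul_eLpNorm_of_ae_le_mul (.of_forall fun x => ?_) 2
    rw [c3, ← f4, norm_mul, mul_comm]
    exact mul_le_mul_of_nonneg_right (hK x) (norm_nonneg _)
  rw [eLpNorm_fourier c1 c2, eLpNorm_fourier hb hb2] at n2
  -- Plancherel in both directions gives a bound of `b` by itself with a factor less than one.
  have n3 : eLpNorm b 2 volume ≤ ENNReal.ofReal (h / 2 * K) * eLpNorm b 2 volume := by
    rw [ENNReal.ofReal_mul (by positivity), mul_assoc]
    exact n1.trans (mul_le_mul_right n2 _)
  have hb0 : eLpNorm b 2 volume = 0 := by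
    by_contra hne
    have : ENNReal.ofReal (h / 2 * K) < 1 := by
      rw [ENNReal.ofReal_lt_one]; linarith
    have h5 := ENNReal.mul_lt_mul_left hne hb2.2.ne this
    rw [one_mul] at h5
    exact absurd n3 (not_le.2 h5)
  have hbz : b =ᵐ[volume] 0 := (eLpNorm_eq_zero_iff hb2.1 (by norm_num)).1 hb0
  refine ⟨g, hg, hg2, ?_, fun x => rfl⟩
  filter_upwards [hbz] with ξ h1 hξ
  rw [← hab, ha0 ξ hξ, h1, Pi.zero_apply, add_zero]

/-- In the Hardy class the real part is the Hilbert transform of the imaginary part. -/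
theorem IsHardy.hilbert_im {R J : ℝ → ℝ} (hR : MemH1 R) (hJ : MemH1 J)
    (h : IsHardy (fun x => (R x : ℂ) + Complex.I * J x)) : hilbert J = R := by
  obtain ⟨r, hr⟩ := hR.exists_hasSpectrum
  obtain ⟨p, hp⟩ := hJ.exists_hasSpectrum
  obtain ⟨q, q1, q2, q3, q4⟩ := h
  have e1 : (fun ξ => r ξ + Complex.I * p ξ) =ᵐ[volume] q := by
    refine ae_eq_of_fourier_eq (hr.integrable.add (hp.integrable.const_mul _))
      (hr.memLp.add (hp.memLp.const_mul _)) q1 ?_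
    funext x
    rw [fourier_add_apply hr.integrable (hp.integrable.const_mul _), fourier_const_mul_apply,
      ← hr.eq, ← hp.eq, ← q4]
  have real : ∀ {f : ℝ → ℝ} {s : ℝ → ℂ}, HasSpectrum f s →
      s =ᵐ[volume] fun ξ => (starRingEnd ℂ) (s (-ξ)) := by
    intro f s hs
    have hint : Integrable (fun ξ => (starRingEnd ℂ) (s (-ξ))) := by
      have := hs.integrable.comp_neg
      exact (Complex.conjCLE.toContinuousLinearMap.integrable_comp this)
    refine ae_eq_of_fourier_eq hs.integrable hs.memLp hint ?_
    funext x
    rw [← conj_fourier_apply, ← hs.eq, Complex.conj_ofReal]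
  have negae : ∀ {P : ℝ → Prop}, (∀ᵐ ξ, P ξ) → ∀ᵐ ξ, P (-ξ) := fun hP =>
    (Measure.measurePreserving_neg (volume : Measure ℝ)).quasiMeasurePreserving.ae hP
  have hne : ∀ᵐ ξ : ℝ, ξ ≠ 0 := Measure.ae_ne volume 0
  -- For `ξ < 0` the vanishing of `q` gives `r = -I p`. For `ξ > 0` the same relation at `-ξ` is
  -- conjugated, by the symmetry `real` of spectra of real functions.
  have e2 : (fun ξ => hilbertMul ξ * p ξ) =ᵐ[volume] r := by
    filter_upwards [e1, q3, negae e1, negae q3, real hr, real hp, hne] with ξ a1 a2 a3 a4 a5 a6 a7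
    rcases lt_or_gt_of_ne a7 with hξ | hξ
    · rw [hilbertMul_of_neg hξ]
      rw [a2 hξ] at a1
      linear_combination -a1
    · rw [hilbertMul_of_pos hξ, a5, a6]
      rw [a4 (by linarith)] at a3
      have := congrArg (starRingEnd ℂ) a3
      simp only [map_add, map_mul, Complex.conj_I, map_zero] at this
      linear_combination -this
  funext x
  have := hp.hilbert_eq x
  rw [Real.fourier_congr_ae e2, ← hr.eq] at this
  exact_mod_cast this

end hardy

/-- The boundary value of the analytic function attached to `f`. -/
noncomputable def analyticSignal (f : ℝ → ℝ) (x : ℝ) : ℂ := hilbert f x + Complex.I * f x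

theorem HasSpectrum.isHardy_analyticSignal {f : ℝ → ℝ} {q : ℝ → ℂ} (h : HasSpectrum f q) :
    IsHardy (analyticSignal f) := by
  refine ⟨fun ξ => hilbertMul ξ * q ξ + Complex.I * q ξ, h.hilbert.integrable.add
    (h.integrable.const_mul _), h.hilbert.memLp.add (h.memLp.const_mul _), ?_, fun x => ?_⟩
  · refine .of_forall fun ξ hξ => ?_
    simp only [hilbertMul_of_neg hξ]; ring
  · rw [fourier_add_apply h.hilbert.integrable (h.integrable.const_mul _), fourier_const_mul_apply,
      ← h.hilbert_eq, ← h.eq, analyticSignal]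

/-! ### The explicit solution. -/

section lipschitz

variable {u v F : ℝ → ℝ} {K : ℝ}

theorem LocAC.of_abs_sub_le (hu : LocAC u) (hv : LocAC v)
    (h : ∀ x y, |F x - F y| ≤ K * (|u x - u y| + |v x - v y|)) : LocAC F := by
  intro a b
  have h1 : Tendsto _ _ _ := hu a b
  have h2 : Tendsto _ _ _ := hv a b
  have h3 := (h1.add h2).const_mul K
  simp only [add_zero, mul_zero] at h3
  refine squeeze_zero (fun t => ?_) (fun t => ?_) h3
  · exact Finset.sum_nonneg fun i _ => dist_nonneg
  · rw [← Finset.sum_add_distrib, Finset.mul_sum]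
    exact Finset.sum_le_sum fun i _ => by simpa [Real.dist_eq] using h _ _

theorem abs_deriv_le_of_abs_sub_le {x : ℝ} (hu : DifferentiableAt ℝ u x)
    (hv : DifferentiableAt ℝ v x) (hF : DifferentiableAt ℝ F x)
    (h : ∀ x y, |F x - F y| ≤ K * (|u x - u y| + |v x - v y|)) :
    |deriv F x| ≤ K * (|deriv u x| + |deriv v x|) := by
  have h1 := (hasDerivAt_iff_tendsto_slope.1 hu.hasDerivAt).abs
  have h2 := (hasDerivAt_iff_tendsto_slope.1 hv.hasDerivAt).abs
  have h3 := (hasDerivAt_iff_tendsto_slope.1 hF.hasDerivAt).abs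
  refine le_of_tendsto_of_tendsto' h3 ((h1.add h2).const_mul K) fun y => ?_
  simp only [slope, vsub_eq_sub, smul_eq_mul, abs_mul]
  have := mul_le_mul_of_nonneg_left (h y x) (abs_nonneg (y - x)⁻¹)
  linarith

/-- The `H¹` size of the pair `(u, v)`. -/
noncomputable def pairNorm (u v : ℝ → ℝ) : ENNReal :=
  eLpNorm (fun x => |u x| + |v x|) 2 volume + eLpNorm (fun x => |deriv u x| + |deriv v x|) 2 volume

theorem MemH1.pairNorm_lt_top (hu : MemH1 u) (hv : MemH1 v) : pairNorm u v < ⊤ :=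
  ENNReal.add_lt_top.2 ⟨(hu.memLp.norm.add hv.memLp.norm).2,
    (hu.memLp_deriv.norm.add hv.memLp_deriv.norm).2⟩

/-- Stability of `H¹` under Lipschitz functions of a pair. Applied to `(H(f), f)`, it gives every
`H¹` estimate of the explicit solution from pointwise bounds, without differentiating a quotient. -/
theorem MemH1.of_abs_sub_le (hu : MemH1 u) (hv : MemH1 v)
    (h : ∀ x y, |F x - F y| ≤ K * (|u x - u y| + |v x - v y|))
    (h0 : ∀ x, |F x| ≤ K * (|u x| + |v x|)) :
    MemH1 F ∧ h1Norm F ≤ ENNReal.ofReal K * pairNorm u v := by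
  have hac := LocAC.of_abs_sub_le hu.locAC hv.locAC h
  have b0 : ∀ᵐ x, ‖F x‖ ≤ K * ‖|u x| + |v x|‖ := .of_forall fun x => by
    rw [Real.norm_eq_abs, Real.norm_of_nonneg (by positivity)]
    exact h0 x
  have b1 : ∀ᵐ x, ‖deriv F x‖ ≤ K * ‖|deriv u x| + |deriv v x|‖ := by
    filter_upwards [hu.locAC.ae_differentiableAt, hv.locAC.ae_differentiableAt,
      hac.ae_differentiableAt] with x h1 h2 h3
    rw [Real.norm_eq_abs, Real.norm_of_nonneg (by positivity)]
    exact abs_deriv_le_of_abs_sub_le h1 h2 h3 h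
  refine ⟨memH1_iff.2 ⟨hac, ?_, ?_⟩, ?_⟩
  · exact (hu.memLp.norm.add hv.memLp.norm).of_le_mul hac.continuous.aestronglyMeasurable b0
  · exact (hu.memLp_deriv.norm.add hv.memLp_deriv.norm).of_le_mul
      (measurable_deriv F).aestronglyMeasurable b1
  · rw [h1Norm, pairNorm, mul_add]
    exact add_le_add (eLpNorm_le_mul_eLpNorm_of_ae_le_mul b0 2)
      (eLpNorm_le_mul_eLpNorm_of_ae_le_mul b1 2)

end lipschitz

section signal

variable {f : ℝ → ℝ}

theorem norm_analyticSignal_sub_le (x y : ℝ) : ‖analyticSignal f x - analyticSignal f y‖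
    ≤ |hilbert f x - hilbert f y| + |f x - f y| := by
  have : analyticSignal f x - analyticSignal f y
      = ((hilbert f x - hilbert f y : ℝ) : ℂ) + Complex.I * ((f x - f y : ℝ) : ℂ) := by
    simp only [analyticSignal]; push_cast; ring
  rw [this]
  refine (norm_add_le _ _).trans_eq ?_
  rw [norm_mul, Complex.norm_I, one_mul, Complex.norm_real, Complex.norm_real]
  rfl

theorem norm_analyticSignal_le (x : ℝ) : ‖analyticSignal f x‖ ≤ |hilbert f x| + |f x| := by
  rw [analyticSignal]
  refine (norm_add_le _ _).trans_eq ?_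
  rw [norm_mul, Complex.norm_I, one_mul, Complex.norm_real, Complex.norm_real]
  rfl

theorem MemH1.exists_norm_analyticSignal_le (hf : MemH1 f) :
    ∃ M, 0 ≤ M ∧ ∀ x, ‖analyticSignal f x‖ ≤ M := by
  obtain ⟨q, hq⟩ := hf.exists_hasSpectrum
  have h0 : 0 ≤ ∫ ξ, ‖q ξ‖ := integral_nonneg fun ξ => norm_nonneg _
  refine ⟨(∫ ξ, ‖q ξ‖) + ∫ ξ, ‖q ξ‖, by linarith, fun x => (norm_analyticSignal_le x).trans ?_⟩
  exact add_le_add (hq.abs_hilbert_le x) (hq.abs_le x)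

theorem MemH1.continuous_analyticSignal (hf : MemH1 f) : Continuous (analyticSignal f) := by
  have h1 := hf.continuous
  have h2 := hf.hilbert.continuous
  unfold analyticSignal
  fun_prop

theorem MemH1.tendsto_analyticSignal (hf : MemH1 f) :
    Tendsto (analyticSignal f) (cocompact ℝ) (𝓝 0) := by
  obtain ⟨q, hq⟩ := hf.exists_hasSpectrum
  obtain ⟨p, -, -, -, hp⟩ := hq.isHardy_analyticSignal
  have : analyticSignal f = 𝓕 p := funext hp
  rw [this]
  exact Real.zero_at_infty_fourier p

/-- The explicit solution `z = H(ω) + i ω` of `z_t = z² / 2`. -/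
noncomputable def clmSignal (f : ℝ → ℝ) (t x : ℝ) : ℂ :=
  2 * analyticSignal f x / (2 - t * analyticSignal f x)

/-- The explicit solution of the Constantin--Lax--Majda equation. -/
noncomputable def clmSol (f : ℝ → ℝ) (t x : ℝ) : ℝ := (clmSignal f t x).im

theorem clmSignal_zero (x : ℝ) : clmSignal f 0 x = analyticSignal f x := by
  simp [clmSignal]

theorem clmSol_zero : clmSol f 0 = f := by
  funext x
  simp [clmSol, clmSignal_zero, analyticSignal]

/-- `2 - t z` stays away from zero on every compact time interval. -/
theorem MemH1.exists_lower_bound (hf : MemH1 f) {t₁ : ℝ} (ht₁ : 0 ≤ t₁)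
    (hne : ∀ t ∈ Icc 0 t₁, ∀ x, (2 : ℂ) - t * analyticSignal f x ≠ 0) :
    ∃ m, 0 < m ∧ ∀ t ∈ Icc 0 t₁, ∀ x, m ≤ ‖(2 : ℂ) - t * analyticSignal f x‖ := by
  -- By Riemann–Lebesgue the signal decays, so `‖t z‖ ≤ 1` off a compact set and the norm is at
  -- least one there. On the rest the minimum is positive; inserting `0` below makes that set
  -- nonempty.
  have h1 : ∀ᶠ x in cocompact ℝ, ‖analyticSignal f x‖ < 1 / (t₁ + 1) := by
    have := hf.tendsto_analyticSignal.norm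
    rw [norm_zero] at this
    exact this.eventually_lt_const (by positivity)
  obtain ⟨S, hS, hSc⟩ := mem_cocompact.1 h1
  have hcont : Continuous fun p : ℝ × ℝ => ‖(2 : ℂ) - p.1 * analyticSignal f p.2‖ := by
    have := hf.continuous_analyticSignal
    fun_prop
  have hK : IsCompact (Icc 0 t₁ ×ˢ (insert 0 S)) := isCompact_Icc.prod (hS.insert 0)
  obtain ⟨p, hp, hmin⟩ := hK.exists_isMinOn
    ⟨(0, 0), ⟨⟨le_rfl, ht₁⟩, mem_insert _ _⟩⟩ hcont.continuousOn
  have hpos : 0 < ‖(2 : ℂ) - p.1 * analyticSignal f p.2‖ := norm_pos_iff.2 (hne _ hp.1 _)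
  refine ⟨min 1 ‖(2 : ℂ) - p.1 * analyticSignal f p.2‖, lt_min one_pos hpos, fun t ht x => ?_⟩
  by_cases hx : x ∈ S
  · exact (min_le_right _ _).trans (hmin (show (t, x) ∈ _ from ⟨ht, mem_insert_of_mem _ hx⟩))
  · refine (min_le_left _ _).trans ?_
    have h2 : ‖analyticSignal f x‖ < 1 / (t₁ + 1) := hSc hx
    have h3 : ‖(t : ℂ) * analyticSignal f x‖ ≤ 1 := by
      rw [norm_mul, Complex.norm_real, Real.norm_of_nonneg ht.1]
      calc t * ‖analyticSignal f x‖ ≤ (t₁ + 1) * (1 / (t₁ + 1)) :=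
            mul_le_mul (by linarith [ht.2]) h2.le (norm_nonneg _) (by linarith)
        _ = 1 := by field_simp
    have h4 := norm_sub_norm_le (2 : ℂ) (t * analyticSignal f x)
    have h5 : ‖(2 : ℂ)‖ = 2 := by simp
    linarith

section bounds

variable {s t m M : ℝ}

theorem norm_div_sub_div_le {z w : ℂ} (hm : 0 < m) (hz : m ≤ ‖2 - t * z‖) (hw : m ≤ ‖2 - t * w‖) :
    ‖z / (2 - t * z) - w / (2 - t * w)‖ ≤ 2 / m ^ 2 * ‖z - w‖ := by
  have hz0 : (2 - t * z) ≠ 0 := norm_pos_iff.1 (hm.trans_le hz)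
  have hw0 : (2 - t * w) ≠ 0 := norm_pos_iff.1 (hm.trans_le hw)
  have e : z / (2 - t * z) - w / (2 - t * w) = 2 * (z - w) / ((2 - t * z) * (2 - t * w)) := by
    rw [div_sub_div _ _ hz0 hw0]; congr 1; ring
  rw [e, norm_div, norm_mul, norm_mul, Complex.norm_two, sq, div_mul_eq_mul_div]
  gcongr

theorem norm_div_two_sub_le {z : ℂ} (hm : 0 < m) (hz : m ≤ ‖2 - t * z‖) :
    ‖z / (2 - t * z)‖ ≤ m⁻¹ * ‖z‖ := by
  rw [norm_div, div_eq_inv_mul]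
  gcongr

theorem MemH1.clmSignal_component (hf : MemH1 f) (L : ℂ →L[ℝ] ℝ) (hL : ∀ z, |L z| ≤ ‖z‖)
    (hm : 0 < m) (hlow : ∀ x, m ≤ ‖(2 : ℂ) - t * analyticSignal f x‖) :
    MemH1 (fun x => L (clmSignal f t x)) := by
  -- A single constant must serve twice: `4 / m ^ 2` is a Lipschitz bound for `z ↦ 2z / (2 - tz)`,
  -- and `2 / m` bounds its size relative to `z`.
  refine (MemH1.of_abs_sub_le (K := 4 / m ^ 2 + 2 / m) hf.hilbert hf (fun x y => ?_)
    (fun x => ?_)).1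
  · rw [← map_sub]
    refine (hL _).trans ?_
    simp only [clmSignal, mul_div_assoc, ← mul_sub]
    rw [norm_mul, Complex.norm_two]
    have h1 := norm_div_sub_div_le hm (hlow x) (hlow y)
    have h2 := norm_analyticSignal_sub_le (f := f) x y
    have h3 := mul_le_mul_of_nonneg_left h2 (show 0 ≤ 2 / m ^ 2 by positivity)
    have h4 : 0 ≤ 2 / m * (|_root_.hilbert f x - _root_.hilbert f y| + |f x - f y|) := by positivity
    have h5 : 4 / m ^ 2 = 2 * (2 / m ^ 2) := by ring
    rw [add_mul, h5]
    linarith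
  · refine (hL _).trans ?_
    simp only [clmSignal, mul_div_assoc]
    rw [norm_mul, Complex.norm_two]
    have h1 := norm_div_two_sub_le hm (hlow x)
    have h2 := norm_analyticSignal_le (f := f) x
    have h3 := mul_le_mul_of_nonneg_left h2 (show 0 ≤ m⁻¹ by positivity)
    have h4 : 0 ≤ 4 / m ^ 2 * (|_root_.hilbert f x| + |f x|) := by positivity
    have h5 : 2 / m = 2 * m⁻¹ := by ring
    rw [add_mul, h5]
    linarith

theorem MemH1.clmSignal_re (hf : MemH1 f) (hm : 0 < m)
    (hlow : ∀ x, m ≤ ‖(2 : ℂ) - t * analyticSignal f x‖) :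
    MemH1 (fun x => (clmSignal f t x).re) :=
  hf.clmSignal_component Complex.reCLM Complex.abs_re_le_norm hm hlow

theorem MemH1.clmSol (hf : MemH1 f) (hm : 0 < m)
    (hlow : ∀ x, m ≤ ‖(2 : ℂ) - t * analyticSignal f x‖) : MemH1 (clmSol f t) :=
  hf.clmSignal_component Complex.imCLM Complex.abs_im_le_norm hm hlow

/-- The factorisation `key` of the difference of two signals displays the factor `s - t`; the result
is Lipschitz continuity in time with values in `H¹`. -/
theorem MemH1.h1Norm_clmSol_sub_le (hf : MemH1 f) (hm : 0 < m) (hM : 0 ≤ M)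
    (hMf : ∀ x, ‖analyticSignal f x‖ ≤ M)
    (hs : ∀ x, m ≤ ‖(2 : ℂ) - s * analyticSignal f x‖)
    (ht : ∀ x, m ≤ ‖(2 : ℂ) - t * analyticSignal f x‖) :
    h1Norm (_root_.clmSol f s - _root_.clmSol f t)
      ≤ ENNReal.ofReal (|s - t| * (8 * M / m ^ 3 + 2 * M / m ^ 2)) * pairNorm (_root_.hilbert f) f := by
  have key : ∀ x, clmSignal f s x - clmSignal f t x = 2 * (s - t) *
      ((analyticSignal f x / (2 - s * analyticSignal f x)) *
        (analyticSignal f x / (2 - t * analyticSignal f x))) := by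
    intro x
    have hz0 : (2 - s * analyticSignal f x) ≠ 0 := norm_pos_iff.1 (hm.trans_le (hs x))
    have hw0 : (2 - t * analyticSignal f x) ≠ 0 := norm_pos_iff.1 (hm.trans_le (ht x))
    rw [clmSignal, clmSignal, div_sub_div _ _ hz0 hw0, div_mul_div_comm, mul_div_assoc']
    congr 1; ring
  have hst : ‖(2 : ℂ) * (s - t)‖ = 2 * |s - t| := by
    rw [norm_mul, Complex.norm_two, ← Complex.ofReal_sub, Complex.norm_real, Real.norm_eq_abs]
  refine (MemH1.of_abs_sub_le hf.hilbert hf (fun x y => ?_) (fun x => ?_)).2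
  · have e : (_root_.clmSol f s - _root_.clmSol f t) x - (_root_.clmSol f s - _root_.clmSol f t) y
        = ((clmSignal f s x - clmSignal f t x) - (clmSignal f s y - clmSignal f t y)).im := by
      simp [_root_.clmSol]
    rw [e, key, key, ← mul_sub]
    refine (Complex.abs_im_le_norm _).trans ?_
    rw [norm_mul, hst]
    set p := analyticSignal f x / (2 - s * analyticSignal f x)
    set q := analyticSignal f x / (2 - t * analyticSignal f x)
    set p' := analyticSignal f y / (2 - s * analyticSignal f y)
    set q' := analyticSignal f y / (2 - t * analyticSignal f y)
    have e2 : p * q - p' * q' = p * (q - q') + (p - p') * q' := by ring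
    have hp : ‖p‖ ≤ m⁻¹ * M := (norm_div_two_sub_le hm (hs x)).trans
      (mul_le_mul_of_nonneg_left (hMf x) (by positivity))
    have hq' : ‖q'‖ ≤ m⁻¹ * M := (norm_div_two_sub_le hm (ht y)).trans
      (mul_le_mul_of_nonneg_left (hMf y) (by positivity))
    set d := |_root_.hilbert f x - _root_.hilbert f y| + |f x - f y| with hd
    have hd0 : 0 ≤ d := by positivity
    have hzd := norm_analyticSignal_sub_le (f := f) x y
    have h1 : ‖q - q'‖ ≤ 2 / m ^ 2 * d := (norm_div_sub_div_le hm (ht x) (ht y)).trans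
      (mul_le_mul_of_nonneg_left hzd (by positivity))
    have h2 : ‖p - p'‖ ≤ 2 / m ^ 2 * d := (norm_div_sub_div_le hm (hs x) (hs y)).trans
      (mul_le_mul_of_nonneg_left hzd (by positivity))
    have h3 : ‖p * q - p' * q'‖ ≤ 4 * M / m ^ 3 * d := by
      rw [e2]
      refine (norm_add_le _ _).trans ?_
      rw [norm_mul, norm_mul]
      calc ‖p‖ * ‖q - q'‖ + ‖p - p'‖ * ‖q'‖
          ≤ (m⁻¹ * M) * (2 / m ^ 2 * d) + (2 / m ^ 2 * d) * (m⁻¹ * M) := by gcongr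
        _ = 4 * M / m ^ 3 * d := by field_simp; ring
    have h4 : 0 ≤ |s - t| * (2 * M / m ^ 2) * d := by positivity
    calc 2 * |s - t| * ‖p * q - p' * q'‖ ≤ 2 * |s - t| * (4 * M / m ^ 3 * d) := by gcongr
      _ ≤ 2 * |s - t| * (4 * M / m ^ 3 * d) + |s - t| * (2 * M / m ^ 2) * d := by linarith
      _ = |s - t| * (8 * M / m ^ 3 + 2 * M / m ^ 2) * d := by ring
  · have e : (_root_.clmSol f s - _root_.clmSol f t) x
        = (clmSignal f s x - clmSignal f t x).im := by
      simp [_root_.clmSol]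
    rw [e, key]
    refine (Complex.abs_im_le_norm _).trans ?_
    rw [norm_mul, hst, norm_mul]
    set d := |_root_.hilbert f x| + |f x| with hd
    have hd0 : 0 ≤ d := by positivity
    have hp : ‖analyticSignal f x / (2 - s * analyticSignal f x)‖ ≤ m⁻¹ * M :=
      (norm_div_two_sub_le hm (hs x)).trans (mul_le_mul_of_nonneg_left (hMf x) (by positivity))
    have hq : ‖analyticSignal f x / (2 - t * analyticSignal f x)‖ ≤ m⁻¹ * d :=
      (norm_div_two_sub_le hm (ht x)).trans
        (mul_le_mul_of_nonneg_left (norm_analyticSignal_le x) (by positivity))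
    have h4 : 0 ≤ |s - t| * (8 * M / m ^ 3) * d := by positivity
    calc _ ≤ 2 * |s - t| * ((m⁻¹ * M) * (m⁻¹ * d)) := by gcongr
      _ ≤ 2 * |s - t| * ((m⁻¹ * M) * (m⁻¹ * d)) + |s - t| * (8 * M / m ^ 3) * d := by linarith
      _ = |s - t| * (8 * M / m ^ 3 + 2 * M / m ^ 2) * d := by field_simp; ring

end bounds

theorem clmSignal_eq (t x : ℝ) : clmSignal f t x
    = ((clmSignal f t x).re : ℂ) + Complex.I * clmSol f t x := by
  rw [clmSol, mul_comm]
  exact (Complex.re_add_im _).symm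

theorem MemH1.exists_clmSignal_fourier (hf : MemH1 f) {t m : ℝ} (hm : 0 < m)
    (hlow : ∀ x, m ≤ ‖(2 : ℂ) - t * analyticSignal f x‖) :
    ∃ g : ℝ → ℂ, Integrable g ∧ MemLp g 2 ∧ ∀ x, clmSignal f t x = 𝓕 g x := by
  obtain ⟨r, hr⟩ := (hf.clmSignal_re hm hlow).exists_hasSpectrum
  obtain ⟨p, hp⟩ := (hf.clmSol hm hlow).exists_hasSpectrum
  refine ⟨fun ξ => r ξ + Complex.I * p ξ, hr.integrable.add (hp.integrable.const_mul _),
    hr.memLp.add (hp.memLp.const_mul _), fun x => ?_⟩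
  rw [fourier_add_apply hr.integrable (hp.integrable.const_mul _), fourier_const_mul_apply,
    ← hr.eq, ← hp.eq]
  exact clmSignal_eq t x

/-- The flow of `z_t = z² / 2` is a semigroup: the signal `G` at time `n h + h` satisfies `G (2 - h
F) = 2 F` with `F` the signal at time `n h`. The bound `K` is uniform on `[0, t₁]`, so steps of
length `t₁ / n` with `n` large satisfy `h K < 2` and reach `t₁`. -/
theorem MemH1.isHardy_clmSignal (hf : MemH1 f) {t₁ m : ℝ} (ht₁ : 0 ≤ t₁) (hm : 0 < m)
    (hlow : ∀ t ∈ Icc 0 t₁, ∀ x, m ≤ ‖(2 : ℂ) - t * analyticSignal f x‖) :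
    IsHardy (clmSignal f t₁) := by
  obtain ⟨M, hM, hMf⟩ := hf.exists_norm_analyticSignal_le
  have hne : ∀ t ∈ Icc 0 t₁, ∀ x, (2 : ℂ) - t * analyticSignal f x ≠ 0 := fun t ht x =>
    norm_pos_iff.1 (hm.trans_le (hlow t ht x))
  set K := 2 * (m⁻¹ * M)
  have hK : ∀ t ∈ Icc 0 t₁, ∀ x, ‖clmSignal f t x‖ ≤ K := by
    intro t ht x
    rw [clmSignal, mul_div_assoc, norm_mul, Complex.norm_two]
    have := (norm_div_two_sub_le hm (hlow t ht x)).trans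
      (mul_le_mul_of_nonneg_left (hMf x) (by positivity))
    simp only [K]; linarith
  have step : ∀ h : ℝ, 0 ≤ h → h * K < 2 → ∀ n : ℕ, n * h ≤ t₁ → IsHardy (clmSignal f (n * h)) := by
    intro h hh hhK n
    induction n with
    | zero =>
      intro _
      obtain ⟨q, hq⟩ := hf.exists_hasSpectrum
      have : clmSignal f ((0 : ℕ) * h) = analyticSignal f := by
        funext x; simp [clmSignal_zero]
      rw [this]
      exact hq.isHardy_analyticSignal
    | succ n ih =>
      intro hn
      have hn' : (n : ℝ) * h + h ≤ t₁ := by push_cast at hn; linarith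
      have hnh : 0 ≤ (n : ℝ) * h := by positivity
      have ht : (n : ℝ) * h ∈ Icc 0 t₁ := ⟨hnh, by linarith⟩
      have ht' : (n : ℝ) * h + h ∈ Icc 0 t₁ := ⟨by linarith, hn'⟩
      have e : ((n + 1 : ℕ) : ℝ) * h = n * h + h := by push_cast; ring
      rw [e]
      obtain ⟨g, g1, g2, g3⟩ := hf.exists_clmSignal_fourier hm (hlow _ ht')
      have hg : clmSignal f (n * h + h) = 𝓕 g := funext g3
      rw [hg]
      refine (ih ht.2).of_resolvent hh (hK _ ht) hhK g1 g2 fun x => ?_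
      rw [← g3, clmSignal, clmSignal]
      have n1 := hne _ ht x
      have n2 := hne _ ht' x
      have e2 : (2 : ℂ) - ((n * h + h : ℝ) : ℂ) * analyticSignal f x
          = (2 - ((n * h : ℝ) : ℂ) * analyticSignal f x) - h * analyticSignal f x := by
        push_cast; ring
      rw [e2] at n2 ⊢
      generalize (2 - ((n * h : ℝ) : ℂ) * analyticSignal f x) = D at n1 n2 ⊢
      rw [div_mul_eq_mul_div, div_eq_iff n2]
      field_simp
  obtain ⟨n, hn⟩ := exists_nat_gt (t₁ * K)
  have hK0 : 0 ≤ K := by positivity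
  have hn0 : (0 : ℝ) < n := (by positivity : 0 ≤ t₁ * K).trans_lt hn
  have := step (t₁ / n) (by positivity) (by
    rw [div_mul_eq_mul_div, div_lt_iff₀ hn0]; linarith) n (by field_simp; rfl)
  rwa [mul_div_cancel₀ _ hn0.ne'] at this

theorem MemH1.hilbert_clmSol (hf : MemH1 f) {t₁ m : ℝ} (ht₁ : 0 ≤ t₁) (hm : 0 < m)
    (hlow : ∀ t ∈ Icc 0 t₁, ∀ x, m ≤ ‖(2 : ℂ) - t * analyticSignal f x‖) :
    _root_.hilbert (_root_.clmSol f t₁) = fun x => (clmSignal f t₁ x).re := by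
  have h1 := hlow t₁ ⟨ht₁, le_rfl⟩
  refine IsHardy.hilbert_im (hf.clmSignal_re hm h1) (hf.clmSol hm h1) ?_
  have : (fun x => ((clmSignal f t₁ x).re : ℂ) + Complex.I * _root_.clmSol f t₁ x)
      = clmSignal f t₁ := funext fun x => (clmSignal_eq t₁ x).symm
  rw [this]
  exact hf.isHardy_clmSignal ht₁ hm hlow

/-- The imaginary part of `z² / 2` is `Im z · Re z`. -/
theorem hasDerivAt_clmSol {t x : ℝ} (hne : (2 : ℂ) - t * analyticSignal f x ≠ 0) :
    HasDerivAt (fun s => clmSol f s x) (clmSol f t x * (clmSignal f t x).re) t := by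
  set z := analyticSignal f x with hz
  have h1 : HasDerivAt (fun s : ℝ => (2 : ℂ) - s * z) (-z) t := by
    have := ((Complex.ofRealCLM.hasDerivAt (x := t)).mul_const z).const_sub 2
    simpa using this
  have h2 : HasDerivAt (fun s : ℝ => clmSignal f s x) (clmSignal f t x ^ 2 / 2) t := by
    have := (hasDerivAt_const t (2 * z)).div h1 hne
    refine this.congr_deriv ?_
    rw [clmSignal, ← hz]
    field_simp
    ring
  have h3 := Complex.imCLM.hasFDerivAt.comp_hasDerivAt t h2
  refine h3.congr_deriv ?_
  have : clmSignal f t x ^ 2 / 2 = ((1 / 2 : ℝ) : ℂ) * (clmSignal f t x ^ 2) := by push_cast; ring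
  rw [this]
  simp [sq, clmSol]
  ring

theorem MemH1.isCLMSolution (hf : MemH1 f) {T : ℝ}
    (hne : ∀ t ∈ Ico 0 T, ∀ x, (2 : ℂ) - t * analyticSignal f x ≠ 0) :
    IsCLMSolution f T (_root_.clmSol f) ∧
      ∀ t ∈ Ico 0 T, _root_.hilbert (_root_.clmSol f t) = fun x => (clmSignal f t x).re := by
  have low : ∀ t₁ ∈ Ico 0 T, ∃ m, 0 < m ∧
      ∀ t ∈ Icc 0 t₁, ∀ x, m ≤ ‖(2 : ℂ) - t * analyticSignal f x‖ := fun t₁ ht₁ =>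
    hf.exists_lower_bound ht₁.1 fun t ht => hne t ⟨ht.1, ht.2.trans_lt ht₁.2⟩
  have hH : ∀ t ∈ Ico 0 T, _root_.hilbert (_root_.clmSol f t) = fun x => (clmSignal f t x).re := by
    intro t ht
    obtain ⟨m, hm, hlow⟩ := low t ht
    exact hf.hilbert_clmSol ht.1 hm hlow
  have hmem : ∀ t ∈ Ico 0 T, MemH1 (_root_.clmSol f t) := by
    intro t ht
    obtain ⟨m, hm, hlow⟩ := low t ht
    exact hf.clmSol hm (hlow t ⟨ht.1, le_rfl⟩)
  refine ⟨⟨clmSol_zero, ⟨hmem, fun t => deriv (_root_.clmSol f t), fun t ht =>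
    ⟨(hmem t ht).memLp_deriv, (hmem t ht).locAC.isWeakDeriv⟩, fun t ht => ?_⟩, fun t ht x => ?_⟩, hH⟩
  -- The lower bound `m` is taken up to a time beyond `t`, so that it is uniform for all nearby
  -- times.
  · have ht' : (t + T) / 2 ∈ Ico 0 T := ⟨by linarith [ht.1, ht.2], by linarith [ht.2]⟩
    obtain ⟨m, hm, hlow⟩ := low _ ht'
    obtain ⟨M, hM, hMf⟩ := hf.exists_norm_analyticSignal_le
    set C := 8 * M / m ^ 3 + 2 * M / m ^ 2
    have hlim : Tendsto (fun s : ℝ => ENNReal.ofReal (|s - t| * C) * pairNorm (_root_.hilbert f) f)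
        (𝓝[Ico 0 T] t) (𝓝 0) := by
      have h1 : Tendsto (fun s : ℝ => |s - t| * C) (𝓝[Ico 0 T] t) (𝓝 0) := by
        have : Continuous fun s : ℝ => |s - t| * C := by fun_prop
        simpa using (this.tendsto t).mono_left nhdsWithin_le_nhds
      have h2 := ENNReal.Tendsto.mul_const (b := pairNorm (_root_.hilbert f) f)
        (ENNReal.tendsto_ofReal h1) (Or.inr (hf.hilbert.pairNorm_lt_top hf).ne)
      simpa using h2
    refine tendsto_of_tendsto_of_tendsto_of_le_of_le' tendsto_const_nhds hlim
      (.of_forall fun s => zero_le) ?_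
    have hev : ∀ᶠ s in 𝓝[Ico 0 T] t, s < (t + T) / 2 :=
      nhdsWithin_le_nhds (Iio_mem_nhds (by linarith [ht.2]))
    filter_upwards [hev, self_mem_nhdsWithin] with s hs hsI
    have hb := hf.h1Norm_clmSol_sub_le hm hM hMf (hlow s ⟨hsI.1, hs.le⟩)
      (hlow t ⟨ht.1, by linarith [ht.2]⟩)
    refine le_trans (le_of_eq ?_) hb
    rw [h1Norm]
    congr 1
    refine eLpNorm_congr_ae ?_
    filter_upwards [(hmem s hsI).locAC.ae_differentiableAt,
      (hmem t ht).locAC.ae_differentiableAt] with x h1 h2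
    exact (deriv_sub h1 h2).symm
  · rw [hH t ht]
    exact (hasDerivAt_clmSol (hne t ht x)).hasDerivWithinAt

end signal

/-! ### Uniqueness. -/

/-- Iterating the inequality `n` times bounds `y` by `Y (c t)ⁿ / n!`. In this form neither
continuity nor measurability of `y` has to be checked. -/
theorem gronwall_lintegral {y : ℝ → ENNReal} {t₁ c Y : ℝ} (hc : 0 ≤ c) (hY : 0 ≤ Y)
    (hb : ∀ t ∈ Icc 0 t₁, y t ≤ ENNReal.ofReal Y)
    (h : ∀ t ∈ Icc 0 t₁, y t ≤ ∫⁻ s in Ioc 0 t, ENNReal.ofReal c * y s) :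
    ∀ t ∈ Icc 0 t₁, y t = 0 := by
  have key : ∀ n : ℕ, ∀ t ∈ Icc 0 t₁, y t ≤ ENNReal.ofReal (Y * ((c * t) ^ n / n.factorial)) := by
    intro n
    induction n with
    | zero => intro t ht; simpa using hb t ht
    | succ n ih =>
      intro t ht
      refine (h t ht).trans ?_
      have h1 : ∫⁻ s in Ioc 0 t, ENNReal.ofReal c * y s
          ≤ ∫⁻ s in Ioc 0 t, ENNReal.ofReal (c * (Y * ((c * s) ^ n / n.factorial))) := by
        refine setLIntegral_mono' measurableSet_Ioc fun s hs => ?_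
        rw [ENNReal.ofReal_mul hc]
        exact mul_le_mul_right (ih s ⟨hs.1.le, hs.2.trans ht.2⟩) _
      refine h1.trans (le_of_eq ?_)
      rw [← ofReal_integral_eq_lintegral_ofReal]
      · congr 1
        rw [← intervalIntegral.integral_of_le ht.1]
        have : ∀ s : ℝ, c * (Y * ((c * s) ^ n / n.factorial))
            = (c ^ (n + 1) * Y / n.factorial) * s ^ n := fun s => by rw [mul_pow]; ring
        simp_rw [this]
        rw [intervalIntegral.integral_const_mul, integral_pow, Nat.factorial_succ]
        push_cast
        field_simp
        ring
      · refine (Continuous.integrableOn_Icc ?_).mono_set Ioc_subset_Icc_self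
        fun_prop
      · filter_upwards [self_mem_ae_restrict measurableSet_Ioc] with s hs
        have : 0 ≤ s := hs.1.le
        positivity
  intro t ht
  have h1 := (FloorSemiring.tendsto_pow_div_factorial_atTop (c * t)).const_mul Y
  have h2 := ENNReal.tendsto_ofReal h1
  rw [mul_zero, ENNReal.ofReal_zero] at h2
  exact le_antisymm (ge_of_tendsto' h2 fun n => key n t ht) zero_le

theorem h1Norm_le_sub_add {f g : ℝ → ℝ} (hf : MemH1 f) (hg : MemH1 g) :
    h1Norm f ≤ h1Norm (f - g) + h1Norm g := by
  have e1 : eLpNorm f 2 volume ≤ eLpNorm (f - g) 2 volume + eLpNorm g 2 volume := by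
    have := eLpNorm_add_le (hf.sub hg).memLp.1 hg.memLp.1 (p := 2) (by norm_num)
    rwa [sub_add_cancel] at this
  have e2 : eLpNorm (deriv f) 2 volume
      ≤ eLpNorm (deriv (f - g)) 2 volume + eLpNorm (deriv g) 2 volume := by
    have := eLpNorm_add_le (hf.sub hg).memLp_deriv.1 hg.memLp_deriv.1 (p := 2) (by norm_num)
    refine le_trans (le_of_eq (eLpNorm_congr_ae ?_)) this
    filter_upwards [hf.locAC.ae_differentiableAt, hg.locAC.ae_differentiableAt] with x h1 h2
    rw [Pi.add_apply, deriv_sub h1 h2, sub_add_cancel]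
  calc h1Norm f ≤ _ := add_le_add e1 e2
    _ = _ := by rw [h1Norm, h1Norm]; ring

section continuity

variable {T : ℝ} {ω : ℝ → ℝ → ℝ}

theorem ContinuousInH1.tendsto_h1Norm (h : ContinuousInH1 T ω) {t : ℝ} (ht : t ∈ Ico 0 T) :
    Tendsto (fun s => h1Norm (ω s - ω t)) (𝓝[Ico 0 T] t) (𝓝 0) := by
  obtain ⟨ωx, h1, h2⟩ := h.continuous_norm
  refine (h2 t ht).congr' ?_
  filter_upwards [self_mem_nhdsWithin] with s hs
  rw [h1Norm]
  congr 1
  refine eLpNorm_congr_ae ?_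
  have a1 := (h1 s hs).2.ae_eq_deriv (h.memH1 s hs) (h1 s hs).1
  have a2 := (h1 t ht).2.ae_eq_deriv (h.memH1 t ht) (h1 t ht).1
  filter_upwards [a1, a2, (h.memH1 s hs).locAC.ae_differentiableAt,
    (h.memH1 t ht).locAC.ae_differentiableAt] with x b1 b2 b3 b4
  rw [deriv_sub b3 b4, Pi.sub_apply, b1, b2]

theorem ContinuousInH1.eventually_abs_sub_le (h : ContinuousInH1 T ω) {t : ℝ} (ht : t ∈ Ico 0 T)
    {ε : ℝ} (hε : 0 < ε) : ∀ᶠ s in 𝓝[Ico 0 T] t, ∀ x,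
      |ω s x - ω t x| ≤ ε ∧ |hilbert (ω s) x - hilbert (ω t) x| ≤ ε := by
  have h1 := ENNReal.Tendsto.const_mul (a := supConst) (h.tendsto_h1Norm ht)
    (Or.inr supConst_lt_top.ne)
  rw [mul_zero] at h1
  have h2 := h1.eventually_lt_const (ENNReal.ofReal_pos.2 hε)
  filter_upwards [h2, self_mem_nhdsWithin] with s hs hsI x
  have hm := (h.memH1 s hsI).sub (h.memH1 t ht)
  constructor
  · have := (hm.enorm_le x).trans hs.le
    rw [← ofReal_norm, ENNReal.ofReal_le_ofReal_iff hε.le] at this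
    exact this
  · have := (hm.enorm_hilbert_le x).trans hs.le
    rw [← ofReal_norm, ENNReal.ofReal_le_ofReal_iff hε.le,
      hilbert_sub (h.memH1 s hsI) (h.memH1 t ht)] at this
    exact this

theorem ContinuousInH1.exists_h1Norm_le (h : ContinuousInH1 T ω) {t₁ : ℝ} (ht₁ : t₁ < T) :
    ∃ K : ENNReal, K < ⊤ ∧ ∀ t ∈ Icc 0 t₁, h1Norm (ω t) ≤ K := by
  have hsub : Icc 0 t₁ ⊆ Ico 0 T := fun t ht => ⟨ht.1, ht.2.trans_lt ht₁⟩
  refine isCompact_Icc.induction_on (p := fun S => ∃ K : ENNReal, K < ⊤ ∧ ∀ t ∈ S, h1Norm (ω t) ≤ K)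
    ⟨0, by simp, by simp⟩ ?_ ?_ ?_
  · rintro s t hst ⟨K, hK, h⟩
    exact ⟨K, hK, fun x hx => h x (hst hx)⟩
  · rintro s t ⟨K, hK, h⟩ ⟨K', hK', h'⟩
    refine ⟨max K K', max_lt hK hK', ?_⟩
    rintro x (hx | hx)
    · exact (h x hx).trans (le_max_left _ _)
    · exact (h' x hx).trans (le_max_right _ _)
  · intro t ht
    have h1 := (h.tendsto_h1Norm (hsub ht)).eventually_lt_const one_pos
    have h2 : {s | h1Norm (ω s - ω t) < 1} ∩ Icc 0 t₁ ∈ 𝓝[Icc 0 t₁] t :=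
      inter_mem (nhdsWithin_mono t hsub h1) self_mem_nhdsWithin
    refine ⟨_, h2, 1 + h1Norm (ω t),
      ENNReal.add_lt_top.2 ⟨by simp, (h.memH1 t (hsub ht)).h1Norm_lt_top⟩, fun s hs => ?_⟩
    exact (h1Norm_le_sub_add (h.memH1 s (hsub hs.2)) (h.memH1 t (hsub ht))).trans
      (add_le_add hs.1.le le_rfl)

theorem ContinuousInH1.exists_abs_le (h : ContinuousInH1 T ω) {t₁ : ℝ} (ht₁ : t₁ < T) :
    ∃ K : ℝ, 0 ≤ K ∧ ∀ t ∈ Icc 0 t₁, eLpNorm (ω t) 2 volume ≤ ENNReal.ofReal K ∧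
      ∀ x, |ω t x| ≤ K ∧ |hilbert (ω t) x| ≤ K := by
  obtain ⟨K, hK, hb⟩ := h.exists_h1Norm_le ht₁
  have hK' : (1 + supConst) * K < ⊤ :=
    ENNReal.mul_lt_top (ENNReal.add_lt_top.2 ⟨by simp, supConst_lt_top⟩) hK
  refine ⟨((1 + supConst) * K).toReal, ENNReal.toReal_nonneg, fun t ht => ?_⟩
  have hm := h.memH1 t ⟨ht.1, ht.2.trans_lt ht₁⟩
  rw [ENNReal.ofReal_toReal hK'.ne]
  have hsup : supConst * h1Norm (ω t) ≤ (1 + supConst) * K :=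
    mul_le_mul' (le_add_of_nonneg_left zero_le) (hb t ht)
  refine ⟨?_, fun x => ⟨?_, ?_⟩⟩
  · calc eLpNorm (ω t) 2 volume ≤ h1Norm (ω t) := le_self_add
      _ ≤ K := hb t ht
      _ ≤ _ := le_mul_of_one_le_left zero_le le_self_add
  · have := (hm.enorm_le x).trans hsup
    rw [← ofReal_norm, ENNReal.ofReal_le_iff_le_toReal hK'.ne] at this
    exact this
  · have := (hm.enorm_hilbert_le x).trans hsup
    rw [← ofReal_norm, ENNReal.ofReal_le_iff_le_toReal hK'.ne] at this
    exact this

/-- Joint continuity provides the time integrals at fixed `x` and the measurability for Tonelli's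
theorem in the uniqueness proof. -/
theorem continuousOn_of_uniform {g : ℝ → ℝ → ℝ} {S : Set ℝ} (hx : ∀ t ∈ S, Continuous (g t))
    (h : ∀ t ∈ S, ∀ ε > 0, ∀ᶠ s in 𝓝[S] t, ∀ x, |g s x - g t x| ≤ ε) :
    ContinuousOn (fun p : ℝ × ℝ => g p.1 p.2) (S ×ˢ univ) := by
  rintro ⟨t, x⟩ ⟨ht, -⟩
  rw [ContinuousWithinAt, Metric.tendsto_nhds]
  intro ε hε
  have h1 := h t ht (ε / 3) (by positivity)
  have h2 : ∀ᶠ y in 𝓝 x, dist (g t y) (g t x) < ε / 3 :=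
    Metric.tendsto_nhds.1 ((hx t ht).tendsto x) _ (by positivity)
  rw [nhdsWithin_prod_eq, nhdsWithin_univ]
  filter_upwards [h1.prod_mk h2] with p hp
  obtain ⟨a, b⟩ := hp
  have a' := a p.2
  rw [Real.dist_eq] at b ⊢
  calc |g p.1 p.2 - g t x| ≤ |g p.1 p.2 - g t p.2| + |g t p.2 - g t x| := abs_sub_le _ _ _
    _ < ε := by linarith

theorem ContinuousInH1.continuousOn_uncurry (h : ContinuousInH1 T ω) :
    ContinuousOn (fun p : ℝ × ℝ => ω p.1 p.2) (Ico 0 T ×ˢ univ) :=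
  continuousOn_of_uniform (fun t ht => (h.memH1 t ht).continuous) fun t ht ε hε => by
    filter_upwards [h.eventually_abs_sub_le ht hε] with s hs x using (hs x).1

theorem ContinuousInH1.continuousOn_hilbert_uncurry (h : ContinuousInH1 T ω) :
    ContinuousOn (fun p : ℝ × ℝ => hilbert (ω p.1) p.2) (Ico 0 T ×ˢ univ) :=
  continuousOn_of_uniform (g := fun t => hilbert (ω t))
    (fun t ht => (h.memH1 t ht).hilbert.continuous) fun t ht ε hε => by
    filter_upwards [h.eventually_abs_sub_le ht hε] with s hs x using (hs x).2

theorem ContinuousOn.slice {g : ℝ → ℝ → ℝ} {S : Set ℝ}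
    (h : ContinuousOn (fun p : ℝ × ℝ => g p.1 p.2) (S ×ˢ univ)) (x : ℝ) :
    ContinuousOn (fun s => g s x) S :=
  h.comp (f := fun s => (s, x)) (by fun_prop) fun s hs => ⟨hs, mem_univ _⟩

end continuity

theorem lintegral_ofReal_sq {f : ℝ → ℝ} : ∫⁻ x, ENNReal.ofReal (f x ^ 2) = eLpNorm f 2 volume ^ 2 := by
  rw [eLpNorm_eq_lintegral_rpow_enorm_toReal (by norm_num) (by norm_num), ← ENNReal.rpow_natCast,
    ← ENNReal.rpow_mul]
  simp only [ENNReal.toReal_ofNat, Nat.cast_ofNat]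
  norm_num
  congr 1 with x
  rw [← ofReal_norm, ← ENNReal.ofReal_pow (norm_nonneg _), Real.norm_eq_abs, sq_abs]

theorem IsCLMSolution.mono {f : ℝ → ℝ} {T T' : ℝ} {ω : ℝ → ℝ → ℝ} (h : IsCLMSolution f T ω)
    (hT : T' ≤ T) : IsCLMSolution f T' ω := by
  have hsub : Ico 0 T' ⊆ Ico 0 T := Ico_subset_Ico_right hT
  obtain ⟨ωx, h1, h2⟩ := h.regular.continuous_norm
  exact ⟨h.initial, ⟨fun t ht => h.regular.memH1 t (hsub ht), ωx, fun t ht => h1 t (hsub ht),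
    fun t ht => (h2 t (hsub ht)).mono_left (nhdsWithin_mono t hsub)⟩,
    fun t ht x => (h.equation t (hsub ht) x).mono hsub⟩

/-- The difference satisfies `d_t = d H(ω₁) + ω₂ H(d)` with bounded coefficients, and `H` does not
increase the `L²` norm; hence `‖d‖²` obeys Gronwall's inequality. The equation is integrated in time
at each fixed `x` and only then in `x`, so no derivative is taken under an integral. -/
theorem IsCLMSolution.unique {f : ℝ → ℝ} {T : ℝ} {ω₁ ω₂ : ℝ → ℝ → ℝ} (h₁ : IsCLMSolution f T ω₁)
    (h₂ : IsCLMSolution f T ω₂) : ∀ t ∈ Ico 0 T, ω₁ t = ω₂ t := by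
  intro t₁ ht₁
  have hsub : Icc 0 t₁ ⊆ Ico 0 T := fun t ht => ⟨ht.1, ht.2.trans_lt ht₁.2⟩
  obtain ⟨K₁, hK₁, hb₁⟩ := h₁.regular.exists_abs_le ht₁.2
  obtain ⟨K₂, hK₂, hb₂⟩ := h₂.regular.exists_abs_le ht₁.2
  set K := max K₁ K₂
  have hK : 0 ≤ K := hK₁.trans (le_max_left _ _)
  set d : ℝ → ℝ → ℝ := fun t => ω₁ t - ω₂ t
  have hd : ∀ t ∈ Ico 0 T, MemH1 (d t) := fun t ht =>
    (h₁.regular.memH1 t ht).sub (h₂.regular.memH1 t ht)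
  have hHd : ∀ t ∈ Ico 0 T, ∀ x, hilbert (d t) x = hilbert (ω₁ t) x - hilbert (ω₂ t) x :=
    fun t ht x => congrFun (hilbert_sub (h₁.regular.memH1 t ht) (h₂.regular.memH1 t ht)) x
  set a : ℝ → ℝ → ℝ := fun t x => ω₁ t x * hilbert (ω₁ t) x - ω₂ t x * hilbert (ω₂ t) x
  set y : ℝ → ENNReal := fun t => ∫⁻ x, ENNReal.ofReal (d t x ^ 2)
  have cω₁ := h₁.regular.continuousOn_uncurry
  have cω₂ := h₂.regular.continuousOn_uncurry
  have cH₁ := h₁.regular.continuousOn_hilbert_uncurry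
  have cH₂ := h₂.regular.continuousOn_hilbert_uncurry
  have ca : ∀ x, ContinuousOn (fun s => a s x) (Ico 0 T) := fun x =>
    ((cω₁.slice x).mul (ContinuousOn.slice (g := fun t => hilbert (ω₁ t)) cH₁ x)).sub
      ((cω₂.slice x).mul (ContinuousOn.slice (g := fun t => hilbert (ω₂ t)) cH₂ x))
  have cd : ∀ x, ContinuousOn (fun s => d s x) (Ico 0 T) := fun x =>
    (cω₁.slice x).sub (cω₂.slice x)
  have cHd : ContinuousOn (fun p : ℝ × ℝ => hilbert (d p.1) p.2) (Ico 0 T ×ˢ univ) :=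
    (cH₁.sub cH₂).congr fun p hp => hHd p.1 hp.1 p.2
  have hder : ∀ x, ∀ t ∈ Ico 0 T, HasDerivWithinAt (fun s => d s x) (a t x) (Ico 0 T) t :=
    fun x t ht => (h₁.equation t ht x).sub (h₂.equation t ht x)
  have hsq : ∀ x, ∀ t ∈ Icc 0 t₁, d t x ^ 2 = ∫ s in (0 : ℝ)..t, 2 * d s x * a s x := by
    intro x t ht
    have hI : Icc 0 t ⊆ Ico 0 T := (Icc_subset_Icc_right ht.2).trans hsub
    have hc : ContinuousOn (fun s => 2 * d s x * a s x) (Icc 0 t) :=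
      ((continuousOn_const.mul (cd x)).mul (ca x)).mono hI
    rw [intervalIntegral.integral_eq_sub_of_hasDerivAt_of_le ht.1 (f := fun s => d s x ^ 2)
      (((cd x).pow 2).mono hI)]
    · simp [d, h₁.initial, h₂.initial]
    · intro s hs
      have hn : Ico 0 T ∈ 𝓝 s := Ico_mem_nhds hs.1 (hs.2.trans_le (ht.2.trans ht₁.2.le))
      have := ((hder x s (mem_of_mem_nhds hn)).hasDerivAt hn).fun_pow 2
      simpa using this
    · exact (hc.mono (by rw [uIcc_of_le ht.1])).intervalIntegrable
  -- The term with `H(ω₁)` costs `2 K d²`; the cross term `2 ω₂ d H(d)` costs `K (d² + H(d)²)`.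
  have hpt : ∀ t ∈ Icc 0 t₁, ∀ x, 2 * d t x * a t x ≤ 3 * K * d t x ^ 2 + K * hilbert (d t) x ^ 2 := by
    intro t ht x
    have e : a t x = d t x * hilbert (ω₁ t) x + ω₂ t x * hilbert (d t) x := by
      rw [hHd t (hsub ht)]
      simp only [a, d, Pi.sub_apply]; ring
    have b1 : |hilbert (ω₁ t) x| ≤ K := (((hb₁ t ht).2 x).2).trans (le_max_left _ _)
    have b2 : |ω₂ t x| ≤ K := (((hb₂ t ht).2 x).1).trans (le_max_right _ _)
    rw [abs_le] at b1 b2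
    rw [e]
    nlinarith [mul_nonneg (sub_nonneg.2 b1.2) (sq_nonneg (d t x)),
      mul_nonneg (sub_nonneg.2 b2.2) (sq_nonneg (d t x + hilbert (d t) x)),
      mul_nonneg (show 0 ≤ K + ω₂ t x by linarith) (sq_nonneg (d t x - hilbert (d t) x))]
  have hy : ∀ t ∈ Icc 0 t₁, ∫⁻ x, ENNReal.ofReal (3 * K * d t x ^ 2 + K * hilbert (d t) x ^ 2)
      ≤ ENNReal.ofReal (4 * K) * y t := by
    intro t ht
    have hm := hd t (hsub ht)
    have e : ∀ x, ENNReal.ofReal (3 * K * d t x ^ 2 + K * hilbert (d t) x ^ 2)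
        = ENNReal.ofReal (3 * K) * ENNReal.ofReal (d t x ^ 2)
          + ENNReal.ofReal K * ENNReal.ofReal (hilbert (d t) x ^ 2) := fun x => by
      rw [ENNReal.ofReal_add (by positivity) (by positivity), ENNReal.ofReal_mul (by positivity),
        ENNReal.ofReal_mul hK]
    simp_rw [e]
    have m1 : Measurable fun x => ENNReal.ofReal (d t x ^ 2) := by
      have := hm.continuous.measurable; fun_prop
    have m2 : Measurable fun x => ENNReal.ofReal (hilbert (d t) x ^ 2) := by
      have := hm.hilbert.continuous.measurable; fun_prop
    rw [lintegral_add_left (m1.const_mul _), lintegral_const_mul _ m1, lintegral_const_mul _ m2]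
    have h3 : ∫⁻ x, ENNReal.ofReal (hilbert (d t) x ^ 2) ≤ y t := by
      simp only [y]
      rw [lintegral_ofReal_sq, lintegral_ofReal_sq]
      exact pow_le_pow_left' hm.eLpNorm_hilbert_le 2
    calc _ ≤ ENNReal.ofReal (3 * K) * y t + ENNReal.ofReal K * y t := by gcongr
      _ = _ := by
        rw [← add_mul, ← ENNReal.ofReal_add (by positivity) hK]
        congr 2; ring
  have hyb : ∀ t ∈ Icc 0 t₁, y t ≤ ENNReal.ofReal ((K₁ + K₂) ^ 2) := by
    intro t ht
    simp only [y]
    rw [lintegral_ofReal_sq, ENNReal.ofReal_pow (by positivity)]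
    refine pow_le_pow_left' ?_ 2
    rw [ENNReal.ofReal_add hK₁ hK₂]
    exact (eLpNorm_sub_le (h₁.regular.memH1 t (hsub ht)).memLp.1
      (h₂.regular.memH1 t (hsub ht)).memLp.1 (by norm_num)).trans
      (add_le_add (hb₁ t ht).1 (hb₂ t ht).1)
  have hint : ∀ t ∈ Icc 0 t₁, y t ≤ ∫⁻ s in Ioc 0 t, ENNReal.ofReal (4 * K) * y s := by
    intro t ht
    have hI : Ioc 0 t ⊆ Icc 0 t₁ := fun s hs => ⟨hs.1.le, hs.2.trans ht.2⟩
    have step1 : y t ≤ ∫⁻ x, ∫⁻ s in Ioc 0 t,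
        ENNReal.ofReal (3 * K * d s x ^ 2 + K * hilbert (d s) x ^ 2) := by
      refine lintegral_mono fun x => ?_
      rw [hsq x t ht, intervalIntegral.integral_of_le ht.1]
      have hI' : Icc 0 t ⊆ Ico 0 T := (Icc_subset_Icc_right ht.2).trans hsub
      have c1 : IntegrableOn (fun s => 2 * d s x * a s x) (Ioc 0 t) :=
        (((continuousOn_const.mul (cd x)).mul (ca x)).mono hI').integrableOn_Icc.mono_set
          Ioc_subset_Icc_self
      have c2 : IntegrableOn (fun s => 3 * K * d s x ^ 2 + K * hilbert (d s) x ^ 2) (Ioc 0 t) :=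
        (((continuousOn_const.mul ((cd x).pow 2)).add
          (continuousOn_const.mul ((ContinuousOn.slice (g := fun t => hilbert (d t)) cHd x).pow 2))).mono hI').integrableOn_Icc.mono_set
          Ioc_subset_Icc_self
      rw [← ofReal_integral_eq_lintegral_ofReal c2 (ae_of_all _ fun s => by positivity)]
      exact ENNReal.ofReal_le_ofReal
        (setIntegral_mono_on c1 c2 measurableSet_Ioc fun s hs => hpt s (hI hs) x)
    refine step1.trans ?_
    rw [lintegral_lintegral_swap]
    · refine setLIntegral_mono' measurableSet_Ioc fun s hs => hy s (hI hs)
    · rw [← Measure.restrict_univ (μ := (volume : Measure ℝ)), Measure.restrict_restrict_of_subset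
        (subset_univ _), Measure.prod_restrict]
      refine ContinuousOn.aemeasurable ?_ (MeasurableSet.univ.prod measurableSet_Ioc)
      have hmaps : MapsTo Prod.swap ((univ : Set ℝ) ×ˢ Ioc 0 t) (Ico 0 T ×ˢ (univ : Set ℝ)) :=
        fun p hp => ⟨hsub (hI hp.2), mem_univ _⟩
      have k1 := (cω₁.sub cω₂).comp continuous_swap.continuousOn hmaps
      have k2 := cHd.comp continuous_swap.continuousOn hmaps
      exact ENNReal.continuous_ofReal.comp_continuousOn
        ((continuousOn_const.mul (k1.pow 2)).add (continuousOn_const.mul (k2.pow 2)))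
  have hzero := gronwall_lintegral (by positivity) (by positivity) hyb hint t₁ ⟨ht₁.1, le_rfl⟩
  have hm := hd t₁ ht₁
  have m1 : Measurable fun x => ENNReal.ofReal (d t₁ x ^ 2) := by
    have := hm.continuous.measurable; fun_prop
  have hae := (lintegral_eq_zero_iff m1).1 hzero
  have hae2 : d t₁ =ᵐ[volume] fun _ => 0 := by
    filter_upwards [hae] with x hx
    have h3 : d t₁ x ^ 2 ≤ 0 := ENNReal.ofReal_eq_zero.1 hx
    exact pow_eq_zero_iff (two_ne_zero) |>.1 (le_antisymm h3 (sq_nonneg _))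
  have h4 := (Continuous.ae_eq_iff_eq volume hm.continuous continuous_const).1 hae2
  funext x
  exact sub_eq_zero.1 (congrFun h4 x)

/-! ### Smoothness and signs of the Hilbert transform at the origin. -/

theorem HasSpectrum.ae_eq_of_deriv {f : ℝ → ℝ} {q p : ℝ → ℂ} (hq : HasSpectrum f q)
    (hp : HasSpectrum (deriv f) p) :
    p =ᵐ[volume] fun ξ : ℝ => -(2 * Real.pi * Complex.I * ξ) * q ξ := by
  have h1 := fourier_toLp_ae_eq hp.integrable hp.memLp
  have h2 := hq.locAC_and_deriv.2
  have h3 : (𝓕 (hp.memLp.toLp p) : Lp ℂ 2 (volume : Measure ℝ))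
      = 𝓕 (hq.memLp_deriv.toLp _) := by
    refine Lp.ext (h1.trans ?_)
    rw [← hp.ofReal_eq]
    exact h2
  have h4 : hp.memLp.toLp p = hq.memLp_deriv.toLp _ := by
    have := congrArg (fun u : Lp ℂ 2 (volume : Measure ℝ) => 𝓕⁻ u) h3
    simpa only [FourierTransform.fourierInv_fourier_eq] using this
  exact (MemLp.toLp_eq_toLp_iff _ _).1 h4

/-- Both operations are multipliers and commute. That `deriv f` is in `H¹` makes `ξ q` integrable,
which permits differentiation of the Fourier integral. -/
theorem MemH1.hasDerivAt_hilbert {f : ℝ → ℝ} (hf : MemH1 f) (hf' : MemH1 (deriv f)) (x : ℝ) :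
    HasDerivAt (_root_.hilbert f) (_root_.hilbert (deriv f) x) x := by
  obtain ⟨q, hq⟩ := hf.exists_hasSpectrum
  obtain ⟨p, hp⟩ := hf'.exists_hasSpectrum
  have hpq := hq.ae_eq_of_deriv hp
  have hint : Integrable (fun ξ : ℝ => ξ • (hilbertMul ξ * q ξ)) := by
    have h1 : Integrable (fun ξ : ℝ => -(2 * Real.pi * Complex.I * ξ) * q ξ) :=
      (integrable_congr hpq).1 hp.integrable
    have h2 := (integrable_hilbertMul h1).const_mul (-(2 * Real.pi * Complex.I))⁻¹
    refine (integrable_congr (.of_forall fun ξ => ?_)).1 h2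
    have : (Real.pi : ℂ) ≠ 0 := by exact_mod_cast Real.pi_ne_zero
    simp only [Complex.real_smul]
    field_simp
  have h := Real.hasDerivAt_fourier hq.hilbert.integrable hint x
  have e1 : 𝓕 (fun ξ : ℝ => (-2 * Real.pi * Complex.I * ξ) • (hilbertMul ξ * q ξ)) x
      = (_root_.hilbert (deriv f) x : ℂ) := by
    rw [hp.hilbert.eq, Real.fourier_eq, Real.fourier_eq]
    refine integral_congr_ae ?_
    filter_upwards [hpq] with ξ hξ
    rw [hξ, smul_eq_mul]
    congr 1
    ring
  rw [e1] at h
  have h2 := Complex.reCLM.hasFDerivAt.comp_hasDerivAt x h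
  have e2 : (Complex.reCLM ∘ 𝓕 fun ξ => hilbertMul ξ * q ξ) = _root_.hilbert f := funext fun y => by
    rw [Function.comp_apply, ← hq.hilbert.eq]; simp
  rw [e2] at h2
  simpa using h2

theorem ContDiff.memH1 {f : ℝ → ℝ} (hf : ContDiff ℝ 1 f) (hc : HasCompactSupport f) : MemH1 f :=
  memH1_iff.2 ⟨fun _ _ => hf.contDiffOn.absolutelyContinuousOnInterval,
    hf.continuous.memLp_of_hasCompactSupport hc,
    (hf.continuous_deriv le_rfl).memLp_of_hasCompactSupport hc.deriv⟩

theorem contDiff_hilbert (n : ℕ) : ∀ {f : ℝ → ℝ}, ContDiff ℝ (n + 1) f → HasCompactSupport f →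
    ContDiff ℝ n (hilbert f) := by
  induction n with
  | zero =>
    intro f hf hc
    have : MemH1 f := ContDiff.memH1 (by simpa using hf) hc
    exact contDiff_zero.2 this.hilbert.continuous
  | succ n ih =>
    intro f hf hc
    have hf1 : MemH1 f := ContDiff.memH1 (hf.of_le (by norm_cast; simp)) hc
    have hd : ContDiff ℝ (n + 1) (deriv f) := by
      have := (contDiff_succ_iff_deriv (n := n + 1)).1 (by exact_mod_cast hf)
      exact this.2.2
    have hf2 : MemH1 (deriv f) := ContDiff.memH1 (hd.of_le (by norm_cast; simp)) hc.deriv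
    have hder := hf1.hasDerivAt_hilbert hf2
    push_cast
    refine contDiff_succ_iff_deriv.2 ⟨fun x => (hder x).differentiableAt, by simp, ?_⟩
    rw [show deriv (hilbert f) = hilbert (deriv f) from funext fun x => (hder x).deriv]
    exact ih hd hc.deriv

theorem iteratedDeriv_two_hilbert {f : ℝ → ℝ} (hf : ContDiff ℝ 3 f) (hc : HasCompactSupport f) :
    iteratedDeriv 2 (hilbert f) = hilbert (iteratedDeriv 2 f) := by
  have h0 : MemH1 f := ContDiff.memH1 (hf.of_le (by norm_num)) hc
  have c1 : ContDiff ℝ 2 (deriv f) :=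
    ((contDiff_succ_iff_deriv (n := 2)).1 (hf.of_le (by norm_num))).2.2
  have c2 : ContDiff ℝ 1 (deriv (deriv f)) :=
    ((contDiff_succ_iff_deriv (n := 1)).1 (c1.of_le (by norm_num))).2.2
  have h1 : MemH1 (deriv f) := ContDiff.memH1 (c1.of_le (by norm_num)) hc.deriv
  have h2 : MemH1 (deriv (deriv f)) := ContDiff.memH1 c2 hc.deriv.deriv
  have e1 : deriv (hilbert f) = hilbert (deriv f) := funext fun x => (h0.hasDerivAt_hilbert h1 x).deriv
  have e2 : deriv (hilbert (deriv f)) = hilbert (deriv (deriv f)) :=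
    funext fun x => (h1.hasDerivAt_hilbert h2 x).deriv
  simp only [iteratedDeriv_succ, iteratedDeriv_zero, e1, e2]

/-- A one-sided expansion suffices, because the blow-up is observed at points near `r (T - t)^{1/2}
> 0`. -/
theorem ContDiffAt.exists_taylor_bound {f : ℝ → ℝ} (n : ℕ) (hf : ContDiffAt ℝ (n + 1) f 0) :
    ∃ C b : ℝ, 0 < b ∧ ∀ x ∈ Icc 0 b,
      |f x - ∑ k ∈ Finset.range (n + 1), (k.factorial : ℝ)⁻¹ * x ^ k * iteratedDeriv k f 0|
        ≤ C * x ^ (n + 1) := by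
  obtain ⟨u, hu, hfu⟩ := hf.contDiffOn (m := n + 1) le_rfl (by norm_cast; simp)
  obtain ⟨ε, hε, hb⟩ := Metric.mem_nhds_iff.1
    (show u ∈ 𝓝 (0 : ℝ) by simpa using hu)
  rw [Real.ball_eq_Ioo] at hb
  have hsub : Icc 0 (ε / 2) ⊆ u := fun x hx => hb ⟨by linarith [hx.1], by linarith [hx.2]⟩
  obtain ⟨C, hC⟩ := exists_taylor_mean_remainder_bound (f := f) (a := 0) (b := ε / 2) (n := n)
    (by positivity) (hfu.mono hsub)
  refine ⟨C, ε / 2, by positivity, fun x hx => ?_⟩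
  have h := hC x hx
  rw [taylor_within_apply, sub_zero, Real.norm_eq_abs] at h
  convert h using 4 with k hk
  rw [smul_eq_mul, iteratedDerivWithin_eq_iteratedDeriv (uniqueDiffOn_Icc (by positivity))
    (hf.of_le (by exact_mod_cast (Finset.mem_range.1 hk).le)) ⟨le_rfl, by positivity⟩]

section odd

variable {f : ℝ → ℝ}

theorem iteratedDeriv_zero_of_odd (hodd : ∀ x, f (-x) = -f x) {k : ℕ} (hk : Even k) :
    iteratedDeriv k f 0 = 0 := by
  have h1 := iteratedDeriv_comp_neg k f 0
  rw [funext hodd, hk.neg_one_pow, one_smul, neg_zero,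
    show (fun x => -f x) = -f from rfl, iteratedDeriv_neg] at h1
  linarith

theorem iteratedDeriv_zero_of_even (heven : ∀ x, f (-x) = f x) {k : ℕ} (hk : Odd k) :
    iteratedDeriv k f 0 = 0 := by
  have h1 := iteratedDeriv_comp_neg k f 0
  rw [funext heven, hk.neg_one_pow, neg_zero, neg_one_smul] at h1
  change iteratedDeriv k f 0 = _ at h1
  linarith

theorem integrableOn_Ioi_div (hf : MemLp f 2) {ε : ℝ} (hε : 0 < ε) :
    IntegrableOn (fun y => -(f y / y)) (Ioi ε) := by
  refine ((integrableOn_truncHilbert hf 0 hε).mono_set fun y hy => ?_).congr_fun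
    (fun y _ => ?_) measurableSet_Ioi
  · rw [mem_ofPred_eq, zero_sub, abs_neg]
    exact lt_of_lt_of_le hy (le_abs_self y)
  · simp only [zero_sub, div_neg]

theorem truncHilbert_zero_of_odd (hf : MemLp f 2) (hodd : ∀ x, f (-x) = -f x) {ε : ℝ}
    (hε : 0 < ε) : truncHilbert f 0 ε = Real.pi⁻¹ * (2 * ∫ y in Ioi ε, -(f y / y)) := by
  have hset : {y : ℝ | ε < |0 - y|} = Iio (-ε) ∪ Ioi ε := by
    ext y
    rw [mem_ofPred_eq, zero_sub, abs_neg, lt_abs, mem_union, mem_Iio, mem_Ioi]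
    constructor
    · rintro (h | h)
      · exact Or.inr h
      · exact Or.inl (by linarith)
    · rintro (h | h)
      · exact Or.inr (by linarith)
      · exact Or.inl h
  have hint := integrableOn_truncHilbert hf 0 hε
  rw [truncHilbert]
  rw [hset] at hint ⊢
  rw [setIntegral_union (by
    rw [Set.disjoint_left]; intro y h1 h2; simp only [mem_Iio, mem_Ioi] at h1 h2; linarith)
    measurableSet_Ioi (hint.mono_set subset_union_left) (hint.mono_set subset_union_right),
    ← integral_Iic_eq_integral_Iio, ← integral_comp_neg_Ioi, two_mul]
  congr 2
  · refine setIntegral_congr_fun measurableSet_Ioi fun y _ => ?_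
    simp only [hodd, zero_sub, neg_neg, neg_div]
  · refine setIntegral_congr_fun measurableSet_Ioi fun y _ => ?_
    simp only [zero_sub, div_neg]

theorem setIntegral_Ioi_pos {g : ℝ → ℝ} {a ρ : ℝ} (ha : a < ρ) (hg : IntegrableOn g (Ioi a))
    (h0 : ∀ y ∈ Ioi a, 0 ≤ g y) (h1 : ∀ y ∈ Ioo a ρ, 0 < g y) : 0 < ∫ y in Ioi a, g y := by
  rw [setIntegral_pos_iff_support_of_nonneg_ae
    ((ae_restrict_iff' measurableSet_Ioi).2 (.of_forall h0)) hg]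
  have hsub : Ioo a ρ ⊆ Function.support g ∩ Ioi a := fun y hy => ⟨(h1 y hy).ne', hy.1⟩
  refine lt_of_lt_of_le ?_ (measure_mono hsub)
  rw [Real.volume_Ioo]
  exact ENNReal.ofReal_pos.2 (by linarith)

/-- By oddness the truncated integral is `(2 / π) ∫_ε^∞ -f(y) / y dy`. For `ε < 1` it is at least
the integral over `(1, ∞)`, a positive number independent of `ε`. -/
theorem MemH1.hilbert_zero_pos (hf : MemH1 f) (hodd : ∀ x, f (-x) = -f x)
    (hneg : ∀ y, 0 < y → f y < 0) : 0 < _root_.hilbert f 0 := by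
  have hg : ∀ y, 0 < y → 0 < -(f y / y) := fun y hy =>
    neg_pos.2 (div_neg_of_neg_of_pos (hneg y hy) hy)
  have hκ : 0 < ∫ y in Ioi (1 : ℝ), -(f y / y) :=
    setIntegral_Ioi_pos one_lt_two (integrableOn_Ioi_div hf.memLp one_pos)
      (fun y hy => (hg y (one_pos.trans hy)).le) fun y hy => hg y (one_pos.trans hy.1)
  refine lt_of_lt_of_le (show 0 < Real.pi⁻¹ * (2 * ∫ y in Ioi (1 : ℝ), -(f y / y)) by
    have := Real.pi_pos; positivity) ?_
  refine ge_of_tendsto (hf.hasHilbertAt 0) ?_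
  filter_upwards [Ioo_mem_nhdsGT (one_pos (α := ℝ))] with ε hε
  rw [truncHilbert_zero_of_odd hf.memLp hodd hε.1]
  have := Real.pi_pos
  refine mul_le_mul_of_nonneg_left (mul_le_mul_of_nonneg_left ?_ two_pos.le) (by positivity)
  refine setIntegral_mono_set (integrableOn_Ioi_div hf.memLp hε.1) ?_
    (LE.le.eventuallyLE (Ioi_subset_Ioi hε.2.le))
  exact (ae_restrict_iff' measurableSet_Ioi).2 (.of_forall fun y hy => (hg y (hε.1.trans hy)).le)

/-- Two integrations by parts, packed in the single primitive `F`, turn `-∫ f'' / y` over `(ε, ∞)`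
into `F ε - 2 ∫ f / y³`. As `f = O(y³)` at the origin, `F ε → 0`, and the remaining integral has a
sign. -/
theorem hilbert_iteratedDeriv_two_pos (hf : ContDiff ℝ 4 f) (hc : HasCompactSupport f)
    (hodd : ∀ x, f (-x) = -f x) (hd : deriv f 0 = 0) (h0 : ∀ y, 0 < y → f y ≤ 0) {ρ : ℝ}
    (hρ : 0 < ρ) (hneg : ∀ y ∈ Ioo 0 ρ, f y < 0) : 0 < hilbert (iteratedDeriv 2 f) 0 := by
  have c1 : ContDiff ℝ 3 (deriv f) :=
    ((contDiff_succ_iff_deriv (n := 3)).1 (hf.of_le (by norm_num))).2.2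
  have c2 : ContDiff ℝ 2 (deriv (deriv f)) :=
    ((contDiff_succ_iff_deriv (n := 2)).1 (c1.of_le (by norm_num))).2.2
  have e2 : iteratedDeriv 2 f = deriv (deriv f) := by
    simp only [iteratedDeriv_succ, iteratedDeriv_zero]
  have hm : MemH1 (deriv (deriv f)) := ContDiff.memH1 (c2.of_le (by norm_num)) hc.deriv.deriv
  have hodd2 : ∀ x, deriv (deriv f) (-x) = -deriv (deriv f) x := by
    intro x
    have h1 := iteratedDeriv_comp_neg 2 f x
    rw [funext hodd, e2, show (fun x => -f x) = -f from rfl, iteratedDeriv_neg, e2] at h1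
    simp at h1
    exact h1.symm
  have z0 : f 0 = 0 := by simpa using iteratedDeriv_zero_of_odd hodd (k := 0) (by simp)
  have z2 : deriv (deriv f) 0 = 0 := by
    rw [← e2]; exact iteratedDeriv_zero_of_odd hodd (by norm_num)
  set F : ℝ → ℝ := fun y => deriv f y / y + f y / y ^ 2
  have hF : ∀ y ≠ 0, HasDerivAt F (deriv (deriv f) y / y - 2 * (f y / y ^ 3)) y := by
    intro y hy
    have d0 : HasDerivAt f (deriv f y) y := (hf.differentiable (by norm_num) y).hasDerivAt
    have d1 : HasDerivAt (deriv f) (deriv (deriv f) y) y :=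
      (c1.differentiable (by norm_num) y).hasDerivAt
    have := (d1.div (hasDerivAt_id y) hy).add (d0.div (hasDerivAt_pow 2 y) (pow_ne_zero 2 hy))
    refine this.congr_deriv ?_
    simp only [id]
    field_simp
    ring
  have i3 : ∀ ε : ℝ, 0 < ε → IntegrableOn (fun y => f y / y ^ 3) (Ioi ε) := by
    intro ε hε
    have hfi : Integrable f := hf.continuous.integrable_of_hasCompactSupport hc
    refine Integrable.mono' (hfi.norm.const_mul (ε ^ 3)⁻¹).integrableOn
      ((hf.continuous.measurable.div (by fun_prop)).aestronglyMeasurable) ?_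
    refine (ae_restrict_iff' measurableSet_Ioi).2 (.of_forall fun y hy => ?_)
    have hy' : ε < y := hy
    have : 0 < y := hε.trans hy'
    rw [norm_div, Real.norm_of_nonneg (show 0 ≤ y ^ 3 by positivity), div_eq_inv_mul]
    gcongr
  have i2 : ∀ ε : ℝ, 0 < ε → IntegrableOn (fun y => deriv (deriv f) y / y) (Ioi ε) := fun ε hε => by
    simpa using (integrableOn_Ioi_div hm.memLp hε).neg
  have hFtop : Tendsto F atTop (𝓝 0) := by
    refine tendsto_const_nhds.congr' ?_
    obtain ⟨R, hR⟩ := hc.isCompact.isBounded.subset_ball 0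
    filter_upwards [eventually_ge_atTop R] with y hy
    have hn : y ∉ tsupport f := fun h => by
      have := hR h
      rw [mem_ball_zero_iff, Real.norm_eq_abs] at this
      linarith [le_abs_self y]
    have a1 : f y = 0 := image_eq_zero_of_notMem_tsupport hn
    have a2 : deriv f y = 0 := image_eq_zero_of_notMem_tsupport fun h =>
      hn (tsupport_deriv_subset h)
    simp [F, a1, a2]
  have key : ∀ ε : ℝ, 0 < ε → truncHilbert (deriv (deriv f)) 0 ε
      = Real.pi⁻¹ * (2 * (F ε + 2 * ∫ y in Ioi ε, -(f y / y ^ 3))) := by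
    intro ε hε
    have h1 := integral_Ioi_of_hasDerivAt_of_tendsto' (a := ε) (f := F)
      (fun y hy => hF y (hε.trans_le hy).ne') ((i2 ε hε).sub ((i3 ε hε).const_mul 2)) hFtop
    rw [integral_sub (i2 ε hε) ((i3 ε hε).const_mul 2), integral_const_mul] at h1
    rw [truncHilbert_zero_of_odd hm.memLp hodd2 hε, integral_neg, integral_neg]
    congr 2
    linarith
  have hFzero : Tendsto F (𝓝[>] 0) (𝓝 0) := by
    obtain ⟨C, b, hb, hC⟩ := ContDiffAt.exists_taylor_bound (f := f) 2
      ((hf.of_le (by norm_num)).contDiffAt)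
    obtain ⟨C', b', hb', hC'⟩ := ContDiffAt.exists_taylor_bound (f := deriv f) 1
      ((c1.of_le (by norm_num)).contDiffAt)
    simp only [Finset.sum_range_succ, Finset.sum_range_zero, iteratedDeriv_succ, iteratedDeriv_zero,
      z0, hd, z2] at hC hC'
    have hlim : Tendsto (fun y : ℝ => (C' + C) * y) (𝓝[>] 0) (𝓝 0) := by
      have : Tendsto (fun y : ℝ => (C' + C) * y) (𝓝 0) (𝓝 ((C' + C) * 0)) :=
        (continuous_const.mul continuous_id).tendsto 0
      rw [mul_zero] at this
      exact this.mono_left nhdsWithin_le_nhds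
    refine squeeze_zero_norm' ?_ hlim
    filter_upwards [Ioo_mem_nhdsGT (lt_min hb hb')] with y hy
    have hy0 := hy.1
    have b1 := hC y ⟨hy.1.le, hy.2.le.trans (min_le_left _ _)⟩
    have b2 := hC' y ⟨hy.1.le, hy.2.le.trans (min_le_right _ _)⟩
    simp only [mul_zero, add_zero, sub_zero] at b1 b2
    rw [Real.norm_eq_abs]
    calc |F y| ≤ |deriv f y / y| + |f y / y ^ 2| := abs_add_le _ _
      _ ≤ C' * y + C * y := by
        rw [abs_div, abs_div, abs_of_pos hy0, abs_of_pos (pow_pos hy0 2)]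
        refine add_le_add ?_ ?_
        · rw [div_le_iff₀ hy0]; exact b2.trans_eq (by ring)
        · rw [div_le_iff₀ (pow_pos hy0 2)]; exact b1.trans_eq (by ring)
      _ = _ := by ring
  have hg : ∀ y, 0 < y → 0 ≤ -(f y / y ^ 3) := fun y hy => neg_nonneg.2
    (div_nonpos_of_nonpos_of_nonneg (h0 y hy) (by positivity))
  have hκ : 0 < ∫ y in Ioi (ρ / 2), -(f y / y ^ 3) := by
    refine setIntegral_Ioi_pos (half_lt_self hρ) (i3 _ (by positivity)).neg
      (fun y hy => hg y ((half_pos hρ).trans hy)) fun y hy => neg_pos.2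
      (div_neg_of_neg_of_pos (hneg y ⟨(half_pos hρ).trans hy.1, hy.2⟩) ?_)
    have := (half_pos hρ).trans hy.1
    positivity
  rw [e2]
  set κ := ∫ y in Ioi (ρ / 2), -(f y / y ^ 3)
  have hlim : Tendsto (fun ε => Real.pi⁻¹ * (2 * (F ε + 2 * κ))) (𝓝[>] 0)
      (𝓝 (Real.pi⁻¹ * (2 * (0 + 2 * κ)))) := ((hFzero.add_const _).const_mul _).const_mul _
  refine lt_of_lt_of_le (show 0 < Real.pi⁻¹ * (2 * (0 + 2 * κ)) by
    have := Real.pi_pos; positivity) (le_of_tendsto_of_tendsto hlim (hm.hasHilbertAt 0) ?_)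
  filter_upwards [Ioo_mem_nhdsGT (half_pos hρ)] with ε hε
  rw [key ε hε.1]
  have := Real.pi_pos
  refine mul_le_mul_of_nonneg_left (mul_le_mul_of_nonneg_left (add_le_add_right
    (mul_le_mul_of_nonneg_left ?_ two_pos.le) _) two_pos.le) (by positivity)
  refine setIntegral_mono_set (i3 ε hε.1).neg ?_
    (LE.le.eventuallyLE (Ioi_subset_Ioi hε.2.le))
  exact (ae_restrict_iff' measurableSet_Ioi).2 (.of_forall fun y hy => hg y (hε.1.trans hy))

end odd

theorem hilbert_even_of_odd {f : ℝ → ℝ} (hodd : ∀ x, f (-x) = -f x) (x : ℝ) :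
    hilbert f (-x) = hilbert f x := by
  have hs : ∀ x ε : ℝ, MeasurableSet {y : ℝ | ε < |x - y|} := fun x ε =>
    measurableSet_lt measurable_const (by fun_prop)
  have : truncHilbert f (-x) = truncHilbert f x := by
    funext ε
    rw [truncHilbert, truncHilbert, ← integral_indicator (hs _ _), ← integral_indicator (hs _ _),
      ← integral_neg_eq_self]
    congr 2 with y
    have e : |-x - -y| = |x - y| := by rw [← abs_neg]; ring_nf
    by_cases hy : ε < |x - y|
    · rw [indicator_of_mem (show -y ∈ {y : ℝ | ε < |-x - y|} by rwa [mem_ofPred_eq, e]),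
        indicator_of_mem (show y ∈ {y : ℝ | ε < |x - y|} from hy), hodd,
        show -x - -y = -(x - y) by ring, neg_div_neg_eq]
    · rw [indicator_of_notMem (show -y ∉ {y : ℝ | ε < |-x - y|} by rwa [mem_ofPred_eq, e]),
        indicator_of_notMem (show y ∉ {y : ℝ | ε < |x - y|} from hy)]
  rw [hilbert, hilbert, this]

/-! ### The contribution of the part of `ω₀` away from the origin. -/

section far

variable {v : ℝ → ℝ} {ρ : ℝ}

/-- The Cauchy type integrals whose derivatives are computed away from the support of `v`. -/
noncomputable def cauchyPow (v : ℝ → ℝ) (n : ℕ) (x : ℝ) : ℝ := ∫ y, v y / (x - y) ^ (n + 1)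

theorem norm_div_pow_le (hρ : 0 < ρ) (hz : ∀ y, |y| < ρ → v y = 0) (n : ℕ) {x : ℝ}
    (hx : x ∈ Ioo (-(ρ / 2)) (ρ / 2)) (y : ℝ) :
    ‖v y / (x - y) ^ (n + 1)‖ ≤ ((ρ / (2 * (1 + ρ))) ^ (n + 1))⁻¹ * ‖v y * (1 + |y|)⁻¹‖ := by
  rcases lt_or_ge |y| ρ with hy | hy
  · simp [hz y hy]
  -- Chosen so that `κ (1 + |y|) ≤ |y| / 2` is equivalent to `|y| ≥ ρ`; and `|y| / 2 ≤ |x - y|`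
  -- because `|x| < ρ / 2`.
  · set κ := ρ / (2 * (1 + ρ))
    have hκ : 0 < κ := by positivity
    have h1 : κ * (1 + |y|) ≤ |x - y| := by
      have h2 : |y| - |x| ≤ |x - y| := by
        rw [abs_sub_comm]; exact abs_sub_abs_le_abs_sub y x
      have h3 : |x| < ρ / 2 := abs_lt.2 hx
      have h4 : κ * (1 + |y|) ≤ |y| / 2 := by
        rw [div_mul_eq_mul_div, div_le_div_iff₀ (by positivity) (by positivity)]
        nlinarith
      linarith
    have h5 : κ ^ (n + 1) * (1 + |y|) ≤ |x - y| ^ (n + 1) := by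
      calc κ ^ (n + 1) * (1 + |y|) ≤ κ ^ (n + 1) * (1 + |y|) ^ (n + 1) := by
            gcongr
            exact le_self_pow₀ (by linarith [abs_nonneg y]) (by simp)
        _ = (κ * (1 + |y|)) ^ (n + 1) := (mul_pow _ _ _).symm
        _ ≤ _ := by gcongr
    rw [norm_div, norm_mul, norm_pow, Real.norm_eq_abs (x - y), norm_inv,
      Real.norm_of_nonneg (show 0 ≤ 1 + |y| by positivity), div_eq_mul_inv]
    calc ‖v y‖ * (|x - y| ^ (n + 1))⁻¹ ≤ ‖v y‖ * (κ ^ (n + 1) * (1 + |y|))⁻¹ := by gcongr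
      _ = _ := by rw [mul_inv]; ring

theorem hasDerivAt_cauchyPow (hv : MemLp v 2) (hρ : 0 < ρ) (hz : ∀ y, |y| < ρ → v y = 0) (n : ℕ)
    {x : ℝ} (hx : x ∈ Ioo (-(ρ / 2)) (ρ / 2)) :
    HasDerivAt (cauchyPow v n) (-(n + 1) * cauchyPow v (n + 1) x) x := by
  have hw : Integrable (fun y : ℝ => v y * (1 + |y|)⁻¹) := hv.integrable_mul memLp_weight
  have hmeas : ∀ (n : ℕ) (x : ℝ), AEStronglyMeasurable (fun y => v y / (x - y) ^ (n + 1)) volume :=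
    fun n x => (hv.1.aemeasurable.div (by fun_prop)).aestronglyMeasurable
  have h := (hasDerivAt_integral_of_dominated_loc_of_deriv_le (μ := volume) (𝕜 := ℝ)
    (F := fun x y => v y / (x - y) ^ (n + 1))
    (F' := fun x y => -(n + 1) * (v y / (x - y) ^ (n + 1 + 1)))
    (bound := fun y => (n + 1) * (((ρ / (2 * (1 + ρ))) ^ (n + 1 + 1))⁻¹ * ‖v y * (1 + |y|)⁻¹‖))
    (isOpen_Ioo.mem_nhds hx) (.of_forall fun x => hmeas n x) ?_ ((hmeas (n + 1) x).const_mul _) ?_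
    ((hw.norm.const_mul _).const_mul _) ?_).2
  · rw [integral_const_mul] at h
    exact h
  · exact (hw.norm.const_mul _).mono' (hmeas n x) (.of_forall (norm_div_pow_le hρ hz n hx))
  · refine .of_forall fun y x' hx' => ?_
    rw [norm_mul, norm_neg, Real.norm_of_nonneg (show (0 : ℝ) ≤ n + 1 by positivity)]
    exact mul_le_mul_of_nonneg_left (norm_div_pow_le hρ hz (n + 1) hx' y) (by positivity)
  · refine .of_forall fun y x' hx' => ?_
    rcases lt_or_ge |y| ρ with hy | hy
    · simp only [hz y hy, zero_div, mul_zero]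
      exact hasDerivAt_const _ _
    · have hne : x' - y ≠ 0 := fun h0 => by
        have h1 : |x'| < ρ / 2 := abs_lt.2 hx'
        rw [sub_eq_zero.1 h0] at h1
        linarith
      have h2 := (hasDerivAt_const x' (v y)).div
        (((hasDerivAt_id x').sub_const y).fun_pow (n + 1)) (pow_ne_zero _ hne)
      refine h2.congr_deriv ?_
      simp only [id, Nat.add_sub_cancel]
      push_cast
      field_simp
      ring

theorem contDiffOn_cauchyPow (hv : MemLp v 2) (hρ : 0 < ρ) (hz : ∀ y, |y| < ρ → v y = 0) (m : ℕ) :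
    ∀ n, ContDiffOn ℝ m (cauchyPow v n) (Ioo (-(ρ / 2)) (ρ / 2)) := by
  induction m with
  | zero =>
    intro n
    refine contDiffOn_zero.2 fun x hx => ?_
    exact (hasDerivAt_cauchyPow hv hρ hz n hx).continuousAt.continuousWithinAt
  | succ m ih =>
    intro n
    push_cast
    refine (contDiffOn_succ_iff_deriv_of_isOpen isOpen_Ioo).2 ⟨fun x hx =>
      (hasDerivAt_cauchyPow hv hρ hz n hx).differentiableAt.differentiableWithinAt, by simp, ?_⟩
    exact (contDiffOn_const.mul (ih (n + 1))).congr fun x hx =>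
      (hasDerivAt_cauchyPow hv hρ hz n hx).deriv

theorem hilbert_eq_cauchyPow (hρ : 0 < ρ) (hz : ∀ y, |y| < ρ → v y = 0) {x : ℝ}
    (hx : x ∈ Ioo (-(ρ / 2)) (ρ / 2)) : hilbert v x = Real.pi⁻¹ * cauchyPow v 0 x := by
  refine HasHilbertAt.eq ?_
  refine tendsto_const_nhds.congr' ?_
  filter_upwards [Ioo_mem_nhdsGT (half_pos hρ)] with ε hε
  rw [truncHilbert, setIntegral_eq_integral_of_forall_compl_eq_zero]
  · simp [cauchyPow]
  · intro y hy
    rw [mem_ofPred_eq, not_lt] at hy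
    have h1 : |x| < ρ / 2 := abs_lt.2 hx
    have h2 : |y| - |x| ≤ |x - y| := by
      rw [abs_sub_comm]; exact abs_sub_abs_le_abs_sub y x
    rw [hz y (by linarith [hε.2]), zero_div]

theorem contDiffAt_hilbert_of_zero_near (hv : MemLp v 2) (hρ : 0 < ρ)
    (hz : ∀ y, |y| < ρ → v y = 0) (m : ℕ) : ContDiffAt ℝ m (hilbert v) 0 := by
  have hmem : Ioo (-(ρ / 2)) (ρ / 2) ∈ 𝓝 (0 : ℝ) :=
    isOpen_Ioo.mem_nhds ⟨by linarith, by linarith⟩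
  have := (contDiff_const (c := Real.pi⁻¹)).contDiffAt.mul
    ((contDiffOn_cauchyPow hv hρ hz m 0).contDiffAt hmem)
  refine this.congr_of_eventuallyEq ?_
  filter_upwards [hmem] with x hx using hilbert_eq_cauchyPow hρ hz hx

theorem iteratedDeriv_two_hilbert_of_zero_near (hv : MemLp v 2) (hρ : 0 < ρ)
    (hz : ∀ y, |y| < ρ → v y = 0) :
    iteratedDeriv 2 (hilbert v) 0 = Real.pi⁻¹ * (2 * cauchyPow v 2 0) := by
  have hmem : Ioo (-(ρ / 2)) (ρ / 2) ∈ 𝓝 (0 : ℝ) :=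
    isOpen_Ioo.mem_nhds ⟨by linarith, by linarith⟩
  have e1 : deriv (hilbert v) =ᶠ[𝓝 0] fun x => Real.pi⁻¹ * (-1 * cauchyPow v 1 x) := by
    filter_upwards [hmem] with x hx
    have h1 := (hasDerivAt_cauchyPow hv hρ hz 0 hx).const_mul Real.pi⁻¹
    have h2 : hilbert v =ᶠ[𝓝 x] fun x => Real.pi⁻¹ * cauchyPow v 0 x := by
      filter_upwards [isOpen_Ioo.mem_nhds hx] with y hy using hilbert_eq_cauchyPow hρ hz hy
    rw [(h1.congr_of_eventuallyEq h2).deriv]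
    simp
  simp only [iteratedDeriv_succ, iteratedDeriv_zero]
  have h3 := ((hasDerivAt_cauchyPow hv hρ hz 1 (mem_of_mem_nhds hmem)).const_mul
    (-1)).const_mul Real.pi⁻¹
  rw [(h3.congr_of_eventuallyEq e1).deriv]
  push_cast
  ring

end far

/-- A cutoff splits `f` into `u`, smooth with compact support, and `v`, zero near the origin, whose
Hilbert transform is a smooth Cauchy integral there. For `u` one derivative is lost, hence order
four. Both parts inherit the sign of `f`: `v` contributes a nonnegative amount to the second
derivative, `u` a positive one. -/
theorem MemH1.contDiffAt_hilbert {f : ℝ → ℝ} (hf : MemH1 f) (hodd : ∀ x, f (-x) = -f x)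
    (hneg : ∀ y, 0 < y → f y < 0) {δ : ℝ} (hδ : 0 < δ)
    (hsmooth : ContDiffOn ℝ 5 f (Ioo (-δ) δ)) (hd : deriv f 0 = 0) :
    ContDiffAt ℝ 4 (_root_.hilbert f) 0 ∧ 0 < iteratedDeriv 2 (_root_.hilbert f) 0 := by
  let χ : ContDiffBump (0 : ℝ) := ⟨δ / 4, δ / 2, by positivity, by linarith⟩
  have hone : ∀ y, |y| < δ / 4 → χ y = 1 := fun y hy =>
    χ.one_of_mem_closedBall (by simpa [Real.norm_eq_abs] using hy.le)
  have hzero : ∀ y, δ / 2 ≤ |y| → χ y = 0 := fun y hy =>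
    χ.zero_of_le_dist (by simpa [Real.norm_eq_abs] using hy)
  set u : ℝ → ℝ := fun y => χ y * f y
  have hu : ContDiff ℝ 5 u := by
    refine contDiff_iff_contDiffAt.2 fun x => ?_
    rcases lt_or_ge |x| δ with hx | hx
    · exact (χ.contDiff (n := 5)).contDiffAt.mul
        (hsmooth.contDiffAt (isOpen_Ioo.mem_nhds (abs_lt.1 hx)))
    · refine (contDiff_const (c := (0 : ℝ))).contDiffAt.congr_of_eventuallyEq ?_
      have : ∀ᶠ y in 𝓝 x, δ / 2 < |y| :=
        continuous_abs.continuousAt.eventually (lt_mem_nhds (by linarith))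
      filter_upwards [this] with y hy
      simp only [u, hzero y hy.le, zero_mul]
  have huc : HasCompactSupport u := χ.hasCompactSupport.mul_right
  have hu1 : MemH1 u := ContDiff.memH1 (hu.of_le (by norm_num)) huc
  set v : ℝ → ℝ := f - u
  have hv : MemH1 v := hf.sub hu1
  have hvz : ∀ y, |y| < δ / 4 → v y = 0 := fun y hy => by simp [v, u, hone y hy]
  have hH : _root_.hilbert f = _root_.hilbert v + _root_.hilbert u := by
    rw [hilbert_sub hf hu1, sub_add_cancel]
  have c1 : ContDiffAt ℝ 4 (_root_.hilbert v) 0 :=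
    contDiffAt_hilbert_of_zero_near hv.memLp (by positivity) hvz 4
  have c2 : ContDiffAt ℝ 4 (_root_.hilbert u) 0 :=
    (contDiff_hilbert 4 (hu.of_le (by norm_num)) huc).contDiffAt
  have hf0 : f 0 = 0 := by simpa using iteratedDeriv_zero_of_odd hodd (k := 0) (by simp)
  have hu0 : deriv u 0 = 0 := by
    have h1 : u =ᶠ[𝓝 0] f := by
      have : ∀ᶠ y in 𝓝 (0 : ℝ), |y| < δ / 4 :=
        continuous_abs.continuousAt.eventually (gt_mem_nhds (by simpa using hδ))
      filter_upwards [this] with y hy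
      simp only [u, hone y hy, one_mul]
    rw [h1.deriv_eq, hd]
  have hupos := hilbert_iteratedDeriv_two_pos (hu.of_le (by norm_num)) huc
    (fun x => by simp only [u, hodd, χ.neg, mul_neg]) hu0
    (fun y hy => mul_nonpos_of_nonneg_of_nonpos χ.nonneg (hneg y hy).le) (ρ := δ / 4)
    (by positivity) (fun y hy => by
      simp only [u, hone y (by rw [abs_of_pos hy.1]; exact hy.2), one_mul]
      exact hneg y hy.1)
  refine ⟨by rw [hH]; exact c1.add c2, ?_⟩
  rw [hH, iteratedDeriv_add (c1.of_le (by norm_num)) (c2.of_le (by norm_num)),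
    iteratedDeriv_two_hilbert (hu.of_le (by norm_num)) huc,
    iteratedDeriv_two_hilbert_of_zero_near hv.memLp (by positivity) hvz]
  refine add_pos_of_nonneg_of_pos ?_ hupos
  have hpi := Real.pi_pos
  refine mul_nonneg (by positivity) (mul_nonneg two_pos.le (integral_nonneg fun y => ?_))
  have hvy : v y = (1 - χ y) * f y := by simp only [v, u, Pi.sub_apply]; ring
  have hχ : 0 ≤ 1 - χ y := sub_nonneg.2 χ.le_one
  simp only [Pi.zero_apply, hvy, zero_sub]
  rcases lt_trichotomy y 0 with hy | hy | hy
  · have h1 := hneg (-y) (by linarith)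
    rw [hodd] at h1
    have h2 : 0 < -y := by linarith
    have h3 : 0 ≤ f y := by linarith
    positivity
  · simp [hy, hf0]
  · refine div_nonneg_of_nonpos (mul_nonpos_of_nonneg_of_nonpos hχ (hneg y hy).le) ?_
    rw [Odd.neg_pow (by decide)]
    exact neg_nonpos.2 (by positivity)

/-! ### The profile and the rescaled asymptotics. -/

theorem memLp_mul_exp_neg_abs {l : ℝ} (hl : 0 < l) :
    MemLp (fun ξ : ℝ => ξ * Real.exp (-l * |ξ|)) 2 := by
  refine ((memLp_exp_neg_abs (half_pos hl)).const_mul (2 / l)).mono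
    (Continuous.aestronglyMeasurable (by fun_prop)) (.of_forall fun ξ => ?_)
  rw [norm_mul, Real.norm_eq_abs, Real.norm_of_nonneg (Real.exp_pos _).le,
    Real.norm_of_nonneg (by positivity)]
  have h1 : l / 2 * |ξ| ≤ Real.exp (l / 2 * |ξ|) := by
    linarith [Real.add_one_le_exp (l / 2 * |ξ|)]
  have h2 : Real.exp (-l * |ξ|) = Real.exp (-(l / 2) * |ξ|) * Real.exp (-(l / 2) * |ξ|) := by
    rw [← Real.exp_add]; ring_nf
  have h3 : Real.exp (l / 2 * |ξ|) * Real.exp (-(l / 2) * |ξ|) = 1 := by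
    rw [← Real.exp_add]; simp
  calc |ξ| * Real.exp (-l * |ξ|)
      = 2 / l * ((l / 2 * |ξ|) * Real.exp (-(l / 2) * |ξ|)) * Real.exp (-(l / 2) * |ξ|) := by
        rw [h2]; field_simp
    _ ≤ 2 / l * (Real.exp (l / 2 * |ξ|) * Real.exp (-(l / 2) * |ξ|)) * Real.exp (-(l / 2) * |ξ|) := by
        gcongr
    _ = _ := by rw [h3, mul_one]

theorem hasHilbertAt_profile {a b c : ℝ} (ha : 0 < a) (hb : 0 < b) (hc : 0 < c) (z : ℝ) :
    HasHilbertAt (profile a b c) z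
      (-(a * b ^ (7 / 2 : ℝ) * z) / (a ^ 4 * c ^ 2 + b ^ 4 * z ^ 2)) := by
  -- The profile is a Poisson kernel of half-width `l / (2π) = a² c / b²`, with `A` the amplitude of
  -- its spectrum.
  set l : ℝ := 2 * Real.pi * (a ^ 2 * c) / b ^ 2
  have hpi := Real.pi_pos
  have hl : 0 < l := by positivity
  set A : ℝ := -(Real.pi * a * b ^ (3 / 2 : ℝ) / b ^ 2)
  have hb72 : b ^ (7 / 2 : ℝ) = b ^ (3 / 2 : ℝ) * b ^ 2 := by
    rw [← Real.rpow_natCast, ← Real.rpow_add hb]; norm_num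
  have hD : ∀ x : ℝ, l ^ 2 + 4 * Real.pi ^ 2 * x ^ 2
      = 4 * Real.pi ^ 2 * (a ^ 4 * c ^ 2 + b ^ 4 * x ^ 2) / b ^ 4 := fun x => by
    simp only [l]; field_simp; ring
  have hDpos : ∀ x : ℝ, 0 < a ^ 4 * c ^ 2 + b ^ 4 * x ^ 2 := fun x => by positivity
  have hs : HasSpectrum (profile a b c) (fun ξ => (A : ℂ) * (Real.exp (-l * |ξ|) : ℂ)) := by
    refine ⟨((integrable_exp_neg_abs hl).ofReal).const_mul _,
      ((memLp_exp_neg_abs hl).ofReal).const_mul _, ?_, fun x => ?_⟩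
    · refine (memLp_congr_ae (.of_forall fun ξ => ?_)).1
        ((memLp_mul_exp_neg_abs hl).ofReal.const_mul (-(2 * Real.pi * Complex.I) * (A : ℂ)))
      change -(2 * Real.pi * Complex.I) * (A : ℂ) * ((ξ * Real.exp (-l * |ξ|) : ℝ) : ℂ) = _
      rw [Complex.ofReal_mul]
      ring
    · rw [fourier_const_mul_apply, fourier_exp_neg_abs hl, ← Complex.ofReal_mul, hD]
      congr 1
      have := (hDpos x).ne'
      rw [profile]
      simp only [A, l]
      field_simp
      ring
  convert hs.hasHilbertAt z using 1
  rw [← Complex.ofReal_inj, hs.hilbert_eq,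
    show (fun ξ => hilbertMul ξ * ((A : ℂ) * (Real.exp (-l * |ξ|) : ℂ)))
      = fun ξ => (A : ℂ) * (hilbertMul ξ * (Real.exp (-l * |ξ|) : ℂ)) from
      funext fun ξ => by ring, fourier_const_mul_apply, fourier_hilbertMul_exp_neg_abs hl,
    ← Complex.ofReal_mul, hD, hb72]
  congr 1
  have := (hDpos z).ne'
  simp only [A]
  field_simp

/-- The error in the denominator is measured relative to `w₀`. In the application `w₀` contains `η /
s`, which may be unbounded, and the absolute error need not be small. -/
theorem norm_div_sub_div_le_of_near {p p₀ w w₀ : ℂ} {m θ : ℝ} (hm : 0 < m) (hw₀ : m ≤ ‖w₀‖)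
    (hθ : θ ≤ 1 / 2) (h : ‖w - w₀‖ ≤ θ * ‖w₀‖) :
    ‖p / w - p₀ / w₀‖ ≤ 2 / m * ‖p - p₀‖ + 2 * ‖p₀‖ / m * θ := by
  have h0 : 0 < ‖w₀‖ := hm.trans_le hw₀
  have hθ0 : 0 ≤ θ := nonneg_of_mul_nonneg_left ((norm_nonneg _).trans h) h0
  have hw : ‖w₀‖ / 2 ≤ ‖w‖ := by
    have h1 : ‖w₀‖ - ‖w‖ ≤ ‖w - w₀‖ := by
      rw [norm_sub_rev]; exact norm_sub_norm_le _ _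
    nlinarith
  have hwpos : 0 < ‖w‖ := by linarith
  have e : p / w - p₀ / w₀ = (p - p₀) / w - p₀ * ((w - w₀) / (w * w₀)) := by
    have : w ≠ 0 := norm_pos_iff.1 hwpos
    have : w₀ ≠ 0 := norm_pos_iff.1 h0
    field_simp
    ring
  rw [e]
  refine (norm_sub_le _ _).trans (add_le_add ?_ ?_)
  · rw [norm_div, div_mul_eq_mul_div, div_le_div_iff₀ hwpos hm]
    nlinarith [norm_nonneg (p - p₀)]
  · rw [norm_mul, norm_div, norm_mul, mul_comm 2 ‖p₀‖, mul_div_assoc, mul_assoc]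
    refine mul_le_mul_of_nonneg_left ?_ (norm_nonneg _)
    rw [div_mul_eq_mul_div, div_le_div_iff₀ (by positivity) hm]
    calc ‖w - w₀‖ * m ≤ θ * ‖w₀‖ * m := by gcongr
      _ = θ * m * ‖w₀‖ := by ring
      _ ≤ θ * (2 * ‖w‖) * ‖w₀‖ := by gcongr; linarith
      _ = _ := by ring

set_option maxHeartbeats 1000000 in
-- Here `s² = T - t` and `x = s (a / β + η)`. In `2 - t h(x)` the term `2 a s²` cancels against the
-- leading part of `(2 β² / a) x²`, leaving `-4 β s² η`, while `-t f(x)` starts with `4 c a² s³ /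
-- β³`. After division by `s³` these are the two parts of the limiting denominator.
theorem exists_rescaled_signal_bound {h f : ℝ → ℝ} {a β c C B : ℝ} (ha : 0 < a) (hβ : 0 < β)
    (hc : 0 < c) (hC : 0 ≤ C) (hB : 0 < B)
    (hh : ∀ x ∈ Icc 0 B, |h x - (2 * a + 2 * β ^ 2 * x ^ 2)| ≤ C * x ^ 4)
    (hf : ∀ x ∈ Icc 0 B, |f x + 4 * c * x ^ 3| ≤ C * x ^ 4) :
    ∃ M ε : ℝ, 0 < ε ∧ ∀ s η : ℝ, 0 < s → s < ε → |η| < ε →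
      ∀ z₀ : ℂ, z₀ = h (s * (a / β + η)) + Complex.I * f (s * (a / β + η)) →
      ‖(s : ℂ) ^ 3 * (2 * z₀ / (2 - ((1 / a - s ^ 2 : ℝ) : ℂ) * z₀))
        - 4 * a / (((-4 * β * (η / s) : ℝ) : ℂ) + Complex.I * ((4 * c * a ^ 2 / β ^ 3 : ℝ) : ℂ))‖
        ≤ M * (|η| + s) := by
  set r := a / β
  have hr : 0 < r := by positivity
  set Y := r + 1
  have hY : 0 < Y := by positivity
  set m := 4 * c * a ^ 2 / β ^ 3
  have hm : 0 < m := by positivity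
  -- `Q` collects the errors that are absolutely small, made relative by `‖w₀‖ ≥ m`. The term `(2 β²
  -- / a) η · η / s` is compared with `‖w₀‖ ≥ 4 β |η / s|` instead, whence `β / (2 a)` in `N`. The
  -- constant `P` is for the numerator.
  set Q := 2 * β ^ 2 * Y ^ 2 + C * Y ^ 4 / a + 12 * c * Y ^ 2 / a + 4 * c * Y ^ 3 + C * Y ^ 4 / a
  have hQ : 0 < Q := by positivity
  set N := β / (2 * a) + Q / m
  have hN : 0 < N := by positivity
  set P := 2 * (2 * β ^ 2 * Y ^ 2 + C * Y ^ 4 + 4 * c * Y ^ 3 + C * Y ^ 4)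
  -- The bounds `r` and `1` give `0 < y ≤ Y` and `s² ≤ s`; `B / Y` keeps `x` in the Taylor interval;
  -- `1 / a` keeps `t` nonnegative; `1 / (4 N)` makes the relative error at most `1 / 2`.
  refine ⟨2 / m * P + 2 * (4 * a) / m * N, min (min r 1) (min (B / Y) (min (1 / a) (1 / (4 * N)))),
    by positivity, fun s η hs hsε hηε z₀ hz₀ => ?_⟩
  simp only [lt_min_iff] at hsε hηε
  obtain ⟨⟨-, hs1⟩, hsB, hsa, hsN⟩ := hsε
  obtain ⟨⟨hηr, hη1⟩, -, -, hηN⟩ := hηε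
  set y := r + η
  have hη := abs_lt.1 hηr
  have hη' := abs_lt.1 hη1
  have hy0 : 0 < y := by simp only [y]; linarith
  have hyY : y ≤ Y := by simp only [y, Y]; linarith
  set x := s * y
  have hx : x ∈ Icc 0 B := by
    refine ⟨by positivity, ?_⟩
    rw [lt_div_iff₀ hY] at hsB
    exact (mul_le_mul_of_nonneg_left hyY hs.le).trans hsB.le
  set E₁ := h x - (2 * a + 2 * β ^ 2 * x ^ 2)
  set E₂ := f x + 4 * c * x ^ 3
  have hxs : C * x ^ 4 ≤ C * Y ^ 4 * s ^ 4 := by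
    simp only [x, mul_pow]
    rw [mul_comm (s ^ 4), ← mul_assoc]
    gcongr
  have hE₁ : |E₁| ≤ C * Y ^ 4 * s ^ 4 := (hh x hx).trans hxs
  have hE₂ : |E₂| ≤ C * Y ^ 4 * s ^ 4 := (hf x hx).trans hxs
  have hhx : h x = 2 * a + 2 * β ^ 2 * x ^ 2 + E₁ := by simp only [E₁]; ring
  have hfx : f x = -(4 * c * x ^ 3) + E₂ := by simp only [E₂]; ring
  set t := 1 / a - s ^ 2
  have hs2 : s ^ 2 ≤ s := by nlinarith
  have ht0 : 0 ≤ t := by simp only [t]; linarith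
  have ht1 : t ≤ 1 / a := by simp only [t]; nlinarith
  have htE : ∀ E : ℝ, |E| ≤ C * Y ^ 4 * s ^ 4 → |t * E / s ^ 3| ≤ C * Y ^ 4 / a * s := by
    intro E hE
    rw [abs_div, abs_mul, abs_of_nonneg ht0, abs_of_pos (pow_pos hs 3), div_le_iff₀ (by positivity)]
    calc t * |E| ≤ 1 / a * (C * Y ^ 4 * s ^ 4) := by gcongr
      _ = _ := by ring
  set w₀ : ℂ := ((-4 * β * (η / s) : ℝ) : ℂ) + Complex.I * (m : ℂ)
  set w : ℂ := (2 - (t : ℂ) * z₀) / (s : ℂ) ^ 3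
  have hw₀re : w₀.re = -4 * β * (η / s) := by simp [w₀]
  have hw₀im : w₀.im = m := by simp [w₀]
  have hw₀m : m ≤ ‖w₀‖ := by
    have := Complex.abs_im_le_norm w₀
    rwa [hw₀im, abs_of_pos hm] at this
  have hw₀η : 4 * β * |η / s| ≤ ‖w₀‖ := by
    have := Complex.abs_re_le_norm w₀
    rwa [hw₀re, abs_mul, neg_mul, abs_neg, abs_of_pos (by positivity : 0 < 4 * β)] at this
  have hwre : w.re = (2 - t * h x) / s ^ 3 := by
    simp only [w, hz₀, ← Complex.ofReal_pow, Complex.div_ofReal_re]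
    simp
  have hwim : w.im = -(t * f x) / s ^ 3 := by
    simp only [w, hz₀, ← Complex.ofReal_pow, Complex.div_ofReal_im]
    simp
  have hre : (w - w₀).re
      = -(2 * β ^ 2 / a) * η * (η / s) + 2 * β ^ 2 * y ^ 2 * s - t * E₁ / s ^ 3 := by
    rw [Complex.sub_re, hwre, hw₀re, hhx]
    simp only [x, y, t, r]
    field_simp
    ring
  have him : (w - w₀).im
      = 4 * c / a * (η * (y ^ 2 + y * r + r ^ 2)) - 4 * c * y ^ 3 * s ^ 2 - t * E₂ / s ^ 3 := by
    rw [Complex.sub_im, hwim, hw₀im, hfx]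
    simp only [x, y, t, r, m]
    field_simp
    ring
  have hrY : r ≤ Y := by simp only [Y]; linarith
  have hnear : ‖w - w₀‖ ≤ N * (|η| + s) * ‖w₀‖ := by
    have b1 : |(w - w₀).re| ≤ 2 * β ^ 2 / a * |η| * |η / s| + 2 * β ^ 2 * Y ^ 2 * s
        + C * Y ^ 4 / a * s := by
      rw [hre]
      refine (abs_sub _ _).trans (add_le_add ((abs_add_le _ _).trans (add_le_add ?_ ?_)) (htE _ hE₁))
      · rw [abs_mul, abs_mul, abs_neg, abs_of_pos (by positivity : 0 < 2 * β ^ 2 / a)]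
      · rw [abs_of_pos (by positivity)]
        gcongr
    have b2 : |(w - w₀).im| ≤ 12 * c * Y ^ 2 / a * |η| + 4 * c * Y ^ 3 * s
        + C * Y ^ 4 / a * s := by
      rw [him]
      refine (abs_sub _ _).trans (add_le_add ((abs_sub _ _).trans (add_le_add ?_ ?_)) (htE _ hE₂))
      · rw [abs_mul, abs_mul, abs_of_pos (by positivity : 0 < 4 * c / a),
          abs_of_pos (by positivity : 0 < y ^ 2 + y * r + r ^ 2)]
        calc 4 * c / a * (|η| * (y ^ 2 + y * r + r ^ 2))
            ≤ 4 * c / a * (|η| * (Y ^ 2 + Y * Y + Y ^ 2)) := by gcongr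
          _ = _ := by ring
      · rw [abs_of_pos (by positivity)]
        gcongr
    have b3 : 2 * β ^ 2 / a * |η| * |η / s| ≤ β / (2 * a) * |η| * ‖w₀‖ := by
      calc 2 * β ^ 2 / a * |η| * |η / s| = β / (2 * a) * |η| * (4 * β * |η / s|) := by
            field_simp; ring
        _ ≤ _ := by gcongr
    have b4 : Q * (|η| + s) ≤ Q / m * (|η| + s) * ‖w₀‖ := by
      calc Q * (|η| + s) = Q / m * (|η| + s) * m := by field_simp
        _ ≤ _ := by gcongr
    have b5 : 2 * β ^ 2 * Y ^ 2 * s + C * Y ^ 4 / a * s + (12 * c * Y ^ 2 / a * |η|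
        + 4 * c * Y ^ 3 * s + C * Y ^ 4 / a * s) ≤ Q * (|η| + s) := by
      have e : Q * (|η| + s) - (2 * β ^ 2 * Y ^ 2 * s + C * Y ^ 4 / a * s
        + (12 * c * Y ^ 2 / a * |η| + 4 * c * Y ^ 3 * s + C * Y ^ 4 / a * s))
        = (2 * β ^ 2 * Y ^ 2 + C * Y ^ 4 / a + 4 * c * Y ^ 3 + C * Y ^ 4 / a) * |η|
          + 12 * c * Y ^ 2 / a * s := by simp only [Q]; ring
      have : 0 ≤ (2 * β ^ 2 * Y ^ 2 + C * Y ^ 4 / a + 4 * c * Y ^ 3 + C * Y ^ 4 / a) * |η|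
          + 12 * c * Y ^ 2 / a * s := by positivity
      linarith
    have b6 : β / (2 * a) * |η| * ‖w₀‖ ≤ β / (2 * a) * (|η| + s) * ‖w₀‖ := by
      gcongr; linarith
    have b7 := Complex.norm_le_abs_re_add_abs_im (w - w₀)
    have b8 : N * (|η| + s) * ‖w₀‖ = β / (2 * a) * (|η| + s) * ‖w₀‖ + Q / m * (|η| + s) * ‖w₀‖ := by
      simp only [N]; ring
    linarith
  have hθ : N * (|η| + s) ≤ 1 / 2 := by
    rw [lt_div_iff₀ (by positivity)] at hsN hηN
    linarith
  have hp : ‖2 * z₀ - 4 * a‖ ≤ P * s := by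
    have e : 2 * z₀ - 4 * a = ((2 * (h x - 2 * a) : ℝ) : ℂ) + Complex.I * ((2 * f x : ℝ) : ℂ) := by
      rw [hz₀]; push_cast; ring
    have a1 : |h x - 2 * a| ≤ (2 * β ^ 2 * Y ^ 2 + C * Y ^ 4) * s := by
      rw [show h x - 2 * a = 2 * β ^ 2 * y ^ 2 * s ^ 2 + E₁ by rw [hhx]; simp only [x]; ring]
      have s4 : s ^ 4 ≤ s := pow_le_of_le_one hs.le hs1.le (by norm_num)
      refine (abs_add_le _ _).trans ?_
      rw [abs_of_pos (by positivity), add_mul]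
      refine add_le_add (by gcongr) (hE₁.trans (by gcongr))
    have a2 : |f x| ≤ (4 * c * Y ^ 3 + C * Y ^ 4) * s := by
      rw [show f x = -(4 * c * y ^ 3 * s ^ 3) + E₂ by rw [hfx]; simp only [x]; ring]
      have s4 : s ^ 4 ≤ s := pow_le_of_le_one hs.le hs1.le (by norm_num)
      have s3 : s ^ 3 ≤ s := pow_le_of_le_one hs.le hs1.le (by norm_num)
      refine (abs_add_le _ _).trans ?_
      rw [abs_neg, abs_of_pos (by positivity), add_mul]
      refine add_le_add (by gcongr) (hE₂.trans (by gcongr))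
    rw [e]
    refine (norm_add_le _ _).trans ?_
    rw [norm_mul, Complex.norm_I, one_mul, Complex.norm_real, Complex.norm_real, Real.norm_eq_abs,
      Real.norm_eq_abs, abs_mul, abs_mul, abs_two]
    simp only [P]
    linarith
  have hfin := norm_div_sub_div_le_of_near (p := 2 * z₀) (p₀ := 4 * a) hm hw₀m hθ hnear
  have e1 : (2 * z₀) / w = (s : ℂ) ^ 3 * (2 * z₀ / (2 - (t : ℂ) * z₀)) := by
    simp only [w]
    rw [div_div_eq_mul_div]
    ring
  have e2 : ‖(4 * a : ℂ)‖ = 4 * a := by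
    rw [norm_mul, Complex.norm_real, Real.norm_of_nonneg ha.le]; norm_num
  rw [e1, e2] at hfin
  refine hfin.trans ?_
  have hP : 0 ≤ P := by positivity
  calc 2 / m * ‖2 * z₀ - 4 * a‖ + 2 * (4 * a) / m * (N * (|η| + s))
      ≤ 2 / m * (P * (|η| + s)) + 2 * (4 * a) / m * (N * (|η| + s)) := by
        gcongr
        exact hp.trans (mul_le_mul_of_nonneg_left (by linarith [abs_nonneg η]) hP)
    _ = _ := by ring

theorem rescaled_limit_eq {a b c β : ℝ} (ha : 0 < a) (hb : 0 < b) (hc : 0 < c)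
    (hβ : β = b ^ (1 / 2 : ℝ)) (z : ℝ) :
    4 * (a : ℂ) / (((-4 * β * z : ℝ) : ℂ) + Complex.I * ((4 * c * a ^ 2 / β ^ 3 : ℝ) : ℂ))
      = ((-(a * b ^ (7 / 2 : ℝ) * z) / (a ^ 4 * c ^ 2 + b ^ 4 * z ^ 2) : ℝ) : ℂ)
        + Complex.I * (profile a b c z : ℂ) := by
  have hβ0 : 0 < β := hβ ▸ Real.rpow_pos_of_pos hb _
  have e1 : b = β ^ 2 := by
    rw [hβ, ← Real.rpow_natCast, ← Real.rpow_mul hb.le]; norm_num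
  have e3 : b ^ (3 / 2 : ℝ) = β ^ 3 := by
    rw [hβ, ← Real.rpow_natCast, ← Real.rpow_mul hb.le]; norm_num
  have e7 : b ^ (7 / 2 : ℝ) = β ^ 7 := by
    rw [hβ, ← Real.rpow_natCast, ← Real.rpow_mul hb.le]; norm_num
  have hD : 0 < a ^ 4 * c ^ 2 + β ^ 8 * z ^ 2 := by positivity
  have hne : ((-4 * β * z : ℝ) : ℂ) + Complex.I * ((4 * c * a ^ 2 / β ^ 3 : ℝ) : ℂ) ≠ 0 := fun h => by
    have := congrArg Complex.im h
    simp only [Complex.add_im, Complex.ofReal_im, Complex.I_mul_im, Complex.ofReal_re,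
      Complex.zero_im, zero_add] at this
    have h2 : 0 < 4 * c * a ^ 2 / β ^ 3 := by positivity
    linarith
  rw [div_eq_iff hne, profile, e3, e7, e1]
  refine Complex.ext ?_ ?_
  · simp only [Complex.mul_re, Complex.mul_im, Complex.add_re, Complex.add_im, Complex.ofReal_re, Complex.ofReal_im,
      Complex.I_re, Complex.I_im, Complex.re_ofNat, Complex.im_ofNat]
    field_simp
    ring
  · simp only [Complex.mul_im, Complex.mul_re, Complex.add_re, Complex.add_im, Complex.ofReal_re, Complex.ofReal_im,
      Complex.I_re, Complex.I_im, Complex.re_ofNat, Complex.im_ofNat]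
    field_simp
    ring

/-- The constant is chosen before the path, and the error is kept as `|η| + s`; both the `o(1)` and
the `O((T - t)^{1/2})` statements follow from this one bound. -/
theorem exists_clmSignal_bound {f : ℝ → ℝ} {a b c C B : ℝ} (ha : 0 < a) (hb : 0 < b)
    (hc : 0 < c) (hC : 0 ≤ C) (hB : 0 < B)
    (hh : ∀ x ∈ Icc 0 B, |hilbert f x - (2 * a + 2 * b * x ^ 2)| ≤ C * x ^ 4)
    (hf : ∀ x ∈ Icc 0 B, |f x + 4 * c * x ^ 3| ≤ C * x ^ 4) :
    ∃ M : ℝ, 0 ≤ M ∧ ∀ T r : ℝ, T = 1 / a → r = a / b ^ (1 / 2 : ℝ) → ∀ x : ℝ → ℝ,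
      (fun t => x t - r * (T - t) ^ (1 / 2 : ℝ)) =o[𝓝[<] T] (fun t => (T - t) ^ (1 / 2 : ℝ)) →
      ∀ᶠ t in 𝓝[<] T,
        ‖(((T - t) ^ (3 / 2 : ℝ) : ℝ) : ℂ) * clmSignal f t (x t)
          - (((-(a * b ^ (7 / 2 : ℝ) * ((x t - r * (T - t) ^ (1 / 2 : ℝ)) / (T - t)))
              / (a ^ 4 * c ^ 2 + b ^ 4 * ((x t - r * (T - t) ^ (1 / 2 : ℝ)) / (T - t)) ^ 2) : ℝ) : ℂ)
            + Complex.I * (profile a b c ((x t - r * (T - t) ^ (1 / 2 : ℝ)) / (T - t)) : ℂ))‖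
        ≤ M * (|x t - r * (T - t) ^ (1 / 2 : ℝ)| / (T - t) ^ (1 / 2 : ℝ) + (T - t) ^ (1 / 2 : ℝ)) := by
  obtain ⟨β, hβ⟩ : ∃ β, β = b ^ (1 / 2 : ℝ) := ⟨_, rfl⟩
  have hβ0 : 0 < β := hβ ▸ Real.rpow_pos_of_pos hb _
  have hbβ : b = β ^ 2 := by
    rw [hβ, ← Real.rpow_natCast, ← Real.rpow_mul hb.le]; norm_num
  obtain ⟨M, ε, hε, hM⟩ := exists_rescaled_signal_bound (h := hilbert f) ha hβ0 hc hC hB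
    (by rwa [hbβ] at hh) hf
  refine ⟨|M|, abs_nonneg _, fun T r hT hr x hx => ?_⟩
  have hs0 : Tendsto (fun t : ℝ => (T - t) ^ (1 / 2 : ℝ)) (𝓝[<] T) (𝓝 0) := by
    have h1 : Continuous fun t : ℝ => (T - t) ^ (1 / 2 : ℝ) :=
      (continuous_const.sub continuous_id).rpow_const fun _ => Or.inr (by norm_num)
    have h2 := h1.tendsto T
    rw [sub_self, Real.zero_rpow (by norm_num)] at h2
    exact h2.mono_left nhdsWithin_le_nhds
  have hη0 := hx.tendsto_div_nhds_zero.abs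
  rw [abs_zero] at hη0
  filter_upwards [hs0.eventually_lt_const hε, hη0.eventually_lt_const hε, self_mem_nhdsWithin]
    with t h1 h2 h3
  have hTt : 0 < T - t := sub_pos.2 h3
  obtain ⟨s, hs⟩ : ∃ s, s = (T - t) ^ (1 / 2 : ℝ) := ⟨_, rfl⟩
  have hs' : 0 < s := hs ▸ Real.rpow_pos_of_pos hTt _
  have hs2 : T - t = s ^ 2 := by
    rw [hs, ← Real.rpow_natCast, ← Real.rpow_mul hTt.le]; norm_num
  have hs3 : (T - t) ^ (3 / 2 : ℝ) = s ^ 3 := by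
    rw [hs, ← Real.rpow_natCast, ← Real.rpow_mul hTt.le]; norm_num
  rw [← hs] at h1 h2
  rw [← hs, hs3, hs2]
  have hxe : s * (a / β + (x t - r * s) / s) = x t := by
    rw [hr, ← hβ]; field_simp; ring
  have hte : 1 / a - s ^ 2 = t := by rw [← hs2, hT]; ring
  have key := hM s ((x t - r * s) / s) hs' h1 h2 (analyticSignal f (x t)) (by rw [hxe]; rfl)
  rw [hte, rescaled_limit_eq ha hb hc hβ,
    show (x t - r * s) / s / s = (x t - r * s) / s ^ 2 by rw [div_div, sq]] at key
  rw [Complex.ofReal_pow, clmSignal]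
  refine key.trans ?_
  rw [abs_div, abs_of_pos hs']
  exact mul_le_mul_of_nonneg_right (le_abs_self M) (by positivity)

/-! ### Blow-up, maximality and the main theorem. -/

theorem tendsto_iSup_enorm_of_profile {ω : ℝ → ℝ → ℝ} {y : ℝ → ℝ} {T k : ℝ} (hk : k ≠ 0)
    (h : Tendsto (fun t => (T - t) ^ (3 / 2 : ℝ) * ω t (y t)) (𝓝[<] T) (𝓝 k)) :
    Tendsto (fun t => ⨆ x, ‖ω t x‖ₑ) (𝓝[<] T) (𝓝 ⊤) := by
  have h1 : Tendsto (fun t : ℝ => (T - t) ^ (3 / 2 : ℝ)) (𝓝[<] T) (𝓝[>] 0) := by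
    refine tendsto_nhdsWithin_iff.2 ⟨?_, ?_⟩
    · have h1 : Continuous fun t : ℝ => (T - t) ^ (3 / 2 : ℝ) :=
        (continuous_const.sub continuous_id).rpow_const fun _ => Or.inr (by norm_num)
      have h2 := h1.tendsto T
      rw [sub_self, Real.zero_rpow (by norm_num)] at h2
      exact h2.mono_left nhdsWithin_le_nhds
    · filter_upwards [self_mem_nhdsWithin] with t ht
      exact Real.rpow_pos_of_pos (sub_pos.2 ht) _
  have h2 := h.abs.pos_mul_atTop (abs_pos.2 hk) h1.inv_tendsto_nhdsGT_zero
  refine tendsto_nhds_top_mono (ENNReal.tendsto_ofReal_atTop.comp h2) ?_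
  filter_upwards [self_mem_nhdsWithin] with t ht
  refine le_trans (le_of_eq ?_) (le_iSup (fun x => ‖ω t x‖ₑ) (y t))
  have h3 : 0 < (T - t) ^ (3 / 2 : ℝ) := Real.rpow_pos_of_pos (sub_pos.2 ht) _
  rw [← ofReal_norm, Real.norm_eq_abs]
  simp only [Function.comp_apply, Pi.inv_apply]
  rw [abs_mul, abs_of_pos h3]
  congr 1
  field_simp

/-- A solution living beyond `T` would be bounded on `[0, T]`, yet by uniqueness it agrees with the
unbounded `ω` before `T`. -/
theorem IsCLMSolution.le_and_eq {f : ℝ → ℝ} {T T' : ℝ} {ω ω' : ℝ → ℝ → ℝ}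
    (h : IsCLMSolution f T ω) (h' : IsCLMSolution f T' ω') (hT : 0 < T)
    (hblow : Tendsto (fun t => ⨆ x, ‖ω t x‖ₑ) (𝓝[<] T) (𝓝 ⊤)) :
    T' ≤ T ∧ ∀ t ∈ Ico 0 T', ω' t = ω t := by
  have hle : T' ≤ T := by
    by_contra! hlt
    obtain ⟨K, -, hb⟩ := h'.regular.exists_abs_le hlt
    have heq := h.unique (h'.mono hlt.le)
    have h1 := hblow.eventually_const_lt (ENNReal.ofReal_lt_top (r := K))
    have h2 : ∀ᶠ t in 𝓝[<] T, t ∈ Ioo 0 T := Ioo_mem_nhdsLT hT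
    obtain ⟨t, ht1, ht2⟩ := (h1.and h2).exists
    refine absurd ht1 (not_lt.2 (iSup_le fun x => ?_))
    rw [heq t ⟨ht2.1.le, ht2.2⟩, ← ofReal_norm]
    exact ENNReal.ofReal_le_ofReal ((hb t ⟨ht2.1.le, ht2.2.le⟩).2 x).1
  exact ⟨hle, h'.unique (h.mono hle)⟩

theorem theorem2p2 (ω₀ : ℝ → ℝ) (hω₀ : MemH1 ω₀)
    (hodd : ∀ x, ω₀ (-x) = -ω₀ x)
    (hzero : ∀ x, ω₀ x = 0 ↔ x = 0)
    (hsign : ∀ x, SignType.sign (ω₀ x) = -SignType.sign x)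
    (δ : ℝ) (hδ : 0 < δ) (hsmooth : ContDiffOn ℝ 5 ω₀ (Ioo (-δ) δ))
    (hderiv : deriv ω₀ 0 = 0) (hderiv3 : iteratedDeriv 3 ω₀ 0 < 0) :
    -- the Hilbert transform of the initial value exists everywhere and is `C²` near the origin
    (∀ x, HasHilbertAt ω₀ x (hilbert ω₀ x)) ∧ ContDiffAt ℝ 2 (hilbert ω₀) 0 ∧
    0 < hilbert ω₀ 0 ∧ 0 < iteratedDeriv 2 (hilbert ω₀) 0 ∧
    ∀ a b c : ℝ, 0 < a → 0 < b → 0 < c →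
      hilbert ω₀ 0 = 2 * a → iteratedDeriv 2 (hilbert ω₀) 0 = 4 * b →
      iteratedDeriv 3 ω₀ 0 = -24 * c →
      ∀ T r : ℝ, T = 1 / a → r = a / b ^ (1 / 2 : ℝ) →
      -- the Hilbert transform of the profile
      (∀ z, HasHilbertAt (profile a b c) z
        (-(a * b ^ (7 / 2 : ℝ) * z) / (a ^ 4 * c ^ 2 + b ^ 4 * z ^ 2))) ∧
      -- the solution exists on `[0,T)`, is unique, and cannot be continued beyond `T`
      ∃ ω : ℝ → ℝ → ℝ, IsCLMSolution ω₀ T ω ∧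
        (∀ (T' : ℝ) (ω' : ℝ → ℝ → ℝ), IsCLMSolution ω₀ T' ω' →
          T' ≤ T ∧ ∀ t ∈ Ico 0 T', ω' t = ω t) ∧
        (∀ t ∈ Ico 0 T, ∀ x, HasHilbertAt (ω t) x (hilbert (ω t) x)) ∧
        -- it blows up at `T`
        Tendsto (fun t => ⨆ x, ‖ω t x‖ₑ) (𝓝[<] T) (𝓝 ⊤) ∧
        -- for `x = r (T-t)^{1/2} + o((T-t)^{1/2})`
        (∀ x : ℝ → ℝ,
          (fun t => x t - r * (T - t) ^ (1 / 2 : ℝ))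
            =o[𝓝[<] T] (fun t => (T - t) ^ (1 / 2 : ℝ)) →
          (fun t => (T - t) ^ (3 / 2 : ℝ) * ω t (x t)
              - profile a b c ((x t - r * (T - t) ^ (1 / 2 : ℝ)) / (T - t)))
            =o[𝓝[<] T] (fun _ => (1 : ℝ)) ∧
          (fun t => (T - t) ^ (3 / 2 : ℝ) * hilbert (ω t) (x t)
              - hilbert (profile a b c) ((x t - r * (T - t) ^ (1 / 2 : ℝ)) / (T - t)))
            =o[𝓝[<] T] (fun _ => (1 : ℝ))) ∧
        -- for `x = r (T-t)^{1/2} + O(T-t)`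
        (∀ x : ℝ → ℝ,
          (fun t => x t - r * (T - t) ^ (1 / 2 : ℝ)) =O[𝓝[<] T] (fun t => T - t) →
          (fun t => (T - t) ^ (3 / 2 : ℝ) * ω t (x t)
              - profile a b c ((x t - r * (T - t) ^ (1 / 2 : ℝ)) / (T - t)))
            =O[𝓝[<] T] (fun t => (T - t) ^ (1 / 2 : ℝ)) ∧
          (fun t => (T - t) ^ (3 / 2 : ℝ) * hilbert (ω t) (x t)
              - hilbert (profile a b c) ((x t - r * (T - t) ^ (1 / 2 : ℝ)) / (T - t)))
            =O[𝓝[<] T] (fun t => (T - t) ^ (1 / 2 : ℝ))) := by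
  have hneg : ∀ y, 0 < y → ω₀ y < 0 := fun y hy => by
    have := hsign y
    rw [sign_pos hy] at this
    exact sign_eq_neg_one_iff.1 this
  obtain ⟨hsm, hpos2⟩ := hω₀.contDiffAt_hilbert hodd hneg hδ hsmooth hderiv
  refine ⟨hω₀.hasHilbertAt, hsm.of_le (by norm_num), hω₀.hilbert_zero_pos hodd hneg, hpos2, ?_⟩
  intro a b c ha hb hc hH0 hH2 hf3 T r hT hr
  have hprof := fun z => hasHilbertAt_profile ha hb hc z
  refine ⟨hprof, ?_⟩
  have hT0 : 0 < T := hT ▸ by positivity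
  -- At a zero the imaginary part forces `x = 0`, and then the real part forces `t = 1 / a`.
  have hne : ∀ t ∈ Ico 0 T, ∀ x, (2 : ℂ) - t * analyticSignal ω₀ x ≠ 0 := by
    intro t ht x h0
    have him := congrArg Complex.im h0
    have hre := congrArg Complex.re h0
    simp [analyticSignal] at him hre
    have ht0 : t ≠ 0 := by rintro rfl; norm_num at hre
    have hx : x = 0 := (hzero x).1 (him.resolve_left ht0)
    rw [hx, hH0] at hre
    have : t = T := by rw [hT, eq_div_iff ha.ne']; linarith
    exact ht.2.ne this
  obtain ⟨hsol, hhil⟩ := hω₀.isCLMSolution hne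
  obtain ⟨C₁, B₁, hB₁, hC₁⟩ := ContDiffAt.exists_taylor_bound (f := hilbert ω₀) 3
    (by norm_num; exact hsm)
  have hsm0 : ContDiffAt ℝ 5 ω₀ 0 := hsmooth.contDiffAt (isOpen_Ioo.mem_nhds ⟨by linarith, hδ⟩)
  obtain ⟨C₂, B₂, hB₂, hC₂⟩ := ContDiffAt.exists_taylor_bound (f := ω₀) 3
    (hsm0.of_le (by norm_num))
  -- Parity and `ω₀'(0) = 0` remove all Taylor coefficients up to order three except those named
  -- `a`, `b`, `c`.
  have heven := hilbert_even_of_odd hodd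
  have k1 : iteratedDeriv 1 (hilbert ω₀) 0 = 0 := iteratedDeriv_zero_of_even heven odd_one
  have k3 : iteratedDeriv 3 (hilbert ω₀) 0 = 0 := iteratedDeriv_zero_of_even heven (by decide)
  have l1 : iteratedDeriv 1 ω₀ 0 = 0 := by rw [iteratedDeriv_one, hderiv]
  have l2 : iteratedDeriv 2 ω₀ 0 = 0 := iteratedDeriv_zero_of_odd hodd (by decide)
  have l0 : ω₀ 0 = 0 := (hzero 0).2 rfl
  simp only [Finset.sum_range_succ, Finset.sum_range_zero, k1, k3, l1, l2, iteratedDeriv_zero, hH0,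
    hH2, hf3, l0] at hC₁ hC₂
  obtain ⟨M, hM0, hM⟩ := exists_clmSignal_bound (f := ω₀) (C := max 0 (max C₁ C₂))
    (B := min B₁ B₂) ha hb hc (le_max_left _ _) (lt_min hB₁ hB₂)
    (fun x hx => by
      have h1 := hC₁ x ⟨hx.1, hx.2.trans (min_le_left _ _)⟩
      have h2 : C₁ * x ^ 4 ≤ max 0 (max C₁ C₂) * x ^ 4 := by
        have := hx.1
        gcongr
        exact (le_max_left _ _).trans (le_max_right _ _)
      refine le_trans (le_of_eq ?_) (h1.trans h2)
      congr 1
      norm_num [Nat.factorial]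
      ring)
    (fun x hx => by
      have h1 := hC₂ x ⟨hx.1, hx.2.trans (min_le_right _ _)⟩
      have h2 : C₂ * x ^ 4 ≤ max 0 (max C₁ C₂) * x ^ 4 := by
        have := hx.1
        gcongr
        exact (le_max_right _ _).trans (le_max_right _ _)
      refine le_trans (le_of_eq ?_) (h1.trans h2)
      congr 1
      norm_num [Nat.factorial]
      ring)
  have hbd : ∀ x : ℝ → ℝ, (fun t => x t - r * (T - t) ^ (1 / 2 : ℝ))
      =o[𝓝[<] T] (fun t => (T - t) ^ (1 / 2 : ℝ)) → ∀ᶠ t in 𝓝[<] T,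
      ‖(T - t) ^ (3 / 2 : ℝ) * clmSol ω₀ t (x t)
        - profile a b c ((x t - r * (T - t) ^ (1 / 2 : ℝ)) / (T - t))‖
        ≤ M * (|x t - r * (T - t) ^ (1 / 2 : ℝ)| / (T - t) ^ (1 / 2 : ℝ) + (T - t) ^ (1 / 2 : ℝ)) ∧
      ‖(T - t) ^ (3 / 2 : ℝ) * hilbert (clmSol ω₀ t) (x t)
        - hilbert (profile a b c) ((x t - r * (T - t) ^ (1 / 2 : ℝ)) / (T - t))‖
        ≤ M * (|x t - r * (T - t) ^ (1 / 2 : ℝ)| / (T - t) ^ (1 / 2 : ℝ)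
          + (T - t) ^ (1 / 2 : ℝ)) := by
    intro x hx
    filter_upwards [hM T r hT hr x hx, Ioo_mem_nhdsLT hT0] with t ht htI
    rw [(hprof _).eq, congrFun (hhil t ⟨htI.1.le, htI.2⟩) (x t)]
    refine ⟨le_trans (le_of_eq ?_) ((Complex.abs_im_le_norm _).trans ht),
      le_trans (le_of_eq ?_) ((Complex.abs_re_le_norm _).trans ht)⟩
    · rw [Real.norm_eq_abs, clmSol, Complex.sub_im, Complex.im_ofReal_mul, Complex.add_im,
        Complex.ofReal_im, Complex.I_mul_im, Complex.ofReal_re, zero_add]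
    · rw [Real.norm_eq_abs, Complex.sub_re, Complex.re_ofReal_mul, Complex.add_re,
        Complex.ofReal_re, Complex.I_mul_re, Complex.ofReal_im, neg_zero, add_zero]
  have hs0 : Tendsto (fun t : ℝ => (T - t) ^ (1 / 2 : ℝ)) (𝓝[<] T) (𝓝 0) := by
    have h1 : Continuous fun t : ℝ => (T - t) ^ (1 / 2 : ℝ) :=
      (continuous_const.sub continuous_id).rpow_const fun _ => Or.inr (by norm_num)
    have h2 := h1.tendsto T
    rw [sub_self, Real.zero_rpow (by norm_num)] at h2
    exact h2.mono_left nhdsWithin_le_nhds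
  have hlittle : ∀ x : ℝ → ℝ, (fun t => x t - r * (T - t) ^ (1 / 2 : ℝ))
      =o[𝓝[<] T] (fun t => (T - t) ^ (1 / 2 : ℝ)) → Tendsto (fun t => M *
      (|x t - r * (T - t) ^ (1 / 2 : ℝ)| / (T - t) ^ (1 / 2 : ℝ) + (T - t) ^ (1 / 2 : ℝ)))
      (𝓝[<] T) (𝓝 0) := by
    intro x hx
    have h1 := hx.norm_left.tendsto_div_nhds_zero
    simpa using (h1.add hs0).const_mul M
  have hasymp : ∀ x : ℝ → ℝ, (fun t => x t - r * (T - t) ^ (1 / 2 : ℝ))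
      =o[𝓝[<] T] (fun t => (T - t) ^ (1 / 2 : ℝ)) →
      (fun t => (T - t) ^ (3 / 2 : ℝ) * clmSol ω₀ t (x t)
          - profile a b c ((x t - r * (T - t) ^ (1 / 2 : ℝ)) / (T - t)))
        =o[𝓝[<] T] (fun _ => (1 : ℝ)) ∧
      (fun t => (T - t) ^ (3 / 2 : ℝ) * hilbert (clmSol ω₀ t) (x t)
          - hilbert (profile a b c) ((x t - r * (T - t) ^ (1 / 2 : ℝ)) / (T - t)))
        =o[𝓝[<] T] (fun _ => (1 : ℝ)) := by
    intro x hx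
    rw [isLittleO_one_iff, isLittleO_one_iff]
    exact ⟨squeeze_zero_norm' ((hbd x hx).mono fun t h => h.1) (hlittle x hx),
      squeeze_zero_norm' ((hbd x hx).mono fun t h => h.2) (hlittle x hx)⟩
  have hblow : Tendsto (fun t => ⨆ x, ‖clmSol ω₀ t x‖ₑ) (𝓝[<] T) (𝓝 ⊤) := by
    -- Along the exact path `x = r (T - t)^{1/2}` the rescaled solution tends to `profile a b c 0 ≠
    -- 0`.
    have h1 := (hasymp (fun t => r * (T - t) ^ (1 / 2 : ℝ)) (by simp)).1
    simp only [sub_self, zero_div] at h1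
    rw [isLittleO_one_iff] at h1
    have h2 := h1.add_const (profile a b c 0)
    simp only [sub_add_cancel, zero_add] at h2
    refine tendsto_iSup_enorm_of_profile ?_ h2
    rw [profile]
    have := Real.rpow_pos_of_pos hb (3 / 2)
    exact div_ne_zero (neg_ne_zero.2 (by positivity)) (by positivity)
  refine ⟨clmSol ω₀, hsol, fun T' ω' h' => hsol.le_and_eq h' hT0 hblow,
    fun t ht => (hsol.regular.memH1 t ht).hasHilbertAt, hblow, hasymp, fun x hx => ?_⟩
  have hpow : (fun t : ℝ => T - t) =ᶠ[𝓝[<] T]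
      fun t => (T - t) ^ (1 / 2 : ℝ) * (T - t) ^ (1 / 2 : ℝ) := by
    filter_upwards [self_mem_nhdsWithin] with t ht
    have : 0 < T - t := sub_pos.2 ht
    rw [← Real.rpow_add this]; norm_num
  -- A deviation `O(T - t)` is in particular `o((T - t)^{1/2})`, so the same bound applies; dividing
  -- it by `(T - t)^{1/2}` leaves the stated rate.
  have hlo : (fun t : ℝ => T - t) =o[𝓝[<] T] (fun t => (T - t) ^ (1 / 2 : ℝ)) := by
    refine hpow.trans_isLittleO ?_
    simpa using ((isLittleO_one_iff ℝ).2 hs0).mul_isBigO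
      (isBigO_refl (fun t : ℝ => (T - t) ^ (1 / 2 : ℝ)) (𝓝[<] T))
  obtain ⟨K, hK⟩ := hx.bound
  have hO : ∀ᶠ t in 𝓝[<] T, M * (|x t - r * (T - t) ^ (1 / 2 : ℝ)| / (T - t) ^ (1 / 2 : ℝ)
      + (T - t) ^ (1 / 2 : ℝ)) ≤ M * (K + 1) * ‖(T - t) ^ (1 / 2 : ℝ)‖ := by
    filter_upwards [hK, hpow, self_mem_nhdsWithin] with t h1 h2 h3
    have hTt : 0 < T - t := sub_pos.2 h3
    have hs : 0 < (T - t) ^ (1 / 2 : ℝ) := Real.rpow_pos_of_pos hTt _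
    rw [Real.norm_of_nonneg hs.le, mul_assoc]
    refine mul_le_mul_of_nonneg_left ?_ hM0
    rw [add_mul, one_mul]
    refine add_le_add_left ?_ _
    rw [div_le_iff₀ hs, mul_assoc, ← h2]
    simpa [Real.norm_eq_abs, abs_of_pos hTt] using h1
  have hb2 := hbd x (hx.trans_isLittleO hlo)
  exact ⟨IsBigO.of_bound (M * (K + 1)) ((hb2.and hO).mono fun t h => h.1.1.trans h.2),
    IsBigO.of_bound (M * (K + 1)) ((hb2.and hO).mono fun t h => h.1.2.trans h.2)⟩
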